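/- Let $\mathfrak g$ be a finite-dimensional simple complex Lie algebra with Cartan subalgebra $\mathfrak h$ and Killing form $(\cdot,\cdot)$. Let $A=\mathbb C[t_1^{\pm1},\dots,t_n^{\pm1}]$, let $\Omega_A$ be the free $A$-module with basis $K_1,\dots,K_n$, let $dA\subset\Omega_A$ be the span of the elements $\sum_i m_it^mK_i$ ($m\in\mathbb Z^n$), and let $\mathcal K_A=\Omega_A/dA$. Let $d_i=t_i\,\partial/\partial t_i$, so that the $t^rd_i$ form a basis of $\mathrm{Der}(A)$. Let $c_1,c_2\in\mathbb C$ and $\phi=c_1\phi_1+c_2\phi_2$, where $$\phi_1(t^rd_i,t^sd_j)=-s_ir_j\sum_p r_pt^{r+s}K_p,\qquad \phi_2(t^rd_i,t^sd_j)=r_is_j\sum_p r_pt^{r+s}K_p .$$ The full toroidal Lie algebra is $\mathcal L=\mathfrak g\otimes A\oplus\mathcal K_A\oplus\mathrm{Der}(A)$ with brackets, where $x(r)=x\otimes t^r$, $$[x(r),y(s)]=[x,y](r+s)+(x,y)\sum_i r_it^{r+s}K_i,\quad [\mathfrak g\otimes A,\mathcal K_A]=[\mathcal K_A,\mathcal K_A]=0,\quad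 [t^rd_i,x(s)]=s_i\,x(r+s),$$ $$[t^rd_i,t^sK_j]=s_it^{r+s}K_j+\delta_{ij}\sum_p r_pt^{r+s}K_p,\quad [t^rd_i,t^sd_j]=s_it^{r+s}d_j-r_jt^{r+s}d_i+\phi(t^rd_i,t^sd_j).$$ Put $\tilde{\mathfrak h}_n=\mathfrak h\oplus\bigoplus_i\mathbb Cd_i\subset\mathcal L$. For a Lie algebra $\mathfrak a$ and a finite-dimensional abelian subalgebra $\mathfrak b$, let $\mathcal M(\mathfrak a,\mathfrak b)$ be the class of $\mathfrak a$-modules whose restriction to $U(\mathfrak b)$ is free of rank one. For $\Lambda=(\lambda_1,\dots,\lambda_n)\in(\mathbb C^*)^n$, $a\in\mathbb C$ and $M_{\mathfrak g}\in\mathcal M(\mathfrak g,\mathfrak h)$, let $\widehat M_{\mathcal L}(\Lambda,a,M_{\mathfrak g})$ be the $\mathcal L$-module $M_{\mathfrak g}\otimes\mathbb C[d_1,\dots,d_n]$ $(\cong U(\mathfrak h)\otimes\mathbb C[d_1,\dots,d_n]=U(\tilde{\mathfrak h}_n))$ with $$t^rK_j\cdot(v\otimes p)=0,\qquad x(r)\cdot(v\otimes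 p)=\Lambda^r\,(x v)\otimes\tau^r(p),\qquad t^rd_i\cdot(v\otimes p)=\Lambda^r\,v\otimes\tau^r(p)\bigl(d_i-r_i(a+1)\bigr)$$ for $x\in\mathfrak g$, $r\in\mathbb Z^n$, where $\Lambda^r=\prod_j\lambda_j^{r_j}$ and $\tau^r$ is the automorphism of $\mathbb C[d_1,\dots,d_n]$ with $\tau^r(d_j)=d_j-r_j$. **Theorem.** Every $M\in\mathcal M(\mathcal L,\tilde{\mathfrak h}_n)$ is isomorphic as an $\mathcal L$-module to $\widehat M_{\mathcal L}(\Lambda,a,M_{\mathfrak g})$ for some $\Lambda\in(\mathbb C^*)^n$, $a\in\mathbb C$ and $M_{\mathfrak g}\in\mathcal M(\mathfrak g,\mathfrak h)$. -/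

import Mathlib

universe u v

open scoped TensorProduct

noncomputable section

namespace FullToroidal

/-! ### Laurent polynomials, the Witt algebra and Kähler differentials modulo exact ones -/

/-- The Laurent polynomial ring `A = ℂ[t₁^±¹, …, tₙ^±¹]`, the group algebra of `ℤⁿ`. -/
def Laurent (n : ℕ) : Type := AddMonoidAlgebra ℂ (Fin n → ℤ)

instance (n : ℕ) : CommRing (Laurent n) :=
  inferInstanceAs (CommRing (AddMonoidAlgebra ℂ (Fin n → ℤ)))

instance (n : ℕ) : Algebra ℂ (Laurent n) :=
  inferInstanceAs (Algebra ℂ (AddMonoidAlgebra ℂ (Fin n → ℤ)))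

/-- The monomial `t^r`, `r ∈ ℤⁿ`. -/
def mono {n : ℕ} (r : Fin n → ℤ) : Laurent n :=
  (AddMonoidAlgebra.single r 1 : AddMonoidAlgebra ℂ (Fin n → ℤ))

/-- The Witt algebra `Der(A)`; its Lie bracket is the commutator of derivations. -/
abbrev Witt (n : ℕ) : Type := Derivation ℂ (Laurent n) (Laurent n)

theorem mono_add {n : ℕ} (r s : Fin n → ℤ) : mono (r + s) = mono r * mono s := by
  have h := AddMonoidAlgebra.single_mul_single (R := ℂ) r s 1 1
  rw [mul_one] at h
  exact h.symm

theorem mono_zero {n : ℕ} : mono (0 : Fin n → ℤ) = 1 := rfl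

theorem laurent_induction {n : ℕ} {P : Laurent n → Prop} (f : Laurent n)
    (hm : ∀ r, P (mono r)) (ha : ∀ f g, P f → P g → P (f + g))
    (hs : ∀ (c : ℂ) f, P f → P (c • f)) : P f := by
  refine AddMonoidAlgebra.induction_linear (motive := P) f ?_ ha fun r c => ?_
  · have h := hs 0 _ (hm 0)
    rw [zero_smul] at h
    exact h
  · have h : (AddMonoidAlgebra.single r c : AddMonoidAlgebra ℂ (Fin n → ℤ))
        = c • AddMonoidAlgebra.single r 1 := by simp
    rw [h]
    exact hs c _ (hm r)

/-- The monomials form a basis of `A`. -/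
def monoBasis (n : ℕ) : Module.Basis (Fin n → ℤ) ℂ (Laurent n) :=
  AddMonoidAlgebra.basis (Fin n → ℤ) ℂ

theorem monoBasis_apply {n : ℕ} (r : Fin n → ℤ) : monoBasis n r = mono r :=
  AddMonoidAlgebra.basis_apply ℂ r

/-- The linear map underlying `dᵢ = tᵢ ∂/∂tᵢ`. -/
def eulerLin {n : ℕ} (i : Fin n) : Laurent n →ₗ[ℂ] Laurent n :=
  (monoBasis n).constr ℂ fun r => (r i : ℂ) • mono r

theorem eulerLin_mono {n : ℕ} (i : Fin n) (r : Fin n → ℤ) :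
    eulerLin i (mono r) = (r i : ℂ) • mono r := by
  conv_lhs => rw [← monoBasis_apply, eulerLin, Module.Basis.constr_basis]

/-- The degree derivation `dᵢ = tᵢ ∂/∂tᵢ` of `A`: `dᵢ(t^r) = rᵢ t^r`. -/
def euler {n : ℕ} (i : Fin n) : Witt n :=
  Derivation.mk' (eulerLin i) fun f g => by
    induction f using laurent_induction with
    | ha f g hf hg => simp only [add_mul, map_add, hf, hg, add_smul, smul_add]; abel
    | hs c f hf => simp only [smul_mul_assoc, map_smul, hf, smul_add, smul_eq_mul, mul_smul_comm]
    | hm r =>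
      induction g using laurent_induction with
      | ha f g hf hg => simp only [mul_add, map_add, hf, hg, add_smul, smul_add]; abel
      | hs c f hf => simp only [smul_mul_assoc, map_smul, hf, smul_add, smul_eq_mul, mul_smul_comm]
      | hm s =>
        rw [← mono_add, eulerLin_mono, eulerLin_mono, eulerLin_mono, mono_add]
        simp only [Pi.add_apply, Int.cast_add, add_smul, smul_eq_mul, mul_smul_comm]
        rw [mul_comm (mono s)]
        abel

theorem euler_mono {n : ℕ} (i : Fin n) (r : Fin n → ℤ) :
    euler i (mono r) = (r i : ℂ) • mono r := eulerLin_mono i r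

/-- The `i`-th coefficient `uᵢ = tᵢ⁻¹ D(tᵢ)` of a derivation `D = ∑ uᵢ dᵢ` of `A`. -/
def coef {n : ℕ} (i : Fin n) : Witt n →ₗ[ℂ] Laurent n where
  toFun D := mono (-Pi.single i 1) * D (mono (Pi.single i 1))
  map_add' D E := by simp [mul_add]
  map_smul' c D := by simp

theorem mono_neg_mul {n : ℕ} (r : Fin n → ℤ) : mono (-r) * mono r = 1 := by
  rw [← mono_add, neg_add_cancel, mono_zero]

theorem mono_mul_neg {n : ℕ} (r : Fin n → ℤ) : mono r * mono (-r) = 1 := by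
  rw [← mono_add, add_neg_cancel, mono_zero]

theorem apply_mono_single {n : ℕ} (D : Witt n) (i : Fin n) :
    D (mono (Pi.single i 1)) = coef i D * mono (Pi.single i 1) := by
  change _ = (mono (-Pi.single i 1) * D (mono (Pi.single i 1))) * mono (Pi.single i 1)
  rw [mul_right_comm, mono_neg_mul, one_mul]

/-- Every derivation of `A` is `∑ uᵢ dᵢ`. -/
theorem witt_apply {n : ℕ} (D : Witt n) (f : Laurent n) :
    D f = ∑ i, coef i D * euler i f := by
  induction f using laurent_induction with
  | ha f g hf hg => simp only [map_add, hf, hg, mul_add, Finset.sum_add_distrib]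
  | hs c f hf => simp only [Derivation.map_smul, hf, Finset.smul_sum, mul_smul_comm]
  | hm r =>
    let φ : (Fin n → ℤ) →+ Laurent n :=
      { toFun := fun r => mono (-r) * D (mono r)
        map_zero' := by rw [mono_zero, D.map_one_eq_zero, mul_zero]
        map_add' := fun r s => by
          rw [mono_add, D.leibniz, neg_add, mono_add, smul_eq_mul, smul_eq_mul]
          have h1 := mono_neg_mul r
          have h2 := mono_neg_mul s
          linear_combination (mono (-s) * D (mono s)) * h1 + (mono (-r) * D (mono r)) * h2 }
    let ψ : (Fin n → ℤ) →+ Laurent n :=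
      { toFun := fun r => ∑ i, (r i : ℂ) • coef i D
        map_zero' := by simp
        map_add' := fun r s => by simp [add_smul, Finset.sum_add_distrib] }
    have h : φ = ψ := by
      refine AddMonoidHom.functions_ext' (I := Fin n) _ φ ψ fun i => AddMonoidHom.ext fun k => ?_
      change φ (Pi.single i k) = ψ (Pi.single i k)
      have key : φ (Pi.single i 1) = ψ (Pi.single i 1) := by
        change coef i D = ∑ j, ((Pi.single i 1 : Fin n → ℤ) j : ℂ) • coef j D
        rw [Finset.sum_eq_single i]
        · simp
        · intro j _ hj; simp [hj]
        · simp
      have e : (Pi.single i k : Fin n → ℤ) = k • Pi.single i 1 := by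
        rw [← Pi.single_smul]; simp
      rw [e, map_zsmul, map_zsmul, key]
    have h' : mono (-r) * D (mono r) = ∑ i, (r i : ℂ) • coef i D := DFunLike.congr_fun h r
    calc D (mono r) = mono r * (mono (-r) * D (mono r)) := by
          rw [← mul_assoc, mono_mul_neg, one_mul]
      _ = _ := by
          rw [h', Finset.mul_sum]
          refine Finset.sum_congr rfl fun i _ => ?_
          rw [euler_mono, mul_smul_comm, mul_smul_comm, mul_comm]

theorem euler_comm {n : ℕ} (i j : Fin n) (f : Laurent n) :
    euler i (euler j f) = euler j (euler i f) := by
  induction f using laurent_induction with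
  | ha f g hf hg => simp only [map_add, hf, hg]
  | hs c f hf => simp only [Derivation.map_smul, hf]
  | hm r => simp only [euler_mono, Derivation.map_smul]; rw [smul_comm]

theorem coef_lie {n : ℕ} (D E : Witt n) (i : Fin n) :
    coef i ⁅D, E⁆ = D (coef i E) - E (coef i D) := by
  have h : coef i ⁅D, E⁆ * mono (Pi.single i 1)
      = (D (coef i E) - E (coef i D)) * mono (Pi.single i 1) := by
    rw [← apply_mono_single, Derivation.commutator_apply, apply_mono_single, apply_mono_single,
      D.leibniz, E.leibniz, apply_mono_single, apply_mono_single]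
    simp only [smul_eq_mul]
    ring
  have h2 := congrArg (· * mono (-Pi.single i 1)) h
  simpa only [mul_assoc, mono_mul_neg, mul_one] using h2

theorem coef_smul_euler {n : ℕ} (f : Laurent n) (i j : Fin n) :
    coef j (f • euler i) = if i = j then f else 0 := by
  change mono (-Pi.single j 1) * (f * euler i (mono (Pi.single j 1))) = _
  rw [euler_mono]
  split_ifs with h
  · subst h
    simp only [Pi.single_eq_same, Int.cast_one, one_smul]
    rw [mul_left_comm, mono_neg_mul, mul_one]
  · simp [Pi.single_eq_of_ne h]

/-- The differential `d : A → Ω_A`, where `Ω_A = Aⁿ` is the free `A`-module with basis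
`K₁, …, Kₙ`; thus `d(t^m) = ∑ mᵢ t^m Kᵢ`. -/
def dForm (n : ℕ) : Laurent n →ₗ[ℂ] (Fin n → Laurent n) :=
  LinearMap.pi fun i => (euler i : Laurent n →ₗ[ℂ] Laurent n)

/-- `𝒦_A = Ω_A / dA`. -/
abbrev KA (n : ℕ) : Type := (Fin n → Laurent n) ⧸ LinearMap.range (dForm n)

/-- The class of a form `∑ fᵢ Kᵢ` in `𝒦_A`. -/
abbrev KA.mk {n : ℕ} (ω : Fin n → Laurent n) : KA n := (LinearMap.range (dForm n)).mkQ ω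

/-- The bilinear map `(f, g) ↦ [g df]` with values in `𝒦_A`;
`(t^a, t^b) ↦ ∑ aᵢ t^(a+b) Kᵢ`. -/
def dClass {n : ℕ} : Laurent n →ₗ[ℂ] Laurent n →ₗ[ℂ] KA n :=
  LinearMap.mk₂ ℂ (fun f g => KA.mk fun p => g * euler p f)
    (fun f f' g => by
      rw [← map_add]; congr 1; funext p; simp [mul_add])
    (fun c f g => by
      rw [← map_smul]; congr 1; funext p; simp)
    (fun f g g' => by
      rw [← map_add]; congr 1; funext p; simp [add_mul])
    (fun c f g => by
      rw [← map_smul]; congr 1; funext p; simp)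

theorem dClass_apply {n : ℕ} (f g : Laurent n) :
    dClass f g = KA.mk fun p => g * euler p f := rfl

theorem dClass_one {n : ℕ} (g : Laurent n) : dClass 1 g = 0 := by
  rw [dClass_apply]
  simp only [Derivation.map_one_eq_zero, mul_zero]
  exact map_zero _

theorem dClass_swap {n : ℕ} (f g : Laurent n) : dClass f g = -dClass g f := by
  rw [eq_neg_iff_add_eq_zero, dClass_apply, dClass_apply, ← map_add, Submodule.mkQ_apply,
    Submodule.Quotient.mk_eq_zero]
  refine ⟨f * g, funext fun p => ?_⟩
  change euler p (f * g) = g * euler p f + f * euler p g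
  rw [Derivation.leibniz, smul_eq_mul, smul_eq_mul, add_comm]

theorem dClass_mul {n : ℕ} (f g h : Laurent n) :
    dClass (f * g) h = dClass f (g * h) + dClass g (h * f) := by
  rw [dClass_apply, dClass_apply, dClass_apply, ← map_add]
  congr 1
  funext p
  simp only [Derivation.leibniz, smul_eq_mul, Pi.add_apply]
  ring

/-- The Lie derivative of forms: `D(∑ ωₚ Kₚ) = ∑ₚ (D(ωₚ) + ∑ⱼ ωⱼ dₚ(uⱼ)) Kₚ` for `D = ∑ uⱼ dⱼ`.
So `t^r dᵢ (t^s Kⱼ) = sᵢ t^(r+s) Kⱼ + δᵢⱼ ∑ rₚ t^(r+s) Kₚ`. -/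
def lieForm {n : ℕ} (D : Witt n) : (Fin n → Laurent n) →ₗ[ℂ] (Fin n → Laurent n) where
  toFun ω p := D (ω p) + ∑ j, ω j * euler p (coef j D)
  map_add' ω η := by
    funext p
    simp only [Pi.add_apply, map_add, add_mul, Finset.sum_add_distrib]
    abel
  map_smul' c ω := by
    funext p
    simp [Finset.smul_sum]

theorem lieForm_gdf {n : ℕ} (D : Witt n) (f g : Laurent n) :
    lieForm D (fun p => g * euler p f)
      = (fun p => g * euler p (D f)) + fun p => D g * euler p f := by
  funext p
  change D (g * euler p f) + ∑ j, g * euler j f * euler p (coef j D)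
    = g * euler p (D f) + D g * euler p f
  rw [D.leibniz, witt_apply D f, map_sum, witt_apply D (euler p f)]
  simp only [Derivation.leibniz, smul_eq_mul, Finset.sum_add_distrib, mul_add, Finset.mul_sum]
  have h1 : ∑ i, g * (coef i D * euler i (euler p f))
      = ∑ i, g * (coef i D * euler p (euler i f)) :=
    Finset.sum_congr rfl fun i _ => by rw [euler_comm]
  have h2 : ∑ j, g * euler j f * euler p (coef j D) = ∑ j, g * (euler j f * euler p (coef j D)) :=
    Finset.sum_congr rfl fun i _ => by rw [mul_assoc]
  rw [h1, h2]
  ring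

/-- The action of `Der(A)` on `𝒦_A` induced by the Lie derivative. -/
def lieKA {n : ℕ} (D : Witt n) : KA n →ₗ[ℂ] KA n :=
  Submodule.mapQ _ _ (lieForm D) (by
    rintro _ ⟨f, rfl⟩
    refine ⟨D f, ?_⟩
    have := lieForm_gdf D f 1
    simp only [one_mul, Derivation.map_one_eq_zero, zero_mul] at this
    change (fun p => euler p (D f)) = lieForm D (fun p => euler p f)
    rw [this]
    funext p
    simp)

theorem lieKA_dClass {n : ℕ} (D : Witt n) (f g : Laurent n) :
    lieKA D (dClass f g) = dClass (D f) g + dClass f (D g) := by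
  rw [dClass_apply, dClass_apply, dClass_apply, ← map_add, ← lieForm_gdf]
  rfl

theorem KA_induction {n : ℕ} {P : KA n → Prop} (k : KA n)
    (hc : ∀ f g, P (dClass f g)) (h0 : P 0) (ha : ∀ k l, P k → P l → P (k + l)) : P k := by
  obtain ⟨ω, rfl⟩ := Submodule.mkQ_surjective _ k
  have h : (LinearMap.range (dForm n)).mkQ ω
      = ∑ j, dClass (mono (Pi.single j 1)) (ω j * mono (-Pi.single j 1)) := by
    simp only [dClass_apply]
    rw [← map_sum]
    congr 1
    funext p
    rw [Finset.sum_apply, Finset.sum_eq_single p]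
    · rw [euler_mono]
      simp [mul_assoc, mono_neg_mul]
    · intro j _ hj
      rw [euler_mono]
      simp [Pi.single_eq_of_ne hj.symm]
    · simp
  rw [h]
  exact Finset.sum_induction _ P ha h0 fun j _ => hc _ _

theorem lieKA_lie {n : ℕ} (D E : Witt n) (k : KA n) :
    lieKA ⁅D, E⁆ k = lieKA D (lieKA E k) - lieKA E (lieKA D k) := by
  induction k using KA_induction with
  | h0 => simp
  | ha k l hk hl => simp only [map_add, hk, hl]; abel
  | hc f g =>
    simp only [lieKA_dClass, map_add, Derivation.commutator_apply, map_sub, LinearMap.sub_apply]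
    abel

theorem lieKA_add {n : ℕ} (D E : Witt n) (k : KA n) :
    lieKA (D + E) k = lieKA D k + lieKA E k := by
  induction k using KA_induction with
  | h0 => simp
  | ha k l hk hl => simp only [map_add, hk, hl]; abel
  | hc f g =>
    simp only [lieKA_dClass, map_add, Derivation.add_apply, LinearMap.add_apply]
    abel

theorem lieKA_smul {n : ℕ} (c : ℂ) (D : Witt n) (k : KA n) :
    lieKA (c • D) k = c • lieKA D k := by
  induction k using KA_induction with
  | h0 => simp
  | ha k l hk hl => simp only [map_add, hk, hl, smul_add]
  | hc f g =>
    simp only [lieKA_dClass, map_smul, Derivation.smul_apply, LinearMap.smul_apply, smul_add]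

/-! ### The two cocycles of the Witt algebra -/

/-- `φ₁(∑ uᵢ dᵢ, ∑ vⱼ dⱼ) = -∑ᵢⱼ [dᵢ(vⱼ) d(dⱼ(uᵢ))]`, that is,
`φ₁(t^r dᵢ, t^s dⱼ) = -sᵢ rⱼ ∑ rₚ t^(r+s) Kₚ`. -/
def phi₁ {n : ℕ} (D E : Witt n) : KA n :=
  -∑ i, ∑ j, dClass (euler j (coef i D)) (euler i (coef j E))

/-- `φ₂(∑ uᵢ dᵢ, ∑ vⱼ dⱼ) = ∑ᵢⱼ [dⱼ(vⱼ) d(dᵢ(uᵢ))]`, that is,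
`φ₂(t^r dᵢ, t^s dⱼ) = rᵢ sⱼ ∑ rₚ t^(r+s) Kₚ`. -/
def phi₂ {n : ℕ} (D E : Witt n) : KA n :=
  ∑ i, ∑ j, dClass (euler i (coef i D)) (euler j (coef j E))

theorem euler_apply_witt {n : ℕ} (D : Witt n) (f : Laurent n) (j : Fin n) :
    euler j (D f) = D (euler j f) + ∑ k, euler k f * euler j (coef k D) := by
  have h := congrFun (lieForm_gdf D f 1) j
  simp only [lieForm, LinearMap.coe_mk, AddHom.coe_mk, one_mul, Pi.add_apply,
    Derivation.map_one_eq_zero, zero_mul, add_zero] at h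
  exact h.symm

/-- The pairing `∑ᵢⱼ [Nⱼᵢ dMᵢⱼ]` of matrices over `A`. -/
def trPair {n : ℕ} (M N : Matrix (Fin n) (Fin n) (Laurent n)) : KA n :=
  ∑ i, ∑ j, dClass (M i j) (N j i)

theorem trPair_swap {n : ℕ} (M N : Matrix (Fin n) (Fin n) (Laurent n)) :
    trPair M N = -trPair N M := by
  unfold trPair
  rw [Finset.sum_comm, ← Finset.sum_neg_distrib]
  refine Finset.sum_congr rfl fun i _ => ?_
  rw [← Finset.sum_neg_distrib]
  exact Finset.sum_congr rfl fun j _ => dClass_swap _ _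

theorem trPair_add_left {n : ℕ} (M M' N : Matrix (Fin n) (Fin n) (Laurent n)) :
    trPair (M + M') N = trPair M N + trPair M' N := by
  simp [trPair, Finset.sum_add_distrib]

theorem trPair_sub_left {n : ℕ} (M M' N : Matrix (Fin n) (Fin n) (Laurent n)) :
    trPair (M - M') N = trPair M N - trPair M' N := by
  simp [trPair, Finset.sum_sub_distrib]

theorem trPair_add_right {n : ℕ} (M N N' : Matrix (Fin n) (Fin n) (Laurent n)) :
    trPair M (N + N') = trPair M N + trPair M N' := by
  simp [trPair, Finset.sum_add_distrib]

theorem trPair_sub_right {n : ℕ} (M N N' : Matrix (Fin n) (Fin n) (Laurent n)) :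
    trPair M (N - N') = trPair M N - trPair M N' := by
  simp [trPair, Finset.sum_sub_distrib]

theorem trPair_smul_left {n : ℕ} (c : ℂ) (M N : Matrix (Fin n) (Fin n) (Laurent n)) :
    trPair (c • M) N = c • trPair M N := by
  simp [trPair, Finset.smul_sum]

theorem trPair_mul {n : ℕ} (M N P : Matrix (Fin n) (Fin n) (Laurent n)) :
    trPair (M * N) P = trPair M (N * P) + trPair N (P * M) := by
  have hl : trPair (M * N) P = ∑ i, ∑ j, ∑ k, dClass (M i k) (N k j * P j i)
      + ∑ i, ∑ j, ∑ k, dClass (N k j) (P j i * M i k) := by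
    simp only [trPair, Matrix.mul_apply, map_sum, LinearMap.sum_apply, dClass_mul,
      Finset.sum_add_distrib]
  have h1 : trPair M (N * P) = ∑ i, ∑ k, ∑ j, dClass (M i k) (N k j * P j i) := by
    simp only [trPair, Matrix.mul_apply, map_sum]
  have h2 : trPair N (P * M) = ∑ k, ∑ j, ∑ i, dClass (N k j) (P j i * M i k) := by
    simp only [trPair, Matrix.mul_apply, map_sum]
  have e1 : ∑ i, ∑ j, ∑ k, dClass (M i k) (N k j * P j i)
      = ∑ i, ∑ k, ∑ j, dClass (M i k) (N k j * P j i) :=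
    Finset.sum_congr rfl fun i _ => Finset.sum_comm
  have e2 : ∑ i, ∑ j, ∑ k, dClass (N k j) (P j i * M i k)
      = ∑ i, ∑ k, ∑ j, dClass (N k j) (P j i * M i k) :=
    Finset.sum_congr rfl fun i _ => Finset.sum_comm
  have e3 : ∑ i, ∑ k, ∑ j, dClass (N k j) (P j i * M i k)
      = ∑ k, ∑ i, ∑ j, dClass (N k j) (P j i * M i k) := Finset.sum_comm
  have e4 : ∑ k, ∑ i, ∑ j, dClass (N k j) (P j i * M i k)
      = ∑ k, ∑ j, ∑ i, dClass (N k j) (P j i * M i k) :=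
    Finset.sum_congr rfl fun i _ => Finset.sum_comm
  rw [hl, h1, h2, e1, e2, e3, e4]

theorem lieKA_trPair {n : ℕ} (D : Witt n) (M N : Matrix (Fin n) (Fin n) (Laurent n)) :
    lieKA D (trPair M N) = trPair (M.map D) N + trPair M (N.map D) := by
  simp [trPair, lieKA_dClass, Finset.sum_add_distrib]

/-- The Jacobian matrix `(dⱼ(uᵢ))ᵢⱼ` of `∑ uᵢ dᵢ`. -/
def jac {n : ℕ} (D : Witt n) : Matrix (Fin n) (Fin n) (Laurent n) :=
  Matrix.of fun i j => euler j (coef i D)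

theorem jac_lie {n : ℕ} (D E : Witt n) :
    jac ⁅D, E⁆ = (jac E).map D - (jac D).map E + (jac E * jac D - jac D * jac E) := by
  ext1 i j
  simp only [jac, Matrix.of_apply, coef_lie, map_sub, euler_apply_witt, Matrix.add_apply,
    Matrix.sub_apply, Matrix.map_apply, Matrix.mul_apply]
  abel

theorem jac_add {n : ℕ} (D E : Witt n) : jac (D + E) = jac D + jac E := by
  ext1 i j; simp [jac]

theorem jac_smul {n : ℕ} (c : ℂ) (D : Witt n) : jac (c • D) = c • jac D := by
  ext1 i j; simp [jac]

theorem phi₁_eq {n : ℕ} (D E : Witt n) : phi₁ D E = -trPair (jac D) (jac E) := rfl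

theorem phi₂_eq {n : ℕ} (D E : Witt n) :
    phi₂ D E = dClass (jac D).trace (jac E).trace := by
  simp only [phi₂, Matrix.trace, map_sum, LinearMap.sum_apply, Matrix.diag_apply, jac,
    Matrix.of_apply]
  exact Finset.sum_comm

theorem trace_jac_lie {n : ℕ} (D E : Witt n) :
    (jac ⁅D, E⁆).trace = D (jac E).trace - E (jac D).trace := by
  rw [jac_lie, Matrix.trace_add, Matrix.trace_sub, Matrix.trace_sub, Matrix.trace_mul_comm,
    sub_self, add_zero]
  simp [Matrix.trace]

/-- The linear combination `φ = c₁ φ₁ + c₂ φ₂`. -/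
def phi {n : ℕ} (c₁ c₂ : ℂ) (D E : Witt n) : KA n := c₁ • phi₁ D E + c₂ • phi₂ D E

theorem phi₁_swap {n : ℕ} (D E : Witt n) : phi₁ D E = -phi₁ E D := by
  rw [phi₁_eq, phi₁_eq, trPair_swap]

theorem phi₂_swap {n : ℕ} (D E : Witt n) : phi₂ D E = -phi₂ E D := by
  rw [phi₂_eq, phi₂_eq, dClass_swap]

theorem phi₁_cocycle {n : ℕ} (D E F : Witt n) :
    lieKA D (phi₁ E F) + phi₁ D ⁅E, F⁆
      = -lieKA F (phi₁ D E) + phi₁ ⁅D, E⁆ F + (lieKA E (phi₁ D F) + phi₁ E ⁅D, F⁆) := by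
  simp only [phi₁_eq, map_neg, lieKA_trPair, jac_lie, trPair_add_right, trPair_sub_right,
    trPair_add_left, trPair_sub_left, trPair_mul]
  rw [trPair_swap (jac E) ((jac D).map F)]
  abel

theorem phi₂_cocycle {n : ℕ} (D E F : Witt n) :
    lieKA D (phi₂ E F) + phi₂ D ⁅E, F⁆
      = -lieKA F (phi₂ D E) + phi₂ ⁅D, E⁆ F + (lieKA E (phi₂ D F) + phi₂ E ⁅D, F⁆) := by
  simp only [phi₂_eq, trace_jac_lie, lieKA_dClass, map_sub, LinearMap.sub_apply]
  have e1 := dClass_swap (E (jac D).trace) (jac F).trace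
  have e2 := dClass_swap (jac E).trace (F (jac D).trace)
  have e3 := dClass_swap (D (jac E).trace) (jac F).trace
  grind

theorem phi_swap {n : ℕ} (c₁ c₂ : ℂ) (D E : Witt n) : phi c₁ c₂ D E = -phi c₁ c₂ E D := by
  rw [phi, phi, phi₁_swap, phi₂_swap]
  module

theorem phi_cocycle {n : ℕ} (c₁ c₂ : ℂ) (D E F : Witt n) :
    lieKA D (phi c₁ c₂ E F) + phi c₁ c₂ D ⁅E, F⁆
      = -lieKA F (phi c₁ c₂ D E) + phi c₁ c₂ ⁅D, E⁆ F
        + (lieKA E (phi c₁ c₂ D F) + phi c₁ c₂ E ⁅D, F⁆) := by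
  simp only [phi, map_add, map_smul]
  have h1 := congrArg (c₁ • ·) (phi₁_cocycle D E F)
  have h2 := congrArg (c₂ • ·) (phi₂_cocycle D E F)
  simp only [smul_add, smul_neg] at h1 h2
  rw [add_add_add_comm, h1, h2]
  simp only [neg_add]
  abel

theorem phi_add_left {n : ℕ} (c₁ c₂ : ℂ) (D D' E : Witt n) :
    phi c₁ c₂ (D + D') E = phi c₁ c₂ D E + phi c₁ c₂ D' E := by
  simp only [phi, phi₁_eq, phi₂_eq, jac_add, trPair_add_left, Matrix.trace_add, map_add,
    LinearMap.add_apply]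
  module

theorem phi_smul_left {n : ℕ} (c₁ c₂ c : ℂ) (D E : Witt n) :
    phi c₁ c₂ (c • D) E = c • phi c₁ c₂ D E := by
  simp only [phi, phi₁_eq, phi₂_eq, jac_smul, trPair_smul_left, Matrix.trace_smul, map_smul,
    LinearMap.smul_apply]
  module

theorem phi_add_right {n : ℕ} (c₁ c₂ : ℂ) (D E E' : Witt n) :
    phi c₁ c₂ D (E + E') = phi c₁ c₂ D E + phi c₁ c₂ D E' := by
  rw [phi_swap, phi_add_left, phi_swap c₁ c₂ E, phi_swap c₁ c₂ E']
  abel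

theorem phi_smul_right {n : ℕ} (c₁ c₂ c : ℂ) (D E : Witt n) :
    phi c₁ c₂ D (c • E) = c • phi c₁ c₂ D E := by
  rw [phi_swap, phi_smul_left, phi_swap c₁ c₂ E, smul_neg, neg_neg]

/-! ### The full toroidal Lie algebra -/

section Loop

variable {n : ℕ} {𝔤 : Type*} [LieRing 𝔤] [LieAlgebra ℂ 𝔤]

/-- The extension of a derivation of `A` to `A ⊗ 𝔤`: `D(f ⊗ x) = D(f) ⊗ x`. -/
def derLoop (D : Witt n) : Laurent n ⊗[ℂ] 𝔤 →ₗ[ℂ] Laurent n ⊗[ℂ] 𝔤 :=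
  LinearMap.rTensor 𝔤 (D : Laurent n →ₗ[ℂ] Laurent n)

theorem derLoop_tmul (D : Witt n) (f : Laurent n) (x : 𝔤) :
    derLoop D (f ⊗ₜ[ℂ] x) = D f ⊗ₜ[ℂ] x := rfl

theorem derLoop_add (D E : Witt n) (X : Laurent n ⊗[ℂ] 𝔤) :
    derLoop (D + E) X = derLoop D X + derLoop E X := by
  induction X with
  | zero => simp
  | tmul f x => simp [derLoop_tmul, TensorProduct.add_tmul]
  | add X Y hX hY => simp only [map_add, hX, hY]; abel

theorem derLoop_smul (c : ℂ) (D : Witt n) (X : Laurent n ⊗[ℂ] 𝔤) :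
    derLoop (c • D) X = c • derLoop D X := by
  induction X with
  | zero => simp
  | tmul f x => simp [derLoop_tmul, TensorProduct.smul_tmul']
  | add X Y hX hY => simp only [map_add, hX, hY, smul_add]

theorem derLoop_commutator (D E : Witt n) (X : Laurent n ⊗[ℂ] 𝔤) :
    derLoop ⁅D, E⁆ X = derLoop D (derLoop E X) - derLoop E (derLoop D X) := by
  induction X with
  | zero => simp
  | tmul f x => simp [derLoop_tmul, Derivation.commutator_apply, TensorProduct.sub_tmul]
  | add X Y hX hY => simp only [map_add, hX, hY]; abel

theorem derLoop_lie (D : Witt n) (X Y : Laurent n ⊗[ℂ] 𝔤) :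
    derLoop D ⁅X, Y⁆ = ⁅derLoop D X, Y⁆ + ⁅X, derLoop D Y⁆ := by
  induction X with
  | zero => simp
  | add X X' hX hX' => simp only [add_lie, map_add, hX, hX']; abel
  | tmul f x =>
    induction Y with
    | zero => simp
    | add Y Y' hY hY' => simp only [lie_add, map_add, hY, hY']; abel
    | tmul g y =>
      simp only [derLoop_tmul, LieAlgebra.ExtendScalars.bracket_tmul, D.leibniz, smul_eq_mul,
        TensorProduct.add_tmul]
      rw [mul_comm g, add_comm]

variable (n 𝔤) in
/-- The 2-cocycle `(f ⊗ x, g ⊗ y) ↦ (x, y) [g df]` of the loop algebra, with `(-,-)` the Killing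
form; so `(t^a ⊗ x, t^b ⊗ y) ↦ (x, y) ∑ aᵢ t^(a+b) Kᵢ`. -/
def loopCocycle : Laurent n ⊗[ℂ] 𝔤 →ₗ[ℂ] Laurent n ⊗[ℂ] 𝔤 →ₗ[ℂ] KA n :=
  TensorProduct.curry
    (TensorProduct.lift (LinearMap.lsmul ℂ (KA n)) ∘ₗ
      TensorProduct.map (TensorProduct.lift (killingForm ℂ 𝔤)) (TensorProduct.lift dClass) ∘ₗ
      (TensorProduct.comm ℂ _ _).toLinearMap ∘ₗ
      (TensorProduct.tensorTensorTensorComm ℂ (Laurent n) 𝔤 (Laurent n) 𝔤).toLinearMap)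

theorem loopCocycle_tmul (f g : Laurent n) (x y : 𝔤) :
    loopCocycle n 𝔤 (f ⊗ₜ[ℂ] x) (g ⊗ₜ[ℂ] y) = killingForm ℂ 𝔤 x y • dClass f g := rfl

theorem loopCocycle_swap (X Y : Laurent n ⊗[ℂ] 𝔤) :
    loopCocycle n 𝔤 X Y = -loopCocycle n 𝔤 Y X := by
  induction X with
  | zero => simp
  | add X X' hX hX' => simp only [map_add, LinearMap.add_apply, hX, hX']; abel
  | tmul f x =>
    induction Y with
    | zero => simp
    | add Y Y' hY hY' => simp only [map_add, LinearMap.add_apply, hY, hY']; abel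
    | tmul g y =>
      rw [loopCocycle_tmul, loopCocycle_tmul, LieModule.traceForm_comm, dClass_swap f g, smul_neg]

theorem loopCocycle_lie (X Y Z : Laurent n ⊗[ℂ] 𝔤) :
    loopCocycle n 𝔤 X ⁅Y, Z⁆ = loopCocycle n 𝔤 ⁅X, Y⁆ Z + loopCocycle n 𝔤 Y ⁅X, Z⁆ := by
  induction X with
  | zero => simp
  | add X X' hX hX' => simp only [map_add, LinearMap.add_apply, add_lie, hX, hX']; abel
  | tmul f x =>
    induction Y with
    | zero => simp
    | add Y Y' hY hY' =>
      simp only [map_add, LinearMap.add_apply, add_lie, lie_add, hY, hY']; abel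
    | tmul g y =>
      induction Z with
      | zero => simp
      | add Z Z' hZ hZ' =>
        simp only [map_add, lie_add, hZ, hZ']; abel
      | tmul h z =>
        simp only [LieAlgebra.ExtendScalars.bracket_tmul, loopCocycle_tmul, dClass_mul]
        have h1 := LieModule.traceForm_apply_lie_apply ℂ 𝔤 𝔤 x y z
        have h2 := LieModule.traceForm_apply_lie_apply' ℂ 𝔤 𝔤 x y z
        have h3 : killingForm ℂ 𝔤 y ⁅x, z⁆ = -killingForm ℂ 𝔤 x ⁅y, z⁆ := by
          rw [← h1, h2, neg_neg]
        rw [h1, h3, mul_comm h f]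
        module

theorem lieKA_loopCocycle (D : Witt n) (X Y : Laurent n ⊗[ℂ] 𝔤) :
    lieKA D (loopCocycle n 𝔤 X Y)
      = loopCocycle n 𝔤 (derLoop D X) Y + loopCocycle n 𝔤 X (derLoop D Y) := by
  induction X with
  | zero => simp
  | add X X' hX hX' => simp only [map_add, LinearMap.add_apply, hX, hX']; abel
  | tmul f x =>
    induction Y with
    | zero => simp
    | add Y Y' hY hY' => simp only [map_add, hY, hY']; abel
    | tmul g y =>
      simp only [derLoop_tmul, loopCocycle_tmul, map_smul, lieKA_dClass, smul_add]

end Loop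

end FullToroidal

/-- The full toroidal Lie algebra `ℒ = 𝔤 ⊗ A ⊕ 𝒦_A ⊕ Der(A)` of `𝔤` in `n` variables, with
respect to the cocycle `φ = c₁ φ₁ + c₂ φ₂` (the tensor factors are written `A ⊗ 𝔤`). -/
@[ext]
structure FullToroidalAlgebra (c₁ c₂ : ℂ) (n : ℕ) (𝔤 : Type*) [LieRing 𝔤] [LieAlgebra ℂ 𝔤] where
  /-- the component in `A ⊗ 𝔤` -/
  loop : FullToroidal.Laurent n ⊗[ℂ] 𝔤
  /-- the component in `𝒦_A` -/
  cen : FullToroidal.KA n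
  /-- the component in `Der(A)` -/
  der : FullToroidal.Witt n

namespace FullToroidalAlgebra

open FullToroidal

section Algebra

variable {c₁ c₂ : ℂ} {n : ℕ} {𝔤 : Type*} [LieRing 𝔤] [LieAlgebra ℂ 𝔤]

variable (c₁ c₂ n 𝔤) in
/-- The underlying vector space is the direct sum of the three components. -/
def equivProd : FullToroidalAlgebra c₁ c₂ n 𝔤 ≃ (Laurent n ⊗[ℂ] 𝔤) × KA n × Witt n where
  toFun X := (X.loop, X.cen, X.der)
  invFun p := ⟨p.1, p.2.1, p.2.2⟩

instance : AddCommGroup (FullToroidalAlgebra c₁ c₂ n 𝔤) := (equivProd c₁ c₂ n 𝔤).addCommGroup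

instance : Module ℂ (FullToroidalAlgebra c₁ c₂ n 𝔤) := (equivProd c₁ c₂ n 𝔤).module ℂ

variable (X Y : FullToroidalAlgebra c₁ c₂ n 𝔤) (c : ℂ)

@[simp] theorem loop_zero : (0 : FullToroidalAlgebra c₁ c₂ n 𝔤).loop = 0 := rfl
@[simp] theorem cen_zero : (0 : FullToroidalAlgebra c₁ c₂ n 𝔤).cen = 0 := rfl
@[simp] theorem der_zero : (0 : FullToroidalAlgebra c₁ c₂ n 𝔤).der = 0 := rfl
@[simp] theorem loop_add : (X + Y).loop = X.loop + Y.loop := rfl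
@[simp] theorem cen_add : (X + Y).cen = X.cen + Y.cen := rfl
@[simp] theorem der_add : (X + Y).der = X.der + Y.der := rfl
@[simp] theorem loop_smul : (c • X).loop = c • X.loop := rfl
@[simp] theorem cen_smul : (c • X).cen = c • X.cen := rfl
@[simp] theorem der_smul : (c • X).der = c • X.der := rfl

/-- The bracket of `ℒ`. The parts in `𝔤 ⊗ A` and `𝒦_A` are acted on by `Der(A)`, the subspace
`𝒦_A` commutes with itself and with `𝔤 ⊗ A`. -/
instance : Bracket (FullToroidalAlgebra c₁ c₂ n 𝔤) (FullToroidalAlgebra c₁ c₂ n 𝔤) where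
  bracket X Y :=
    { loop := ⁅X.loop, Y.loop⁆ + derLoop X.der Y.loop - derLoop Y.der X.loop
      cen := loopCocycle n 𝔤 X.loop Y.loop + lieKA X.der Y.cen - lieKA Y.der X.cen
        + phi c₁ c₂ X.der Y.der
      der := ⁅X.der, Y.der⁆ }

theorem loop_lie : ⁅X, Y⁆.loop = ⁅X.loop, Y.loop⁆ + derLoop X.der Y.loop - derLoop Y.der X.loop :=
  rfl

theorem cen_lie : ⁅X, Y⁆.cen = loopCocycle n 𝔤 X.loop Y.loop + lieKA X.der Y.cen
    - lieKA Y.der X.cen + phi c₁ c₂ X.der Y.der := rfl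

theorem der_lie : ⁅X, Y⁆.der = ⁅X.der, Y.der⁆ := rfl

theorem self_zero {V : Type*} [AddCommGroup V] [Module ℂ V] {v : V} (h : v = -v) : v = 0 := by
  have h2 : (2 : ℂ) • v = 0 := by
    rw [two_smul]
    nth_rewrite 1 [h]
    exact neg_add_cancel v
  exact (smul_eq_zero.mp h2).resolve_left two_ne_zero

instance : LieRing (FullToroidalAlgebra c₁ c₂ n 𝔤) where
  add_lie X Y Z := by
    ext1
    · simp only [loop_lie, loop_add, der_add, add_lie, derLoop_add, map_add]; abel
    · simp only [cen_lie, loop_add, der_add, cen_add, lieKA_add, phi_add_left, map_add,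
        LinearMap.add_apply]; abel
    · simp only [der_lie, der_add, add_lie]
  lie_add X Y Z := by
    ext1
    · simp only [loop_lie, loop_add, der_add, lie_add, derLoop_add, map_add]; abel
    · simp only [cen_lie, loop_add, der_add, cen_add, lieKA_add, phi_add_right, map_add]; abel
    · simp only [der_lie, der_add, lie_add]
  lie_self X := by
    ext1
    · simp [loop_lie]
    · rw [cen_lie, self_zero (loopCocycle_swap X.loop X.loop),
        self_zero (phi_swap c₁ c₂ X.der X.der)]
      simp
    · simp [der_lie]
  leibniz_lie X Y Z := by
    ext1
    · simp only [loop_lie, loop_add, der_lie, derLoop_commutator, derLoop_lie, map_add, map_sub,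
        lie_add, lie_sub, add_lie, sub_lie]
      rw [leibniz_lie X.loop Y.loop Z.loop, ← lie_skew (derLoop Z.der X.loop) Y.loop]
      abel
    · simp only [cen_lie, cen_add, loop_lie, der_lie, lieKA_lie, map_add, map_sub,
        LinearMap.add_apply, LinearMap.sub_apply, lieKA_loopCocycle]
      have h1 := loopCocycle_lie X.loop Y.loop Z.loop
      have h2 := phi_cocycle c₁ c₂ X.der Y.der Z.der
      have h3 := loopCocycle_swap Y.loop (derLoop Z.der X.loop)
      rw [h1, h3]
      rw [← sub_eq_zero] at h2 ⊢
      rw [← h2]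
      abel
    · simp only [der_lie, der_add, leibniz_lie X.der]

instance : LieAlgebra ℂ (FullToroidalAlgebra c₁ c₂ n 𝔤) where
  lie_smul c X Y := by
    ext1
    · simp only [loop_lie, loop_smul, der_smul, lie_smul, derLoop_smul, map_smul, smul_add,
        smul_sub]
    · simp only [cen_lie, loop_smul, der_smul, cen_smul, lieKA_smul, phi_smul_right, map_smul,
        smul_add, smul_sub]
    · simp only [der_lie, der_smul, lie_smul]

variable (c₁ c₂ n) in
/-- The linear map `(x, (uᵢ)) ↦ x ⊗ 1 + ∑ uᵢ dᵢ` from `𝔥 ⊕ ℂⁿ` to `ℒ`. -/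
def cartanMap (𝔥 : LieSubalgebra ℂ 𝔤) :
    𝔥 × (Fin n → ℂ) →ₗ[ℂ] FullToroidalAlgebra c₁ c₂ n 𝔤 where
  toFun p := ⟨1 ⊗ₜ[ℂ] (p.1 : 𝔤), 0, ∑ i, p.2 i • euler i⟩
  map_add' p q := by
    ext1
    · simp [TensorProduct.tmul_add]
    · simp
    · simp [add_smul, Finset.sum_add_distrib]
  map_smul' c p := by
    ext1
    · simp
    · simp
    · simp [mul_smul, Finset.smul_sum]

theorem sum_euler_one (u : Fin n → ℂ) : (∑ i, u i • euler i : Witt n) 1 = 0 :=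
  Derivation.map_one_eq_zero _

theorem coef_sum_euler (u : Fin n → ℂ) (j : Fin n) :
    coef j (∑ i, u i • euler i : Witt n) = u j • (1 : Laurent n) := by
  have h : ∀ i, coef j (euler i : Witt n) = if i = j then 1 else 0 := fun i => by
    simpa using coef_smul_euler (1 : Laurent n) i j
  simp [h]

theorem jac_sum_euler (u : Fin n → ℂ) : jac (∑ i, u i • euler i : Witt n) = 0 := by
  ext1 i j
  simp only [jac, Matrix.of_apply, coef_sum_euler, Matrix.zero_apply]
  simp

theorem sum_euler_comm (u v : Fin n → ℂ) :
    ⁅(∑ i, u i • euler i : Witt n), (∑ i, v i • euler i : Witt n)⁆ = 0 := by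
  have h : ∀ i j : Fin n, ⁅(euler i : Witt n), (euler j : Witt n)⁆ = 0 := fun i j => by
    ext1 f
    simp [Derivation.commutator_apply, euler_comm i j]
  simp [sum_lie, lie_sum, h]

variable (c₁ c₂ n) in
/-- The subalgebra `𝔥̃ₙ = 𝔥 ⊕ D` of `ℒ`, where `𝔥 = 𝔥 ⊗ 1` and `D = ⨁ ℂ dᵢ`. -/
def cartan (𝔥 : LieSubalgebra ℂ 𝔤) : LieSubalgebra ℂ (FullToroidalAlgebra c₁ c₂ n 𝔤) where
  toSubmodule := LinearMap.range (cartanMap c₁ c₂ n 𝔥)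
  lie_mem' := by
    rintro _ _ ⟨⟨x, u⟩, rfl⟩ ⟨⟨y, v⟩, rfl⟩
    refine ⟨(⁅x, y⁆, 0), ?_⟩
    ext1
    · simp [cartanMap, loop_lie, derLoop_tmul]
    · simp [cartanMap, cen_lie, loopCocycle_tmul, phi, phi₁_eq, phi₂_eq, jac_sum_euler, trPair,
        dClass_one]
    · simp [cartanMap, der_lie, sum_euler_comm]

end Algebra

end FullToroidalAlgebra

/-! ### Modules that are free of rank one over the enveloping algebra of a subalgebra -/

section Free

attribute [local instance 100] LieRing.ofAssociativeRing

/-- The objects `M` of `ℳ(𝔞, 𝔟)`: the restriction of the `𝔞`-module `M` to `U(𝔟)` is isomorphic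
to the left regular module `U(𝔟)`. -/
def IsFreeOfRankOne {𝔞 : Type*} [LieRing 𝔞] [LieAlgebra ℂ 𝔞] (𝔟 : LieSubalgebra ℂ 𝔞)
    (M : Type*) [AddCommGroup M] [Module ℂ M] [LieRingModule 𝔞 M] [LieModule ℂ 𝔞 M] : Prop :=
  ∃ e : UniversalEnvelopingAlgebra ℂ 𝔟 ≃ₗ[ℂ] M, ∀ u v : UniversalEnvelopingAlgebra ℂ 𝔟,
    e (u * v) = UniversalEnvelopingAlgebra.lift ℂ (LieModule.toEnd ℂ 𝔟 M) u (e v)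

end Free

/-! ### The modules `M̂(Λ, a, M_𝔤)` -/

namespace FullToroidal

section Hat

open MvPolynomial

variable {n : ℕ}

/-- `τ^r : ℂ[d₁, …, dₙ] → ℂ[d₁, …, dₙ]`, `dⱼ ↦ dⱼ - rⱼ`. -/
def tau (r : Fin n → ℤ) : MvPolynomial (Fin n) ℂ →ₐ[ℂ] MvPolynomial (Fin n) ℂ :=
  aeval fun j => X j - C (r j : ℂ)

/-- `Λ^r = ∏ λⱼ^(rⱼ)`. -/
def lamPow (Λ : Fin n → ℂˣ) (r : Fin n → ℤ) : ℂ := ((∏ j, Λ j ^ r j : ℂˣ) : ℂ)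

theorem tau_zero : tau (0 : Fin n → ℤ) = AlgHom.id ℂ _ := by
  ext j; simp [tau]

theorem tau_add (r s : Fin n → ℤ) : tau (r + s) = (tau r).comp (tau s) := by
  apply MvPolynomial.algHom_ext
  intro j
  simp only [tau, aeval_X, AlgHom.comp_apply, map_sub, aeval_C, Pi.add_apply, Int.cast_add,
    C_add, MvPolynomial.algebraMap_eq]
  ring

theorem lamPow_zero (Λ : Fin n → ℂˣ) : lamPow Λ 0 = 1 := by simp [lamPow]

theorem lamPow_add (Λ : Fin n → ℂˣ) (r s : Fin n → ℤ) :
    lamPow Λ (r + s) = lamPow Λ r * lamPow Λ s := by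
  simp [lamPow, zpow_add, Finset.prod_mul_distrib]

/-- The action of `A` on `ℂ[d₁, …, dₙ]` with `t^r` acting as `Λ^r τ^r`. -/
def shift (Λ : Fin n → ℂˣ) : Laurent n →ₐ[ℂ] Module.End ℂ (MvPolynomial (Fin n) ℂ) :=
  AddMonoidAlgebra.lift ℂ (Module.End ℂ (MvPolynomial (Fin n) ℂ)) (Fin n → ℤ)
    { toFun := fun r => lamPow Λ r.toAdd • (tau r.toAdd).toLinearMap
      map_one' := by
        rw [toAdd_one, lamPow_zero, tau_zero, one_smul]
        rfl
      map_mul' := fun r s => by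
        rw [toAdd_mul, lamPow_add, tau_add]
        refine LinearMap.ext fun p => ?_
        simp only [LinearMap.smul_apply, AlgHom.toLinearMap_apply, AlgHom.comp_apply,
          Module.End.mul_apply, map_smul, mul_smul]
        rw [smul_comm] }

theorem shift_mono (Λ : Fin n → ℂˣ) (r : Fin n → ℤ) (p : MvPolynomial (Fin n) ℂ) :
    shift Λ (mono r) p = lamPow Λ r • tau r p := by
  have h : shift Λ (mono r) = (1 : ℂ) • (lamPow Λ r • (tau r).toLinearMap) :=
    AddMonoidAlgebra.lift_single _ r 1
  rw [h, one_smul]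
  rfl

/-- The action of the Witt algebra on `ℂ[d₁, …, dₙ]`: `∑ uᵢ dᵢ` acts as
`∑ᵢ (dᵢ · uᵢ(-) - (a + 1) dᵢ(uᵢ)(-))`, so `t^r dᵢ` acts as `p ↦ Λ^r τ^r(p) (dᵢ - rᵢ (a + 1))`. -/
def wittAct (Λ : Fin n → ℂˣ) (a : ℂ) : Witt n →ₗ[ℂ] Module.End ℂ (MvPolynomial (Fin n) ℂ) :=
  ∑ i, (LinearMap.mulLeft ℂ (LinearMap.mulLeft ℂ (X i : MvPolynomial (Fin n) ℂ)) ∘ₗ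
      (shift Λ).toLinearMap ∘ₗ coef i
    - (a + 1) • ((shift Λ).toLinearMap ∘ₗ (euler i : Laurent n →ₗ[ℂ] Laurent n) ∘ₗ coef i))

theorem wittAct_apply (Λ : Fin n → ℂˣ) (a : ℂ) (D : Witt n) (p : MvPolynomial (Fin n) ℂ) :
    wittAct Λ a D p = ∑ i, (X i * shift Λ (coef i D) p
      - (a + 1) • shift Λ (euler i (coef i D)) p) := by
  simp [wittAct, LinearMap.sum_apply]

theorem wittAct_mono_smul (Λ : Fin n → ℂˣ) (a : ℂ) (r : Fin n → ℤ) (i : Fin n)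
    (p : MvPolynomial (Fin n) ℂ) :
    wittAct Λ a (mono r • euler i) p
      = lamPow Λ r • (tau r p * (X i - C ((r i : ℂ) * (a + 1)))) := by
  rw [wittAct_apply, Finset.sum_eq_single i]
  · rw [coef_smul_euler, if_pos rfl, euler_mono, map_smul, LinearMap.smul_apply, shift_mono]
    simp only [MvPolynomial.smul_eq_C_mul, map_mul]
    ring
  · intro j _ hj
    rw [coef_smul_euler, if_neg (Ne.symm hj)]
    simp
  · simp

theorem shift_X_mul (Λ : Fin n → ℂˣ) (f : Laurent n) (i : Fin n)
    (p : MvPolynomial (Fin n) ℂ) :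
    shift Λ f (X i * p) = X i * shift Λ f p - shift Λ (euler i f) p := by
  induction f using laurent_induction with
  | ha f g hf hg => simp only [map_add, LinearMap.add_apply, hf, hg]; ring
  | hs c f hf =>
    simp only [map_smul, LinearMap.smul_apply, hf, Derivation.map_smul, smul_sub, mul_smul_comm]
  | hm r =>
    rw [euler_mono, map_smul, LinearMap.smul_apply]
    simp only [shift_mono, map_mul, MvPolynomial.smul_eq_C_mul]
    simp only [tau, aeval_X]
    ring

theorem wittAct_shift (Λ : Fin n → ℂˣ) (a : ℂ) (D : Witt n) (f : Laurent n)
    (p : MvPolynomial (Fin n) ℂ) :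
    wittAct Λ a D (shift Λ f p) = shift Λ f (wittAct Λ a D p) + shift Λ (D f) p := by
  have hc : ∀ (g h : Laurent n) (q : MvPolynomial (Fin n) ℂ),
      shift Λ g (shift Λ h q) = shift Λ (g * h) q := fun g h q => by
    rw [map_mul]; rfl
  rw [wittAct_apply, wittAct_apply, witt_apply D f, map_sum, map_sum, LinearMap.sum_apply,
    ← Finset.sum_add_distrib]
  refine Finset.sum_congr rfl fun i _ => ?_
  rw [map_sub, map_smul, shift_X_mul, hc, hc, hc, hc, hc, mul_comm f, mul_comm f,
    mul_comm (euler i f)]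
  abel

theorem coef_lie_euler (D : Witt n) (i j : Fin n) :
    coef i ⁅(euler j : Witt n), D⁆ = euler j (coef i D) := by
  rw [coef_lie]
  have h : coef i (euler j : Witt n) = if j = i then 1 else 0 := by
    simpa using coef_smul_euler (1 : Laurent n) j i
  rw [h]
  split_ifs <;> simp

theorem wittAct_X_mul (Λ : Fin n → ℂˣ) (a : ℂ) (D : Witt n) (j : Fin n)
    (p : MvPolynomial (Fin n) ℂ) :
    wittAct Λ a D (X j * p) = X j * wittAct Λ a D p - wittAct Λ a ⁅euler j, D⁆ p := by
  simp only [wittAct_apply, coef_lie_euler, shift_X_mul, Finset.mul_sum,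
    ← Finset.sum_sub_distrib]
  refine Finset.sum_congr rfl fun i _ => ?_
  rw [euler_comm j i]
  simp only [MvPolynomial.smul_eq_C_mul]
  ring

theorem wittAct_eq (Λ : Fin n → ℂˣ) (a : ℂ) (D : Witt n) (p : MvPolynomial (Fin n) ℂ) :
    wittAct Λ a D p = ∑ i, X i * shift Λ (coef i D) p
      - (a + 1) • shift Λ (jac D).trace p := by
  have h : (jac D).trace = ∑ i, euler i (coef i D) := rfl
  rw [wittAct_apply, h, map_sum, LinearMap.sum_apply, Finset.smul_sum, Finset.sum_sub_distrib]

theorem trace_jac_lie_euler (D : Witt n) (j : Fin n) :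
    (jac ⁅(euler j : Witt n), D⁆).trace = euler j (jac D).trace := by
  have h : ∀ E : Witt n, (jac E).trace = ∑ i, euler i (coef i E) := fun _ => rfl
  rw [h, h, map_sum]
  refine Finset.sum_congr rfl fun i _ => ?_
  rw [coef_lie_euler, euler_comm]

theorem wittAct_lie (Λ : Fin n → ℂˣ) (a : ℂ) (D E : Witt n) (p : MvPolynomial (Fin n) ℂ) :
    wittAct Λ a ⁅D, E⁆ p
      = wittAct Λ a D (wittAct Λ a E p) - wittAct Λ a E (wittAct Λ a D p) := by
  have hc : ∀ (g h : Laurent n) (q : MvPolynomial (Fin n) ℂ),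
      shift Λ g (shift Λ h q) = shift Λ (g * h) q := fun g h q => by
    rw [map_mul]; rfl
  have h1 : ∑ j, shift Λ (coef j E) (wittAct Λ a ⁅euler j, D⁆ p)
      = ∑ i, X i * shift Λ (E (coef i D)) p
        - ∑ j, shift Λ (⁅(euler j : Witt n), D⁆ (coef j E)) p
        - (a + 1) • shift Λ (E (jac D).trace) p := by
    have e1 : ∀ j, shift Λ (coef j E) (wittAct Λ a ⁅euler j, D⁆ p)
        = ∑ i, X i * shift Λ (coef j E * euler j (coef i D)) p
          - shift Λ (⁅(euler j : Witt n), D⁆ (coef j E)) p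
          - (a + 1) • shift Λ (coef j E * euler j (jac D).trace) p := fun j => by
      rw [wittAct_eq, trace_jac_lie_euler, map_sub, map_smul, hc, map_sum,
        witt_apply _ (coef j E), map_sum, LinearMap.sum_apply, ← Finset.sum_sub_distrib]
      congr 1
      refine Finset.sum_congr rfl fun i _ => ?_
      rw [coef_lie_euler, shift_X_mul, hc, hc, mul_comm (euler i (coef j E))]
    simp only [e1, Finset.sum_sub_distrib]
    congr 1
    · congr 1
      rw [Finset.sum_comm]
      refine Finset.sum_congr rfl fun i _ => ?_
      rw [witt_apply E (coef i D), map_sum, LinearMap.sum_apply, Finset.mul_sum]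
    · rw [witt_apply E (jac D).trace, map_sum, LinearMap.sum_apply, Finset.smul_sum]
  have h2 : wittAct Λ a D (wittAct Λ a E p)
      = ∑ j, X j * shift Λ (coef j E) (wittAct Λ a D p)
        + ∑ j, X j * shift Λ (D (coef j E)) p
        - (∑ j, shift Λ (coef j E) (wittAct Λ a ⁅euler j, D⁆ p)
          + ∑ j, shift Λ (⁅(euler j : Witt n), D⁆ (coef j E)) p)
        - (a + 1) • (shift Λ (jac E).trace (wittAct Λ a D p)
          + shift Λ (D (jac E).trace) p) := by
    rw [wittAct_eq Λ a E p, map_sub, map_smul, wittAct_shift, map_sum]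
    congr 1
    rw [← Finset.sum_add_distrib, ← Finset.sum_add_distrib, ← Finset.sum_sub_distrib]
    refine Finset.sum_congr rfl fun j _ => ?_
    rw [wittAct_X_mul, wittAct_shift, wittAct_shift, mul_add]
  have h3 : ∑ i, X i * shift Λ (coef i ⁅D, E⁆) p
      = ∑ i, X i * shift Λ (D (coef i E)) p - ∑ i, X i * shift Λ (E (coef i D)) p := by
    rw [← Finset.sum_sub_distrib]
    refine Finset.sum_congr rfl fun i _ => ?_
    rw [coef_lie, map_sub, LinearMap.sub_apply, mul_sub]
  rw [h2, h1, wittAct_eq Λ a E (wittAct Λ a D p), wittAct_eq Λ a ⁅D, E⁆ p, h3, trace_jac_lie,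
    map_sub, LinearMap.sub_apply, smul_add, smul_sub]
  abel

variable {𝔤 : Type*} [LieRing 𝔤] [LieAlgebra ℂ 𝔤]
variable (V : Type*) [AddCommGroup V] [Module ℂ V] [LieRingModule 𝔤 V] [LieModule ℂ 𝔤 V]

/-- The action of `A ⊗ 𝔤` on `V ⊗ ℂ[d₁, …, dₙ]`:
`(t^r ⊗ x) (v ⊗ p) = Λ^r (x v) ⊗ τ^r(p)`. -/
def loopAct (Λ : Fin n → ℂˣ) :
    Laurent n ⊗[ℂ] 𝔤 →ₗ[ℂ] Module.End ℂ (V ⊗[ℂ] MvPolynomial (Fin n) ℂ) :=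
  TensorProduct.lift
    (((TensorProduct.mapBilinear (RingHom.id ℂ) V (MvPolynomial (Fin n) ℂ) V
        (MvPolynomial (Fin n) ℂ)).flip ∘ₗ (shift Λ).toLinearMap).compl₂
      (LieModule.toEnd ℂ 𝔤 V : 𝔤 →ₗ[ℂ] Module.End ℂ V))

theorem loopAct_tmul (Λ : Fin n → ℂˣ) (f : Laurent n) (x : 𝔤) (v : V)
    (p : MvPolynomial (Fin n) ℂ) :
    loopAct V Λ (f ⊗ₜ[ℂ] x) (v ⊗ₜ[ℂ] p) = ⁅x, v⁆ ⊗ₜ[ℂ] shift Λ f p := rfl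

variable (c₁ c₂ : ℂ)

/-- The action of `ℒ` on `V ⊗ ℂ[d₁, …, dₙ]`: `A ⊗ 𝔤` acts by `loopAct`, `𝒦_A` by zero and
`Der(A)` by `wittAct` on the second factor. -/
def hatAct (Λ : Fin n → ℂˣ) (a : ℂ) :
    FullToroidalAlgebra c₁ c₂ n 𝔤 →ₗ[ℂ] Module.End ℂ (V ⊗[ℂ] MvPolynomial (Fin n) ℂ) where
  toFun X := loopAct V Λ X.loop + LinearMap.lTensor V (wittAct Λ a X.der)
  map_add' X Y := by
    simp only [FullToroidalAlgebra.loop_add, FullToroidalAlgebra.der_add, map_add,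
      LinearMap.lTensor_add]
    abel
  map_smul' c X := by
    simp only [FullToroidalAlgebra.loop_smul, FullToroidalAlgebra.der_smul, map_smul,
      LinearMap.lTensor_smul, RingHom.id_apply, smul_add]

theorem hatAct_apply (Λ : Fin n → ℂˣ) (a : ℂ) (X : FullToroidalAlgebra c₁ c₂ n 𝔤)
    (m : V ⊗[ℂ] MvPolynomial (Fin n) ℂ) :
    hatAct V c₁ c₂ Λ a X m
      = loopAct V Λ X.loop m + LinearMap.lTensor V (wittAct Λ a X.der) m := rfl

theorem loopAct_lie (Λ : Fin n → ℂˣ) (X Y : Laurent n ⊗[ℂ] 𝔤)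
    (m : V ⊗[ℂ] MvPolynomial (Fin n) ℂ) :
    loopAct V Λ ⁅X, Y⁆ m
      = loopAct V Λ X (loopAct V Λ Y m) - loopAct V Λ Y (loopAct V Λ X m) := by
  induction m with
  | zero => simp
  | add m m' hm hm' => simp only [map_add, hm, hm']; abel
  | tmul v p =>
    induction X with
    | zero => simp
    | add X X' hX hX' => simp only [map_add, LinearMap.add_apply, add_lie, hX, hX']; abel
    | tmul f x =>
      induction Y with
      | zero => simp
      | add Y Y' hY hY' => simp only [map_add, LinearMap.add_apply, lie_add, hY, hY']; abel
      | tmul g y =>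
        have hc : ∀ (g h : Laurent n) (q : MvPolynomial (Fin n) ℂ),
            shift Λ g (shift Λ h q) = shift Λ (g * h) q := fun g h q => by
          rw [map_mul]; rfl
        simp only [LieAlgebra.ExtendScalars.bracket_tmul, loopAct_tmul, hc, lie_lie,
          TensorProduct.sub_tmul]
        rw [mul_comm g f]

theorem wittAct_loopAct (Λ : Fin n → ℂˣ) (a : ℂ) (D : Witt n) (X : Laurent n ⊗[ℂ] 𝔤)
    (m : V ⊗[ℂ] MvPolynomial (Fin n) ℂ) :
    LinearMap.lTensor V (wittAct Λ a D) (loopAct V Λ X m)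
      = loopAct V Λ X (LinearMap.lTensor V (wittAct Λ a D) m) + loopAct V Λ (derLoop D X) m := by
  induction m with
  | zero => simp
  | add m m' hm hm' => simp only [map_add, hm, hm']; abel
  | tmul v p =>
    induction X with
    | zero => simp
    | add X X' hX hX' => simp only [map_add, LinearMap.add_apply, hX, hX']; abel
    | tmul f x =>
      simp only [derLoop_tmul, loopAct_tmul, LinearMap.lTensor_tmul, wittAct_shift,
        TensorProduct.tmul_add]

theorem lTensor_wittAct_lie (Λ : Fin n → ℂˣ) (a : ℂ) (D E : Witt n)
    (m : V ⊗[ℂ] MvPolynomial (Fin n) ℂ) :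
    LinearMap.lTensor V (wittAct Λ a ⁅D, E⁆) m
      = LinearMap.lTensor V (wittAct Λ a D) (LinearMap.lTensor V (wittAct Λ a E) m)
        - LinearMap.lTensor V (wittAct Λ a E) (LinearMap.lTensor V (wittAct Λ a D) m) := by
  induction m with
  | zero => simp
  | add m m' hm hm' => simp only [map_add, hm, hm']; abel
  | tmul v p =>
    simp only [LinearMap.lTensor_tmul, wittAct_lie, TensorProduct.tmul_sub]

theorem hatAct_lie (Λ : Fin n → ℂˣ) (a : ℂ) (X Y : FullToroidalAlgebra c₁ c₂ n 𝔤)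
    (m : V ⊗[ℂ] MvPolynomial (Fin n) ℂ) :
    hatAct V c₁ c₂ Λ a ⁅X, Y⁆ m
      = hatAct V c₁ c₂ Λ a X (hatAct V c₁ c₂ Λ a Y m)
        - hatAct V c₁ c₂ Λ a Y (hatAct V c₁ c₂ Λ a X m) := by
  simp only [hatAct_apply, FullToroidalAlgebra.loop_lie, FullToroidalAlgebra.der_lie, map_add,
    map_sub, LinearMap.add_apply, LinearMap.sub_apply, loopAct_lie, lTensor_wittAct_lie,
    wittAct_loopAct]
  abel

end Hat

end FullToroidal

/-- The vector space `V ⊗ ℂ[d₁, …, dₙ]` underlying `M̂(Λ, a, V)`. If `V = U(𝔥)` as an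
`𝔥`-module, then this is `U(𝔥) ⊗ ℂ[d₁, …, dₙ] = U(𝔥̃ₙ)`. -/
@[nolint unusedArguments]
def HatModule {n : ℕ} (_Λ : Fin n → ℂˣ) (_a : ℂ) (V : Type*) [AddCommGroup V] [Module ℂ V] :
    Type _ := V ⊗[ℂ] MvPolynomial (Fin n) ℂ

namespace HatModule

open FullToroidal

variable {n : ℕ} (Λ : Fin n → ℂˣ) (a : ℂ) (V : Type*) [AddCommGroup V] [Module ℂ V]

instance : AddCommGroup (HatModule Λ a V) :=
  inferInstanceAs (AddCommGroup (V ⊗[ℂ] MvPolynomial (Fin n) ℂ))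

instance : Module ℂ (HatModule Λ a V) :=
  inferInstanceAs (Module ℂ (V ⊗[ℂ] MvPolynomial (Fin n) ℂ))

variable {V} in
/-- The element `v ⊗ p`. -/
def tmul (v : V) (p : MvPolynomial (Fin n) ℂ) : HatModule Λ a V := v ⊗ₜ[ℂ] p

variable {𝔤 : Type*} [LieRing 𝔤] [LieAlgebra ℂ 𝔤] [LieRingModule 𝔤 V] [LieModule ℂ 𝔤 V]
variable {c₁ c₂ : ℂ}

instance : LieRingModule (FullToroidalAlgebra c₁ c₂ n 𝔤) (HatModule Λ a V) where
  bracket X m := hatAct V c₁ c₂ Λ a X m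
  add_lie X Y m := by
    change hatAct V c₁ c₂ Λ a (X + Y) m = _
    rw [map_add]
    rfl
  lie_add X m m' := map_add (hatAct V c₁ c₂ Λ a X) m m'
  leibniz_lie X Y m := sub_eq_iff_eq_add.mp (hatAct_lie V c₁ c₂ Λ a X Y m).symm

instance : LieModule ℂ (FullToroidalAlgebra c₁ c₂ n 𝔤) (HatModule Λ a V) where
  smul_lie c X m := by
    change hatAct V c₁ c₂ Λ a (c • X) m = _
    rw [map_smul]
    rfl
  lie_smul c X m := map_smul (hatAct V c₁ c₂ Λ a X) c m

theorem lie_loop (r : Fin n → ℤ) (x : 𝔤) (v : V) (p : MvPolynomial (Fin n) ℂ) :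
    ⁅(⟨mono r ⊗ₜ[ℂ] x, 0, 0⟩ : FullToroidalAlgebra c₁ c₂ n 𝔤), tmul Λ a v p⁆
      = lamPow Λ r • tmul Λ a ⁅x, v⁆ (tau r p) := by
  change loopAct V Λ (mono r ⊗ₜ[ℂ] x) (v ⊗ₜ[ℂ] p)
    + LinearMap.lTensor V (wittAct Λ a 0) (v ⊗ₜ[ℂ] p) = lamPow Λ r • (⁅x, v⁆ ⊗ₜ[ℂ] tau r p)
  rw [loopAct_tmul, shift_mono, map_zero, LinearMap.lTensor_zero, LinearMap.zero_apply, add_zero,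
    TensorProduct.tmul_smul]

theorem lie_cen (k : KA n) (m : HatModule Λ a V) :
    ⁅(⟨0, k, 0⟩ : FullToroidalAlgebra c₁ c₂ n 𝔤), m⁆ = 0 := by
  change loopAct (𝔤 := 𝔤) V Λ 0 m + LinearMap.lTensor V (wittAct Λ a 0) m = (0 : HatModule Λ a V)
  rw [map_zero, map_zero, LinearMap.lTensor_zero]
  exact add_zero _

theorem lie_witt (r : Fin n → ℤ) (i : Fin n) (v : V) (p : MvPolynomial (Fin n) ℂ) :
    ⁅(⟨0, 0, mono r • euler i⟩ : FullToroidalAlgebra c₁ c₂ n 𝔤), tmul Λ a v p⁆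
      = lamPow Λ r • tmul Λ a v
          (tau r p * (MvPolynomial.X i - MvPolynomial.C ((r i : ℂ) * (a + 1)))) := by
  change loopAct (𝔤 := 𝔤) V Λ 0 (v ⊗ₜ[ℂ] p)
    + LinearMap.lTensor V (wittAct Λ a (mono r • euler i)) (v ⊗ₜ[ℂ] p)
    = lamPow Λ r • (v ⊗ₜ[ℂ] _)
  rw [map_zero, LinearMap.zero_apply, zero_add, LinearMap.lTensor_tmul, wittAct_mono_smul,
    TensorProduct.tmul_smul]

end HatModule

end

noncomputable section

/-! ### Enveloping algebras of abelian Lie algebras as polynomial rings. -/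

section Enveloping

attribute [local instance 100] LieRing.ofAssociativeRing

namespace UniversalEnvelopingAlgebra

variable {L : Type*} [LieRing L] [LieAlgebra ℂ L]

/-! Since `𝔥̃ₙ` is abelian, its enveloping algebra is the polynomial ring `S(𝔥)[d₁, …, dₙ]`, so M
may be taken to be this ring, with `𝔥` and the `dᵢ` acting by multiplication. The bracket of a
homogeneous element with the `dⱼ` says that it is semilinear for the translation `d ↦ d - r`. Hence
`t^r dᵢ` and `h(r)`, for h in `𝔥`, are determined by their values at 1, and the brackets of ℒ become
functional equations between polynomials.

These equations are solved by counting degrees along the direction r. The bracket of `t^r dᵢ` with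
`h(-r)` gives deg `h(-r)·1` + deg `t^r dᵢ·1` = 1, likewise with r and -r exchanged, and the bracket
of `t^r dᵢ` with `t^(-r) dᵢ` makes the two Witt degrees add up to 2. So `h(r)·1` is constant along
r, and comparing leading coefficients gives `h(r)·1 = χ(r) h` with a nonzero scalar χ(r)
(`exists_smul_of_relations`). Substituting this back shows that χ is a character `Λ^r` and that `t^r
dᵢ·1 = Λ^r (dᵢ - β(r, i))` with β in `S(𝔥)` (the first `exists_normal_form`). Now `h(r)` and `h(s)`
commute as operators, and (h, h) can be chosen nonzero, so `𝒦_A` acts by zero (`cenElt_eq_zero`).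
The Witt relations without centre then force `β(r, i) = rᵢ b` (`exists_linear`).

It remains to see that b is a scalar and to find the action of `𝔤 ⊗ A`. Multiplication by `b - b²`
is a combination of products of Witt elements and of the `dᵢ`, all of which commute with `𝔤`. A
weight vector of `𝔤` translates `S(𝔥)` by its weight and the weights span the dual of `𝔥`, so `b -
b²` is a scalar (`exists_eq_C_of_comm`), and hence so is b, which is a + 1. Then `𝔤` preserves
`S(𝔥)`, which becomes the module `M_𝔤`, and the bracket of `t^(-r) dᵢ` with `x(r)` determines `x(r)`
from `x(0)` (`loopElt_eq_of_witt_form`). -/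

theorem adjoin_range_ι :
    Algebra.adjoin ℂ (Set.range (ι ℂ : L → UniversalEnvelopingAlgebra ℂ L)) = ⊤ := by
  set S := Algebra.adjoin ℂ (Set.range (ι ℂ : L → UniversalEnvelopingAlgebra ℂ L)) with hS
  -- The map ι corestricted to S lifts to the enveloping algebra; followed by the inclusion of S it
  -- is the identity by uniqueness of lifts, so S is everything.
  let f : L →ₗ⁅ℂ⁆ S :=
    { toFun := fun x => ⟨ι ℂ x, Algebra.subset_adjoin ⟨x, rfl⟩⟩
      map_add' := fun x y => Subtype.ext (map_add (ι ℂ) x y)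
      map_smul' := fun c x => Subtype.ext (map_smul (ι ℂ) c x)
      map_lie' := fun {x y} => Subtype.ext (LieHom.map_lie (ι ℂ) x y) }
  have h : S.val.comp (lift ℂ f) = AlgHom.id ℂ _ := by
    apply hom_ext
    ext x
    change S.val (lift ℂ f (ι ℂ x)) = ι ℂ x
    rw [lift_ι_apply]
    rfl
  rw [eq_top_iff]
  intro u _
  have hu : S.val (lift ℂ f u) = u := DFunLike.congr_fun h u
  rw [← hu]
  exact (lift ℂ f u).2

theorem mul_comm_of_abelian [IsLieAbelian L] (u v : UniversalEnvelopingAlgebra ℂ L) :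
    u * v = v * u := by
  have hι : ∀ x y : L, ι ℂ x * ι ℂ y = ι ℂ y * ι ℂ x := fun x y => by
    have h := LieHom.map_lie (ι ℂ) x y
    rw [trivial_lie_zero, map_zero, LieRing.of_associative_ring_bracket] at h
    exact (sub_eq_zero.mp h.symm)
  have hu : u ∈ Algebra.adjoin ℂ (Set.range (ι ℂ : L → UniversalEnvelopingAlgebra ℂ L)) := by
    rw [adjoin_range_ι]; trivial
  have hv : v ∈ Algebra.adjoin ℂ (Set.range (ι ℂ : L → UniversalEnvelopingAlgebra ℂ L)) := by
    rw [adjoin_range_ι]; trivial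
  refine Algebra.commute_of_mem_adjoin_of_forall_mem_commute hv ?_
  rintro _ ⟨y, rfl⟩
  refine (Algebra.commute_of_mem_adjoin_of_forall_mem_commute hu ?_).symm
  rintro _ ⟨x, rfl⟩
  exact hι _ _

variable {ι' : Type*} (b : Module.Basis ι' ℂ L)

/-- The linear map from an abelian Lie algebra to polynomials in a basis. -/
def toPolyLie [IsLieAbelian L] : L →ₗ⁅ℂ⁆ MvPolynomial ι' ℂ :=
  { b.constr ℂ (fun k => (MvPolynomial.X k : MvPolynomial ι' ℂ)) with
    map_lie' := fun {x y} => by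
      rw [trivial_lie_zero]
      change b.constr ℂ (fun k => (MvPolynomial.X k : MvPolynomial ι' ℂ)) 0 = _
      rw [map_zero, LieRing.of_associative_ring_bracket, mul_comm, sub_self] }

theorem toPolyLie_basis [IsLieAbelian L] (k : ι') :
    toPolyLie b (b k) = MvPolynomial.X k := b.constr_basis ℂ _ k

/-- Evaluation of polynomials needs a commutative target. The existential form keeps the commutative
ring structure on the enveloping algebra local to the proof. -/
theorem exists_algHom_of_abelian [IsLieAbelian L] :
    ∃ g : MvPolynomial ι' ℂ →ₐ[ℂ] UniversalEnvelopingAlgebra ℂ L,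
      ∀ k, g (MvPolynomial.X k) = ι ℂ (b k) := by
  let _ : CommRing (UniversalEnvelopingAlgebra ℂ L) :=
    { (inferInstance : Ring (UniversalEnvelopingAlgebra ℂ L)) with
      mul_comm := mul_comm_of_abelian }
  exact ⟨MvPolynomial.aeval fun k => ι ℂ (b k), fun k => MvPolynomial.aeval_X _ k⟩

theorem exists_equiv_mvPolynomial [IsLieAbelian L] :
    ∃ e : UniversalEnvelopingAlgebra ℂ L ≃ₐ[ℂ] MvPolynomial ι' ℂ,
      ∀ x, e (ι ℂ x) = toPolyLie b x := by
  obtain ⟨g, hX⟩ := exists_algHom_of_abelian b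
  have hg : ∀ x, g (toPolyLie b x) = ι ℂ x := by
    intro x
    have : g.toLinearMap ∘ₗ (toPolyLie b : L →ₗ[ℂ] MvPolynomial ι' ℂ)
        = ((ι ℂ : L →ₗ⁅ℂ⁆ UniversalEnvelopingAlgebra ℂ L) : L →ₗ[ℂ] _) := by
      apply b.ext
      intro k
      change g (toPolyLie b (b k)) = ι ℂ (b k)
      rw [toPolyLie_basis, hX]
    exact DFunLike.congr_fun this x
  refine ⟨AlgEquiv.ofAlgHom (lift ℂ (toPolyLie b)) g ?_ ?_, fun x => lift_ι_apply ℂ _ x⟩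
  · apply MvPolynomial.algHom_ext
    intro k
    change lift ℂ (toPolyLie b) (g (MvPolynomial.X k)) = MvPolynomial.X k
    rw [hX, lift_ι_apply, toPolyLie_basis]
  · apply hom_ext
    ext x
    change g (lift ℂ (toPolyLie b) (ι ℂ x)) = ι ℂ x
    rw [lift_ι_apply, hg]

end UniversalEnvelopingAlgebra

end Enveloping

/-! ### Degree and leading coefficient from a finite difference. -/

namespace Polynomial

variable {S : Type*} [CommRing S]

/-- The m-th Taylor coefficient at a is the value of the m-th Hasse derivative, which has degree at
most one here: its constant term cancels against F, and its linear term remains. -/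
theorem coeff_taylor_sub (F : S[X]) (a : S) (m : ℕ) (h : F.natDegree ≤ m + 1) :
    (F.comp (X + C a) - F).coeff m = (m + 1) * a * F.coeff (m + 1) := by
  have hd : (hasseDeriv m F).natDegree ≤ 1 :=
    (natDegree_hasseDeriv_le F m).trans (by omega)
  rw [← taylor_apply, coeff_sub, taylor_coeff, eq_X_add_C_of_natDegree_le_one hd]
  simp only [hasseDeriv_coeff, eval_add, eval_mul, eval_C, eval_X, zero_add, Nat.choose_self,
    Nat.cast_one, one_mul, add_comm 1 m, Nat.choose_succ_self_right]
  push_cast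
  ring

theorem natDegree_comp_X_add_C (F : S[X]) (a : S) : (F.comp (X + C a)).natDegree = F.natDegree := by
  rw [← taylor_apply, natDegree_taylor]

theorem coeff_comp_X_add_C (F : S[X]) (a : S) :
    (F.comp (X + C a)).coeff F.natDegree = F.coeff F.natDegree := by
  rw [← taylor_apply]
  exact coeff_taylor_natDegree a F

variable [IsDomain S] [CharZero S]

/-- If the difference `F(T + a) - F(T)` has degree at most `m`, then `F` has degree at most
`m + 1`. -/
theorem natDegree_le_of_taylor_sub (F : S[X]) {a : S} (ha : a ≠ 0) (m : ℕ)
    (h : (F.comp (X + C a) - F).natDegree ≤ m) : F.natDegree ≤ m + 1 := by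
  by_contra hc
  obtain ⟨k, hk⟩ : ∃ k, F.natDegree = k + 1 := ⟨F.natDegree - 1, by omega⟩
  have h1 := coeff_taylor_sub F a k hk.le
  rw [coeff_eq_zero_of_natDegree_lt (by omega)] at h1
  have h2 : F.coeff (k + 1) ≠ 0 := by
    rw [← hk, coeff_natDegree, leadingCoeff_ne_zero]
    rintro rfl
    simp at hk
  exact (mul_ne_zero (mul_ne_zero (Nat.cast_add_one_ne_zero k) ha) h2) h1.symm

theorem natDegree_eq_zero_of_taylor_eq (F : S[X]) {a : S} (ha : a ≠ 0)
    (h : F.comp (X + C a) = F) : F.natDegree = 0 := by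
  have h1 : F.natDegree ≤ 0 + 1 := natDegree_le_of_taylor_sub F ha 0 (by rw [h, sub_self]; simp)
  have h2 := coeff_taylor_sub F a 0 h1
  rw [h, sub_self] at h2
  simp only [coeff_zero, CharP.cast_eq_zero, zero_add, one_mul] at h2
  have h3 := (mul_eq_zero.mp h2.symm).resolve_left ha
  by_contra hc
  have h4 : F.natDegree = 1 := by omega
  rw [← h4, coeff_natDegree, leadingCoeff_eq_zero] at h3
  simp [h3] at hc

/-- Meant for F a product of two unknown polynomials: a bracket relation expresses the difference of
F, and the conclusion bounds both factors. The quadratic version below plays the same role for the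
bracket of `t^r dᵢ` with `t^(-r) dᵢ`. -/
theorem natDegree_eq_one_of_taylor_sub (F : S[X]) {a c : S} (ha : a ≠ 0) (hc : c ≠ 0)
    (h : F.comp (X + C a) - F = C c) : F.natDegree = 1 ∧ a * F.coeff 1 = c := by
  have h1 : F.natDegree ≤ 0 + 1 := natDegree_le_of_taylor_sub F ha 0 (by rw [h]; simp)
  have h2 := coeff_taylor_sub F a 0 h1
  rw [h] at h2
  simp only [coeff_C_zero, CharP.cast_eq_zero, zero_add, one_mul] at h2
  refine ⟨le_antisymm h1 ?_, h2.symm⟩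
  apply le_natDegree_of_ne_zero
  rintro h3
  rw [h3, mul_zero] at h2
  exact hc h2

theorem natDegree_eq_two_of_taylor_sub (F : S[X]) {a c e : S} (ha : a ≠ 0) (hc : c ≠ 0)
    (h : F.comp (X + C a) - F = C c * X + C e) : F.natDegree = 2 ∧ 2 * a * F.coeff 2 = c := by
  have h1 : F.natDegree ≤ 1 + 1 :=
    natDegree_le_of_taylor_sub F ha 1 (by rw [h]; exact natDegree_linear_le)
  have h2 := coeff_taylor_sub F a 1 h1
  rw [h] at h2
  simp only [coeff_add, coeff_C_mul, coeff_X_one, coeff_C_succ, mul_one, add_zero,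
    Nat.cast_one, one_add_one_eq_two] at h2
  refine ⟨le_antisymm h1 ?_, h2.symm⟩
  apply le_natDegree_of_ne_zero
  rintro h3
  rw [h3, mul_zero] at h2
  exact hc h2

end Polynomial

/-! ### Integral translations and expansion along a direction. -/

namespace MvPolynomial

variable {σ : Type*} {R : Type*} [CommRing R]

/-- The translation `f(d) ↦ f(d - r)`. -/
def shiftBy (r : σ → ℤ) : MvPolynomial σ R →ₐ[R] MvPolynomial σ R :=
  aeval fun j => X j - (r j : MvPolynomial σ R)

/-- The expansion `f(d) ↦ f(d + T r)` along a direction. -/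
def dir (r : σ → ℤ) : MvPolynomial σ R →ₐ[R] Polynomial (MvPolynomial σ R) :=
  aeval fun j => Polynomial.C (X j) + (r j : Polynomial (MvPolynomial σ R)) * Polynomial.X

theorem shiftBy_X (r : σ → ℤ) (j : σ) :
    shiftBy r (X j : MvPolynomial σ R) = X j - (r j : MvPolynomial σ R) :=
  aeval_X _ j

theorem shiftBy_C (r : σ → ℤ) (c : R) : shiftBy r (C c : MvPolynomial σ R) = C c :=
  (shiftBy r).commutes c

theorem shiftBy_zero : shiftBy (0 : σ → ℤ) = AlgHom.id R (MvPolynomial σ R) := by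
  ext j; simp [shiftBy]

theorem shiftBy_zero_apply (p : MvPolynomial σ R) : shiftBy (0 : σ → ℤ) p = p := by
  rw [shiftBy_zero]; rfl

theorem shiftBy_add (r s : σ → ℤ) :
    (shiftBy (r + s) : MvPolynomial σ R →ₐ[R] MvPolynomial σ R) = (shiftBy r).comp (shiftBy s) := by
  apply algHom_ext
  intro j
  simp only [AlgHom.comp_apply, shiftBy_X, map_sub, map_intCast, Pi.add_apply, Int.cast_add]
  ring

theorem shiftBy_shiftBy (r s : σ → ℤ) (p : MvPolynomial σ R) :
    shiftBy r (shiftBy s p) = shiftBy (r + s) p := by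
  rw [shiftBy_add]; rfl

theorem shiftBy_neg_shiftBy (r : σ → ℤ) (p : MvPolynomial σ R) :
    shiftBy (-r) (shiftBy r p) = p := by
  rw [shiftBy_shiftBy, neg_add_cancel, shiftBy_zero]; rfl

theorem dir_X (r : σ → ℤ) (j : σ) : dir r (X j : MvPolynomial σ R)
    = Polynomial.C (X j) + (r j : Polynomial (MvPolynomial σ R)) * Polynomial.X := aeval_X _ j

theorem dir_C (r : σ → ℤ) (c : R) : dir r (C c : MvPolynomial σ R) = Polynomial.C (C c) :=
  (dir r).commutes c

theorem eval_dir (r : σ → ℤ) (p : MvPolynomial σ R) :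
    (dir r p).eval 0 = p := by
  let f : MvPolynomial σ R →ₐ[R] MvPolynomial σ R :=
    ((Polynomial.aeval (R := MvPolynomial σ R) 0).restrictScalars R).comp (dir r)
  have h : f = AlgHom.id R _ := by
    apply algHom_ext
    intro j
    simp [f, dir_X]
  have := DFunLike.congr_fun h p
  simpa [f, Polynomial.aeval_def, Polynomial.eval₂_eq_eval_map] using this

theorem dir_injective (r : σ → ℤ) :
    Function.Injective (dir r : MvPolynomial σ R → Polynomial (MvPolynomial σ R)) :=
  Function.LeftInverse.injective (eval_dir r)

/-- Translation along r becomes translation of the one variable T, so the finite difference lemmas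
apply to multivariate polynomials. -/
theorem dir_shiftBy_zsmul (r : σ → ℤ) (m : ℤ) (p : MvPolynomial σ R) :
    dir r (shiftBy (m • r) p)
      = (dir r p).comp (Polynomial.X + Polynomial.C (-m : MvPolynomial σ R)) := by
  induction p using MvPolynomial.induction_on with
  | C c => rw [shiftBy_C, dir_C, Polynomial.C_comp]
  | add p q hp hq => rw [map_add, map_add, map_add, hp, hq, Polynomial.add_comp]
  | mul_X p j hp =>
    rw [map_mul, map_mul, map_mul, hp, Polynomial.mul_comp]
    simp only [shiftBy_X, dir_X, map_sub, map_intCast, Polynomial.add_comp, Polynomial.mul_comp,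
      Polynomial.C_comp, Polynomial.X_comp, Polynomial.intCast_comp, Pi.smul_apply, smul_eq_mul,
      Int.cast_mul, map_neg, map_mul]
    ring

theorem dir_shiftBy (r : σ → ℤ) (p : MvPolynomial σ R) :
    dir r (shiftBy r p) = (dir r p).comp (Polynomial.X + Polynomial.C (-1)) := by
  simpa using dir_shiftBy_zsmul r 1 p

theorem dir_shiftBy_neg (r : σ → ℤ) (p : MvPolynomial σ R) :
    dir r (shiftBy (-r) p) = (dir r p).comp (Polynomial.X + Polynomial.C 1) := by
  simpa using dir_shiftBy_zsmul r (-1) p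

theorem shiftBy_algebraMap [Algebra ℂ R] (r : σ → ℤ) (c : ℂ) :
    shiftBy r (algebraMap ℂ (MvPolynomial σ R) c) = algebraMap ℂ (MvPolynomial σ R) c :=
  shiftBy_C r (algebraMap ℂ R c)

theorem dir_eq_C {r : σ → ℤ} {p : MvPolynomial σ R} (h : (dir r p).natDegree = 0) :
    dir r p = Polynomial.C p := by
  have h1 := Polynomial.eq_C_of_natDegree_eq_zero h
  rw [Polynomial.coeff_zero_eq_eval_zero, eval_dir] at h1
  exact h1

theorem shiftBy_eq_of_natDegree_dir {r : σ → ℤ} {p : MvPolynomial σ R}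
    (h : (dir r p).natDegree = 0) : shiftBy r p = p := by
  apply dir_injective r
  rw [dir_shiftBy, dir_eq_C h, Polynomial.C_comp]

variable [IsDomain R] [CharZero R]

theorem natDegree_dir_of_shiftBy_eq {r : σ → ℤ} {p : MvPolynomial σ R} (h : shiftBy r p = p) :
    (dir r p).natDegree = 0 := by
  refine Polynomial.natDegree_eq_zero_of_taylor_eq _ (a := -1) (by simp) ?_
  rw [← dir_shiftBy, h]

/-- A polynomial that is invariant under all integral translations is constant. -/
theorem eq_C_of_shiftBy_eq {p : MvPolynomial σ R} (h : ∀ r, shiftBy r p = p) :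
    p = C (constantCoeff p) := by
  -- Integral points suffice to identify a polynomial, and the value at the point m is the value at
  -- 0 of the translate by -m.
  refine funext_set (fun _ => Set.range ((↑) : ℤ → R))
    (fun _ => Set.infinite_range_of_injective Int.cast_injective) fun x hx => ?_
  have hx' : ∀ i, ∃ m : ℤ, (m : R) = x i := fun i => hx i trivial
  choose m hm using hx'
  have key : ∀ q : MvPolynomial σ R, eval x q = eval 0 (shiftBy (-m) q) := by
    intro q
    induction q using MvPolynomial.induction_on with
    | C c => simp
    | add p q hp hq => rw [map_add, map_add, map_add, hp, hq]
    | mul_X p j hp => rw [map_mul, map_mul, map_mul, hp, shiftBy_X]; simp [hm]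
  rw [key p, h, eval_C, eval_zero]

end MvPolynomial

/-! ### The functional equations for the values at 1. -/

namespace FullToroidal

open MvPolynomial

section Degree

variable {n : ℕ} {R : Type*} [CommRing R] [IsDomain R] [Algebra ℂ R]
  (h : R) (p : (Fin n → ℤ) → MvPolynomial (Fin n) R)
  (g : (Fin n → ℤ) → Fin n → MvPolynomial (Fin n) R)

/-- In the application R is `S(𝔥)`, `p s` is `h(s)·1`, `g r i` is `t^r dᵢ·1`, and `hA` is the
bracket of `t^r dᵢ` with `h(s)`. Take s = -r and let P and G be the expansions of `p (-r)` and `g r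
i`. Then `F(T) = P(T - m) G(T)` satisfies `F(T + m) - F(T) = m tᵢ h`, so F has degree one and
leading coefficient `tᵢ h`. -/
theorem natDegree_dir_add (h0 : h ≠ 0) (hp : p 0 = C h)
    (hA : ∀ r s i, shiftBy r (p s) * g r i - shiftBy s (g r i) * p s
      = (s i : MvPolynomial (Fin n) R) * p (r + s))
    (t : Fin n → ℤ) (m : ℤ) (i : Fin n) (hm : m ≠ 0) (ht : t i ≠ 0) :
    (dir t (p (-(m • t)))).natDegree + (dir t (g (m • t) i)).natDegree = 1
      ∧ (dir t (p (-(m • t)))).leadingCoeff * (dir t (g (m • t) i)).leadingCoeff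
        = (t i : MvPolynomial (Fin n) R) * C h := by
  have : CharZero R := charZero_of_injective_algebraMap (algebraMap ℂ R).injective
  set r := m • t with hr
  set P := dir t (p (-r))
  set G := dir t (g r i)
  have hmB : (m : MvPolynomial (Fin n) R) ≠ 0 := Int.cast_ne_zero.mpr hm
  have hc : (m : MvPolynomial (Fin n) R) * ((t i : MvPolynomial (Fin n) R) * C h) ≠ 0 :=
    mul_ne_zero hmB (mul_ne_zero (Int.cast_ne_zero.mpr ht) (by simpa using h0))
  have h1 := congrArg (dir t) (hA r (-r) i)
  rw [add_neg_cancel, hp, map_sub, map_mul, map_mul, map_mul, map_intCast, dir_C, hr,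
    dir_shiftBy_zsmul, ← neg_smul, dir_shiftBy_zsmul, neg_smul, ← hr] at h1
  obtain ⟨hd, hl⟩ := Polynomial.natDegree_eq_one_of_taylor_sub
    (P.comp (Polynomial.X + Polynomial.C (-(m : MvPolynomial (Fin n) R))) * G) hmB hc (by
      rw [Polynomial.mul_comp, Polynomial.comp_assoc]
      have e : (Polynomial.X + Polynomial.C (-(m : MvPolynomial (Fin n) R))).comp
          (Polynomial.X + Polynomial.C (m : MvPolynomial (Fin n) R)) = Polynomial.X := by simp
      rw [e, Polynomial.comp_X]
      simp only [Pi.neg_apply, hr, Pi.smul_apply, smul_eq_mul, Int.cast_neg, Int.cast_mul,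
        neg_neg, map_mul] at h1 ⊢
      simp only [map_intCast] at h1 ⊢
      linear_combination -h1)
  have hne := Polynomial.ne_zero_of_natDegree_gt (n := 0) (hd ▸ one_pos)
  have hP : P.comp (Polynomial.X + Polynomial.C (-(m : MvPolynomial (Fin n) R))) ≠ 0 :=
    left_ne_zero_of_mul hne
  have hG : G ≠ 0 := right_ne_zero_of_mul hne
  have hlc : ((P.comp (Polynomial.X + Polynomial.C (-(m : MvPolynomial (Fin n) R)))) * G).coeff 1
      = P.leadingCoeff * G.leadingCoeff := by
    rw [← hd, Polynomial.coeff_natDegree, Polynomial.leadingCoeff_mul]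
    congr 1
    rw [← Polynomial.coeff_natDegree, Polynomial.natDegree_comp_X_add_C,
      Polynomial.coeff_comp_X_add_C]
    rfl
  constructor
  · rw [Polynomial.natDegree_mul hP hG, Polynomial.natDegree_comp_X_add_C] at hd
    exact hd
  · rw [hlc] at hl
    exact mul_left_cancel₀ hmB hl

/-- The hypothesis `hB` is the bracket of `t^r dᵢ` with `t^(-r) dᵢ`, where κ is the contribution of
the centre. It shows that `g r i` and `g (-r) i` have total degree two along r, which leaves degree
zero for `p r`. Their leading coefficients multiply to `rᵢ²`, a unit, so each is a scalar by `hU`,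
and so is the ratio of `p r` to h. -/
theorem exists_smul_of_relations (hU : ∀ u : R, IsUnit u → ∃ c : ℂ, algebraMap ℂ R c = u)
    (h0 : h ≠ 0) (hp : p 0 = C h)
    (hA : ∀ r s i, shiftBy r (p s) * g r i - shiftBy s (g r i) * p s
      = (s i : MvPolynomial (Fin n) R) * p (r + s))
    (hB : ∀ r i, r i ≠ 0 → ∃ κ : MvPolynomial (Fin n) R, shiftBy r κ * g r i = κ * g r i ∧
      shiftBy r (g (-r) i) * g r i - shiftBy (-r) (g r i) * g (-r) i
        = -(2 * (r i : MvPolynomial (Fin n) R) * X i) + κ)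
    (r : Fin n → ℤ) :
    ∃ c : ℂ, c ≠ 0 ∧ p r = algebraMap ℂ (MvPolynomial (Fin n) R) c * C h := by
  have : CharZero R := charZero_of_injective_algebraMap (algebraMap ℂ R).injective
  by_cases hr : r = 0
  · exact ⟨1, one_ne_zero, by rw [hr, hp, map_one, one_mul]⟩
  obtain ⟨i, hi⟩ : ∃ i, r i ≠ 0 := by
    by_contra hcon
    push Not at hcon
    exact hr (funext hcon)
  -- The signs m = 1 and m = -1 give the pairs `p (-r)`, `g r i` and `p r`, `g (-r) i`, all expanded
  -- along the same direction r.
  obtain ⟨hd1, hl1⟩ := natDegree_dir_add h p g h0 hp hA r 1 i one_ne_zero hi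
  obtain ⟨hd2, hl2⟩ := natDegree_dir_add h p g h0 hp hA r (-1) i (by norm_num) hi
  simp only [neg_smul, one_smul, neg_neg] at hd1 hl1 hd2 hl2
  obtain ⟨κ, hκ, hb⟩ := hB r i hi
  have hiB : (r i : MvPolynomial (Fin n) R) ≠ 0 := Int.cast_ne_zero.mpr hi
  have hCh : (C h : MvPolynomial (Fin n) R) ≠ 0 := by simpa using h0
  set G := dir r (g r i)
  set G' := dir r (g (-r) i)
  have hG : G ≠ 0 := by
    intro hz
    rw [hz, Polynomial.leadingCoeff_zero, mul_zero] at hl1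
    exact mul_ne_zero hiB hCh hl1.symm
  have hG' : G' ≠ 0 := by
    intro hz
    rw [hz, Polynomial.leadingCoeff_zero, mul_zero] at hl2
    exact mul_ne_zero hiB hCh hl2.symm
  have hgne : g r i ≠ 0 := by
    rintro hz
    exact hG (by simp [G, hz])
  -- Thus κ is constant along r and does not affect the leading coefficient of the difference.
  have hκ' : shiftBy r κ = κ := mul_right_cancel₀ hgne hκ
  have h1 := congrArg (dir r) hb
  rw [map_sub, map_mul, map_mul, dir_shiftBy, dir_shiftBy_neg, map_add, map_neg (dir r),
    dir_eq_C (natDegree_dir_of_shiftBy_eq hκ')] at h1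
  simp only [map_mul, map_intCast, map_ofNat, dir_X] at h1
  -- The difference of `G'(T - 1) G(T)` is `2 rᵢ (dᵢ + rᵢ T) - κ`, linear in T with leading
  -- coefficient `2 rᵢ²`.
  obtain ⟨hd, hl⟩ := Polynomial.natDegree_eq_two_of_taylor_sub
    (G'.comp (Polynomial.X + Polynomial.C (-1)) * G) (one_ne_zero)
    (c := 2 * (r i : MvPolynomial (Fin n) R) * r i)
    (e := 2 * (r i : MvPolynomial (Fin n) R) * X i - κ)
    (mul_ne_zero (mul_ne_zero two_ne_zero hiB) hiB) (by
      rw [Polynomial.mul_comp, Polynomial.comp_assoc]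
      have e : (Polynomial.X + Polynomial.C (-1 : MvPolynomial (Fin n) R)).comp
          (Polynomial.X + Polynomial.C 1) = Polynomial.X := by simp
      rw [e, Polynomial.comp_X]
      simp only [map_sub, map_mul, map_intCast, map_ofNat]
      linear_combination -h1)
  have hGc : G'.comp (Polynomial.X + Polynomial.C (-1)) ≠ 0 := by
    intro hz
    rw [hz] at hd
    simp at hd
  have hlc : ((G'.comp (Polynomial.X + Polynomial.C (-1))) * G).coeff 2
      = G'.leadingCoeff * G.leadingCoeff := by
    rw [← hd, Polynomial.coeff_natDegree, Polynomial.leadingCoeff_mul]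
    congr 1
    rw [← Polynomial.coeff_natDegree, Polynomial.natDegree_comp_X_add_C,
      Polynomial.coeff_comp_X_add_C]
    rfl
  rw [Polynomial.natDegree_mul hGc hG, Polynomial.natDegree_comp_X_add_C] at hd
  -- The sum of the degrees in `hd1` and `hd2` is 2, and by `hd` the Witt elements account for all
  -- of it.
  have hP0 : (dir r (p r)).natDegree = 0 := by omega
  rw [hlc, mul_one, mul_assoc 2] at hl
  have hll : G'.leadingCoeff * G.leadingCoeff = r i * r i :=
    mul_left_cancel₀ two_ne_zero hl
  have hunit : IsUnit (r i * r i : MvPolynomial (Fin n) R) := by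
    have e : (r i * r i : MvPolynomial (Fin n) R)
        = algebraMap ℂ (MvPolynomial (Fin n) R) (r i * r i) := by simp
    rw [e]
    exact (IsUnit.mk0 _ (mul_ne_zero (Int.cast_ne_zero.mpr hi) (Int.cast_ne_zero.mpr hi))).map _
  obtain ⟨u, hu, hu'⟩ := isUnit_iff_eq_C_of_isReduced.mp
    (isUnit_of_mul_isUnit_left (hll ▸ hunit : IsUnit (G'.leadingCoeff * G.leadingCoeff)))
  obtain ⟨c, rfl⟩ := hU u hu
  have hc : c ≠ 0 := by
    rintro rfl
    simp at hu
  have hCc : (C (algebraMap ℂ R c) : MvPolynomial (Fin n) R)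
    = algebraMap ℂ (MvPolynomial (Fin n) R) c := rfl
  rw [hu', hCc, dir_eq_C hP0, Polynomial.leadingCoeff_C] at hl2
  refine ⟨c⁻¹ * r i, mul_ne_zero (inv_ne_zero hc) (Int.cast_ne_zero.mpr hi), ?_⟩
  have e : algebraMap ℂ (MvPolynomial (Fin n) R) c
      * algebraMap ℂ (MvPolynomial (Fin n) R) c⁻¹ = 1 := by
    rw [← map_mul, mul_inv_cancel₀ hc, map_one]
  rw [map_mul, map_intCast]
  linear_combination (algebraMap ℂ (MvPolynomial (Fin n) R) c⁻¹) * hl2 - p r * e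

/-- Additivity of `s ↦ sᵢ ch(r + s) / ch(s)` forces the quotient to be independent of s as long as
`sᵢ ≠ 0`. Evaluating it at s = -r identifies it with `1 / ch(-r)`, which is `ch r`. -/
theorem eq_mul_of_additive (ch : (Fin n → ℤ) → ℂˣ) (h1 : ch 0 = 1)
    (hadd : ∀ r i s t, (s i : ℂ) * (ch (r + s) / ch s : ℂˣ) + (t i : ℂ) * (ch (r + t) / ch t : ℂˣ)
      = ((s + t) i : ℤ) * (ch (r + (s + t)) / ch (s + t) : ℂˣ)) (r s : Fin n → ℤ) :
    ch (r + s) = ch r * ch s := by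
  have hconst : ∀ r i s t, s i ≠ 0 → t i ≠ 0 → ch (r + s) / ch s = ch (r + t) / ch t := by
    intro r i s t hs ht
    let φ : (Fin n → ℤ) →+ ℂ :=
      { toFun := fun s => (s i : ℂ) * (ch (r + s) / ch s : ℂˣ)
        map_zero' := by simp
        map_add' := fun s t => (hadd r i s t).symm }
    -- The i-th coordinate of this combination is zero, and φ has it as a factor.
    have e0 : φ (t i • s - s i • t) = 0 := by
      change (((t i • s - s i • t) i : ℤ) : ℂ) * _ = 0
      have : (t i • s - s i • t) i = 0 := by
        simp only [Pi.sub_apply, Pi.smul_apply, smul_eq_mul]; ring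
      rw [this, Int.cast_zero, zero_mul]
    rw [map_sub, map_zsmul, map_zsmul] at e0
    change (t i) • ((s i : ℂ) * (ch (r + s) / ch s : ℂˣ))
      - (s i) • ((t i : ℂ) * (ch (r + t) / ch t : ℂˣ)) = 0 at e0
    simp only [zsmul_eq_mul] at e0
    have hs' : (s i : ℂ) ≠ 0 := Int.cast_ne_zero.mpr hs
    have ht' : (t i : ℂ) ≠ 0 := Int.cast_ne_zero.mpr ht
    apply Units.ext
    apply mul_left_cancel₀ (mul_ne_zero hs' ht')
    linear_combination e0
  have hinv : ∀ r i, r i ≠ 0 → ch r * ch (-r) = 1 := by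
    intro r i hr
    -- These give `1 / ch(-r) = ch(-r) / ch(-2r)` and `1 / ch(r) = ch(-2r) / ch(-r)`; the product of
    -- the right-hand sides is 1.
    have a1 := hconst r i (-r) (-((2 : ℤ) • r)) (by simpa using hr) (by simpa using hr)
    have a2 := hconst (-r) i r (-r) hr (by simpa using hr)
    have e1 : r + -((2 : ℤ) • r) = -r := by module
    have e2 : -r + -r = -((2 : ℤ) • r) := by module
    rw [add_neg_cancel, h1, e1] at a1
    rw [neg_add_cancel, h1, e2] at a2
    have a3 : (1 / ch r) * (1 / ch (-r)) = 1 := by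
      rw [a1, a2, div_mul_div_cancel, div_self']
    rwa [one_div, one_div, ← mul_inv, inv_eq_one] at a3
  have hshare : ∀ r s i, r i ≠ 0 → s i ≠ 0 → ch (r + s) = ch r * ch s := by
    intro r s i hr hs
    have a1 := hconst r i s (-r) hs (by simpa using hr)
    rw [add_neg_cancel, h1, div_eq_iff_eq_mul] at a1
    rw [a1, one_div, ← eq_inv_of_mul_eq_one_left (hinv r i hr)]
  by_cases hr : r = 0
  · rw [hr, zero_add, h1, one_mul]
  obtain ⟨i, hi⟩ : ∃ i, r i ≠ 0 := by
    by_contra hcon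
    push Not at hcon
    exact hr (funext hcon)
  by_cases hs : s i = 0
  · have a1 := hshare (r + s) (-r) i (by simpa [hs] using hi) (by simpa using hi)
    rw [add_neg_cancel_comm, eq_inv_of_mul_eq_one_right (hinv r i hi)] at a1
    rw [a1, mul_comm, mul_assoc, inv_mul_cancel, mul_one]
  · exact hshare r s i hi hs

/-- Once `p` is known up to scalars, `hA` says that every translation changes `g r i` by a scalar.
That scalar is additive in the translation vector, so `ch` is a character and the change is `sᵢ
ch(r)`, the same as for `ch(r) dᵢ`. What remains is invariant under all translations, hence in R. -/
theorem exists_normal_form (hU : ∀ u : R, IsUnit u → ∃ c : ℂ, algebraMap ℂ R c = u)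
    (h0 : h ≠ 0) (hp : p 0 = C h)
    (hA : ∀ r s i, shiftBy r (p s) * g r i - shiftBy s (g r i) * p s
      = (s i : MvPolynomial (Fin n) R) * p (r + s))
    (hB : ∀ r i, r i ≠ 0 → ∃ κ : MvPolynomial (Fin n) R, shiftBy r κ * g r i = κ * g r i ∧
      shiftBy r (g (-r) i) * g r i - shiftBy (-r) (g r i) * g (-r) i
        = -(2 * (r i : MvPolynomial (Fin n) R) * X i) + κ) :
    ∃ ch : (Fin n → ℤ) → ℂˣ, (∀ r s, ch (r + s) = ch r * ch s) ∧
      (∀ r, p r = algebraMap ℂ (MvPolynomial (Fin n) R) (ch r) * C h) ∧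
      ∃ β : (Fin n → ℤ) → Fin n → R, ∀ r i,
        g r i = algebraMap ℂ (MvPolynomial (Fin n) R) (ch r) * (X i - C (β r i)) := by
  have : CharZero R := charZero_of_injective_algebraMap (algebraMap ℂ R).injective
  have hCh : (C h : MvPolynomial (Fin n) R) ≠ 0 := by simpa using h0
  choose c hc hpc using exists_smul_of_relations h p g hU h0 hp hA hB
  let ch : (Fin n → ℤ) → ℂˣ := fun r => Units.mk0 (c r) (hc r)
  have hpch : ∀ r, p r = algebraMap ℂ (MvPolynomial (Fin n) R) (ch r) * C h := hpc
  have hinj : Function.Injective (algebraMap ℂ (MvPolynomial (Fin n) R)) :=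
    (algebraMap ℂ (MvPolynomial (Fin n) R)).injective
  have hne : ∀ r, algebraMap ℂ (MvPolynomial (Fin n) R) (ch r) ≠ 0 := fun r => by
    rw [Ne, map_eq_zero_iff _ hinj]
    exact (ch r).ne_zero
  have hdiff : ∀ r i s, g r i - shiftBy s (g r i)
      = (s i : MvPolynomial (Fin n) R)
        * algebraMap ℂ (MvPolynomial (Fin n) R) (ch (r + s) / ch s : ℂˣ) := by
    intro r i s
    apply mul_left_cancel₀ (mul_ne_zero (hne s) hCh)
    have e := hA r s i
    rw [hpch s, hpch (r + s), map_mul, shiftBy_algebraMap, shiftBy_C] at e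
    have e2 : algebraMap ℂ (MvPolynomial (Fin n) R) (ch s)
        * algebraMap ℂ (MvPolynomial (Fin n) R) (ch (r + s) / ch s : ℂˣ)
        = algebraMap ℂ (MvPolynomial (Fin n) R) (ch (r + s)) := by
      rw [← map_mul, ← Units.val_mul, mul_div_cancel]
    linear_combination e - s i * C h * e2
  have h1 : ch 0 = 1 := by
    have e := hpch 0
    rw [hp] at e
    have e2 : algebraMap ℂ (MvPolynomial (Fin n) R) (ch 0) = algebraMap ℂ _ 1 := by
      apply mul_right_cancel₀ hCh
      rw [← e, map_one, one_mul]
    exact Units.ext (hinj e2)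
  have hmul := eq_mul_of_additive ch h1 (by
    intro r i s t
    apply hinj
    simp only [map_add, map_mul, map_intCast]
    rw [← hdiff, ← hdiff, ← hdiff, ← shiftBy_shiftBy]
    have e := congrArg (shiftBy s) (hdiff r i t)
    rw [map_mul, map_intCast, shiftBy_algebraMap, ← hdiff, map_sub] at e
    linear_combination -e)
  have hβ : ∀ r i, ∃ b : R,
      g r i = algebraMap ℂ (MvPolynomial (Fin n) R) (ch r) * (X i - C b) := by
    intro r i
    have einv : algebraMap ℂ (MvPolynomial (Fin n) R) (ch r)
        * algebraMap ℂ (MvPolynomial (Fin n) R) (ch r)⁻¹ = 1 := by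
      rw [← map_mul, mul_inv_cancel₀ (ch r).ne_zero, map_one]
    have hinv : ∀ s, shiftBy s
        (X i - algebraMap ℂ (MvPolynomial (Fin n) R) (ch r)⁻¹ * g r i)
        = X i - algebraMap ℂ (MvPolynomial (Fin n) R) (ch r)⁻¹ * g r i := by
      intro s
      have e := hdiff r i s
      rw [hmul, mul_div_cancel_right] at e
      rw [map_sub, map_mul, shiftBy_algebraMap, shiftBy_X]
      linear_combination (algebraMap ℂ (MvPolynomial (Fin n) R) (ch r)⁻¹) * e + s i * einv
    refine ⟨constantCoeff (X i - algebraMap ℂ (MvPolynomial (Fin n) R) (ch r)⁻¹ * g r i), ?_⟩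
    rw [← eq_C_of_shiftBy_eq hinv]
    linear_combination -(g r i) * einv
  choose β hβ using hβ
  exact ⟨ch, hmul, hpch, β, hβ⟩

/-- Solutions of the relations between the constant terms of `t^r dᵢ` in the Witt algebra. -/
theorem exists_linear (β : (Fin n → ℤ) → Fin n → R) (h0 : ∀ i, β 0 i = 0)
    (hβ : ∀ r s i j, (r j : R) * (β r i - β (r + s) i) = s i * (β s j - β (r + s) j)) :
    ∃ b : R, ∀ r i, β r i = r i * b := by
  have : CharZero R := charZero_of_injective_algebraMap (algebraMap ℂ R).injective
  have hsingle : ∀ i (m : ℤ), β (Pi.single i m) i = m * β (Pi.single i 1) i := by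
    intro i
    set b := β (Pi.single i 1) i with hb
    -- The deviation from linearity on the i-th axis; it satisfies the relation of the Witt algebra
    -- in one variable.
    let f : ℤ → R := fun m => β (Pi.single i m) i - m * b
    have hf : ∀ m l : ℤ, (m : R) * f m - l * f l = (m - l) * f (m + l) := by
      intro m l
      have e := hβ (Pi.single i m) (Pi.single i l) i i
      rw [Pi.single_eq_same, Pi.single_eq_same, ← Pi.single_add] at e
      simp only [f]
      push_cast
      linear_combination e
    have f0 : f 0 = 0 := by simp [f, h0]
    have f1 : f 1 = 0 := by simp [f, hb]
    have hodd : ∀ m : ℤ, m ≠ 0 → f (-m) = -f m := by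
      intro m hm
      have e := hf m (-m)
      rw [add_neg_cancel, f0] at e
      apply mul_left_cancel₀ (Int.cast_ne_zero.mpr hm : (m : R) ≠ 0)
      push_cast at e
      linear_combination e
    have f2 : f 2 = 0 := by
      -- The value at 2 cannot be reached from the pair (1, 1), for which the factor m - l vanishes.
      have e := hf 2 (-1)
      rw [hodd 1 one_ne_zero] at e
      norm_num [f1] at e
      exact e
    have hnat : ∀ k : ℕ, f (k + 2) = 0 := by
      intro k
      induction k with
      | zero => simpa using f2
      | succ k ih =>
        have e := hf (k + 2) 1
        rw [ih, f1, mul_zero, mul_zero, sub_zero] at e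
        have e2 : (((k : ℤ) + 2 : ℤ) - (1 : ℤ) : R) ≠ 0 := by
          have : (((k : ℤ) + 2 : ℤ) - (1 : ℤ) : R) = ((k + 1 : ℕ) : R) := by push_cast; ring
          rw [this]
          exact Nat.cast_ne_zero.mpr (Nat.succ_ne_zero k)
        have e3 := (mul_eq_zero.mp e.symm).resolve_left e2
        rw [← e3]
        congr 1
    have hpos : ∀ m : ℤ, 0 ≤ m → f m = 0 := by
      intro m hm
      rcases (by omega : m = 0 ∨ m = 1 ∨ 2 ≤ m) with rfl | rfl | h2
      · exact f0
      · exact f1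
      · have := hnat (m - 2).toNat
        rwa [Int.toNat_of_nonneg (by omega), sub_add_cancel] at this
    intro m
    have : f m = 0 := by
      rcases le_or_gt 0 m with hm | hm
      · exact hpos m hm
      · have e := hodd (-m) (by omega)
        rw [neg_neg, hpos (-m) (by omega), neg_zero] at e
        exact e
    exact sub_eq_zero.mp this
  set b : Fin n → R := fun i => β (Pi.single i 1) i with hb
  have hgen : ∀ s i, s i ≠ 0 → β s i = s i * b i := by
    intro s i hs
    -- The first vector has i-th coordinate zero, so the relation moves the value from s to its
    -- projection on the i-th axis.
    have e := hβ (s - Pi.single i (s i)) (Pi.single i (s i)) i i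
    rw [sub_add_cancel, Pi.sub_apply, Pi.single_eq_same, sub_self, Int.cast_zero, zero_mul,
      hsingle] at e
    have e2 := (mul_eq_zero.mp e.symm).resolve_left (Int.cast_ne_zero.mpr hs)
    exact (sub_eq_zero.mp e2).symm
  have hzero : ∀ r i j, i ≠ j → r i = 0 → r j ≠ 0 → β r i = 0 ∧ b i = b j := by
    intro r i j hij hri hrj
    -- The left side does not involve m, so comparing m = 1 with m = 2 makes both `β r i` and `b i -
    -- b j` vanish.
    have key : ∀ m : ℤ, m ≠ 0 → β r i = m * (b i - b j) := by
      intro m hm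
      obtain ⟨s, hsi, hsj⟩ : ∃ s : Fin n → ℤ, s i = m ∧ s j = r j :=
        ⟨Pi.single i m + Pi.single j (r j), by simp [hij], by simp [hij.symm]⟩
      have e := hβ r s i j
      rw [hgen (r + s) i (by simp [hri, hsi, hm]), hgen (r + s) j (by simp [hsj, hrj]),
        hgen s j (by rwa [hsj]), hsi, hsj, Pi.add_apply, Pi.add_apply, hri, hsi, hsj, zero_add] at e
      apply mul_left_cancel₀ (Int.cast_ne_zero.mpr hrj : (r j : R) ≠ 0)
      push_cast at e
      linear_combination e
    have k1 := key 1 one_ne_zero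
    have k2 := key 2 two_ne_zero
    push_cast at k1 k2
    exact ⟨by linear_combination 2 * k1 - k2, by linear_combination k1 - k2⟩
  rcases isEmpty_or_nonempty (Fin n) with hn | ⟨⟨k⟩⟩
  · exact ⟨0, fun _ i => hn.elim i⟩
  have hbk : ∀ i, b i = b k := by
    intro i
    by_cases hik : i = k
    · rw [hik]
    · exact (hzero (Pi.single k 1) i k hik (Pi.single_eq_of_ne hik 1) (by simp)).2
  refine ⟨b k, fun r i => ?_⟩
  by_cases hri : r i = 0
  · rw [hri, Int.cast_zero, zero_mul]
    by_cases hr : r = 0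
    · rw [hr, h0]
    obtain ⟨j, hj⟩ : ∃ j, r j ≠ 0 := by
      by_contra hcon
      push Not at hcon
      exact hr (funext hcon)
    exact (hzero r i j (by rintro rfl; exact hj hri) hri hj).1
  · rw [hgen r i hri, hbk]

/-- The relation between `x(s)` and `x(0)` forces `x(s)` to agree with `x(0)` up to the shift. -/
theorem eq_C_of_shift_relation (b y : R) (s : Fin n → ℤ) (i : Fin n) (hs : s i ≠ 0)
    (q : MvPolynomial (Fin n) R)
    (hq : shiftBy (-s) q * (X i + (s i : MvPolynomial (Fin n) R) * C b)
        - (X i - (s i : MvPolynomial (Fin n) R) + (s i : MvPolynomial (Fin n) R) * C b) * q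
      = (s i : MvPolynomial (Fin n) R) * C y) : q = C y := by
  have : CharZero R := charZero_of_injective_algebraMap (algebraMap ℂ R).injective
  have hsB : (s i : MvPolynomial (Fin n) R) ≠ 0 := Int.cast_ne_zero.mpr hs
  set Q := dir s q with hQ
  have h1 := congrArg (dir s) hq
  simp only [map_sub, map_add, map_mul, map_intCast, dir_X, dir_C, dir_shiftBy_neg] at h1
  rw [← hQ] at h1
  set W := Q.comp (Polynomial.X + Polynomial.C 1) - Q with hW
  -- Here W is the difference of Q, so if Q has degree m + 1 > 0, the coefficient of `T^(m+1)` on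
  -- the left is `sᵢ` times (m + 1) + 1 times the leading coefficient of Q, while on the right it is
  -- zero.
  have h2 : W * (Polynomial.C (s i : MvPolynomial (Fin n) R) * Polynomial.X)
      + Polynomial.C (X i + (s i : MvPolynomial (Fin n) R) * C b) * W
      + Polynomial.C (s i : MvPolynomial (Fin n) R) * Q
      = Polynomial.C ((s i : MvPolynomial (Fin n) R) * C y) := by
    simp only [map_add, map_mul, map_intCast, hW]
    linear_combination h1
  have hdeg : Q.natDegree = 0 := by
    by_contra hc
    obtain ⟨m, hm⟩ : ∃ m, Q.natDegree = m + 1 := ⟨Q.natDegree - 1, by omega⟩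
    have hWm : W.coeff (m + 1) = 0 := by
      rw [hW, Polynomial.coeff_sub, ← hm, Polynomial.coeff_comp_X_add_C, sub_self]
    have h3 := congrArg (fun F => Polynomial.coeff F (m + 1)) h2
    simp only [Polynomial.coeff_add, ← mul_assoc, Polynomial.coeff_mul_X, Polynomial.coeff_mul_C,
      Polynomial.coeff_C_mul, Polynomial.coeff_C_succ, hW,
      Polynomial.coeff_taylor_sub Q 1 m hm.le] at h3
    have h4 : ((m + 2 : ℕ) : MvPolynomial (Fin n) R) * (s i * Q.coeff (m + 1)) = 0 := by
      push_cast
      rw [← hW, hWm] at h3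
      linear_combination h3
    have h5 : Q.coeff (m + 1) ≠ 0 := by
      rw [← hm, Polynomial.coeff_natDegree, Polynomial.leadingCoeff_ne_zero]
      intro hz
      rw [hz] at hc
      simp at hc
    exact mul_ne_zero (Nat.cast_ne_zero.mpr (by omega)) (mul_ne_zero hsB h5) h4
  have hinv : shiftBy (-s) q = q := by
    have e := congrArg (shiftBy (-s)) (shiftBy_eq_of_natDegree_dir hdeg)
    rw [shiftBy_neg_shiftBy] at e
    exact e.symm
  rw [hinv] at hq
  apply mul_left_cancel₀ hsB
  linear_combination hq

end Degree

end FullToroidal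

/-! ### Brackets of the homogeneous elements of the full toroidal algebra. -/

namespace FullToroidalAlgebra

open FullToroidal

variable {c₁ c₂ : ℂ} {n : ℕ} {𝔤 : Type*} [LieRing 𝔤] [LieAlgebra ℂ 𝔤]

variable (c₁ c₂) in
/-- The element `x(r) = x ⊗ t^r`. -/
def loopElt (r : Fin n → ℤ) (x : 𝔤) : FullToroidalAlgebra c₁ c₂ n 𝔤 := ⟨mono r ⊗ₜ[ℂ] x, 0, 0⟩

variable (c₁ c₂ 𝔤) in
/-- The element `t^r dᵢ`. -/
def wittElt (r : Fin n → ℤ) (i : Fin n) : FullToroidalAlgebra c₁ c₂ n 𝔤 :=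
  ⟨0, 0, mono r • euler i⟩

variable (c₁ c₂ 𝔤) in
/-- The inclusion of `𝒦_A`. -/
def cenElt : KA n →ₗ[ℂ] FullToroidalAlgebra c₁ c₂ n 𝔤 where
  toFun k := ⟨0, k, 0⟩
  map_add' k l := by ext1 <;> simp
  map_smul' c k := by ext1 <;> simp

theorem loopElt_add (r : Fin n → ℤ) (x y : 𝔤) :
    loopElt c₁ c₂ r (x + y) = loopElt c₁ c₂ r x + loopElt c₁ c₂ r y := by
  ext1 <;> simp [loopElt, TensorProduct.tmul_add]

theorem loopElt_smul (r : Fin n → ℤ) (c : ℂ) (x : 𝔤) :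
    loopElt c₁ c₂ r (c • x) = c • loopElt c₁ c₂ r x := by
  ext1 <;> simp [loopElt]

theorem loopElt_zero (r : Fin n → ℤ) : loopElt c₁ c₂ r (0 : 𝔤) = 0 := by
  ext1 <;> simp [loopElt]

theorem jac_mono_smul (r : Fin n → ℤ) (i k l : Fin n) :
    jac (mono r • euler i : Witt n) k l = if i = k then (r l : ℂ) • mono r else 0 := by
  rw [jac, Matrix.of_apply, coef_smul_euler]
  split_ifs
  · rw [euler_mono]
  · rw [map_zero]

theorem trace_jac_mono_smul (r : Fin n → ℤ) (i : Fin n) :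
    (jac (mono r • euler i : Witt n)).trace = (r i : ℂ) • mono r := by
  simp [Matrix.trace, jac_mono_smul]

theorem phi_mono_smul (r s : Fin n → ℤ) (i j : Fin n) :
    phi c₁ c₂ (mono r • euler i) (mono s • euler j)
      = (c₂ * (r i * s j) - c₁ * (s i * r j)) • dClass (mono r) (mono s) := by
  rw [phi, phi₁_eq, phi₂_eq, trace_jac_mono_smul, trace_jac_mono_smul]
  have h : trPair (jac (mono r • euler i : Witt n)) (jac (mono s • euler j))
      = ((s i : ℂ) * r j) • dClass (mono r) (mono s) := by
    simp only [trPair, jac_mono_smul]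
    rw [Finset.sum_eq_single i, Finset.sum_eq_single j]
    · simp [smul_smul]
    · intro l _ hl
      simp [hl.symm]
    · simp
    · intro k _ hk
      simp [hk.symm]
    · simp
  rw [h]
  simp only [map_smul, LinearMap.smul_apply]
  module

theorem loop_sub (X Y : FullToroidalAlgebra c₁ c₂ n 𝔤) : (X - Y).loop = X.loop - Y.loop := rfl

theorem cen_sub (X Y : FullToroidalAlgebra c₁ c₂ n 𝔤) : (X - Y).cen = X.cen - Y.cen := rfl

theorem der_sub (X Y : FullToroidalAlgebra c₁ c₂ n 𝔤) : (X - Y).der = X.der - Y.der := rfl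

theorem lieKA_zero (k : KA n) : lieKA 0 k = 0 := by
  have h := lieKA_smul 0 (0 : Witt n) k
  rwa [zero_smul, zero_smul] at h

theorem phi_zero_left (D : Witt n) : phi c₁ c₂ 0 D = 0 := by
  have h := phi_smul_left c₁ c₂ 0 (0 : Witt n) D
  rwa [zero_smul, zero_smul] at h

theorem phi_zero_right (D : Witt n) : phi c₁ c₂ D 0 = 0 := by
  rw [phi_swap, phi_zero_left, neg_zero]

theorem derLoop_zero (X : Laurent n ⊗[ℂ] 𝔤) : derLoop 0 X = 0 := by
  have h := derLoop_smul 0 (0 : Witt n) X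
  rwa [zero_smul, zero_smul] at h

theorem wittElt_lie_loopElt (r s : Fin n → ℤ) (i : Fin n) (x : 𝔤) :
    ⁅wittElt c₁ c₂ 𝔤 r i, loopElt c₁ c₂ s x⁆ = (s i : ℂ) • loopElt c₁ c₂ (r + s) x := by
  ext1
  · simp [wittElt, loopElt, loop_lie, derLoop_tmul, derLoop_zero, euler_mono, mono_add,
      TensorProduct.smul_tmul']
  · simp [wittElt, loopElt, cen_lie, phi_zero_right, lieKA_zero]
  · simp [wittElt, loopElt, der_lie]

theorem loopElt_lie_loopElt (r s : Fin n → ℤ) (x y : 𝔤) :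
    ⁅loopElt c₁ c₂ r x, loopElt c₁ c₂ s y⁆ = loopElt c₁ c₂ (r + s) ⁅x, y⁆
      + cenElt c₁ c₂ 𝔤 (killingForm ℂ 𝔤 x y • dClass (mono r) (mono s)) := by
  ext1
  · simp [loopElt, cenElt, loop_lie, mono_add, derLoop_zero]
  · simp [loopElt, cenElt, cen_lie, loopCocycle_tmul, phi_zero_right, lieKA_zero]
  · simp [loopElt, cenElt, der_lie]

theorem wittElt_lie_wittElt (r s : Fin n → ℤ) (i j : Fin n) :
    ⁅wittElt c₁ c₂ 𝔤 r i, wittElt c₁ c₂ 𝔤 s j⁆ = (s i : ℂ) • wittElt c₁ c₂ 𝔤 (r + s) j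
      - (r j : ℂ) • wittElt c₁ c₂ 𝔤 (r + s) i
      + cenElt c₁ c₂ 𝔤 (phi c₁ c₂ (mono r • euler i) (mono s • euler j)) := by
  have h : ⁅(mono r • euler i : Witt n), (mono s • euler j : Witt n)⁆
      = (s i : ℂ) • (mono (r + s) • euler j) - (r j : ℂ) • (mono (r + s) • euler i) := by
    ext1 f
    simp only [Derivation.commutator_apply, Derivation.smul_apply, Derivation.sub_apply,
      Derivation.leibniz, smul_eq_mul, euler_mono, mono_add, euler_comm j i, mul_smul_comm]
    rw [mul_comm (mono s) (mono r), mul_left_comm (mono s) (mono r)]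
    simp only [Algebra.smul_def]
    ring
  ext1
  · simp [wittElt, cenElt, loop_lie, loop_sub]
  · simp [wittElt, cenElt, cen_lie, cen_sub]
  · rw [der_lie]
    refine h.trans ?_
    simp [wittElt, cenElt, der_sub]

theorem wittElt_lie_cenElt (r : Fin n → ℤ) (i : Fin n) (k : KA n) :
    ⁅wittElt c₁ c₂ 𝔤 r i, cenElt c₁ c₂ 𝔤 k⁆ = cenElt c₁ c₂ 𝔤 (lieKA (mono r • euler i) k) := by
  ext1
  · simp [wittElt, cenElt, loop_lie]
  · simp [wittElt, cenElt, cen_lie, phi_zero_right, lieKA_zero]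
  · simp [wittElt, cenElt, der_lie]

theorem loopElt_lie_cenElt (r : Fin n → ℤ) (x : 𝔤) (k : KA n) :
    ⁅loopElt c₁ c₂ r x, cenElt c₁ c₂ 𝔤 k⁆ = 0 := by
  ext1
  · simp [loopElt, cenElt, loop_lie, derLoop_zero]
  · simp [loopElt, cenElt, cen_lie, phi_zero_right, lieKA_zero]
  · simp [loopElt, cenElt, der_lie]

end FullToroidalAlgebra

/-! ### Semilinear operators, translation-invariant polynomials and characters of `ℤⁿ`. -/

namespace FullToroidal

open MvPolynomial FullToroidalAlgebra

section Polynomials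

variable {ι σ : Type*}

/-- A linear operator that is semilinear with respect to the action of the variables is
determined by its value at `1`. -/
theorem eq_algHom_mul
    (φ : MvPolynomial σ (MvPolynomial ι ℂ) →ₐ[ℂ] MvPolynomial σ (MvPolynomial ι ℂ))
    (T : Module.End ℂ (MvPolynomial σ (MvPolynomial ι ℂ)))
    (hC : ∀ k f, T (C (X k) * f) = φ (C (X k)) * T f) (hX : ∀ i f, T (X i * f) = φ (X i) * T f)
    (f g : MvPolynomial σ (MvPolynomial ι ℂ)) : T (f * g) = φ f * T g := by
  induction f using MvPolynomial.induction_on generalizing g with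
  | C c =>
    induction c using MvPolynomial.induction_on generalizing g with
    | C c =>
      have e : (C (C c) : MvPolynomial σ (MvPolynomial ι ℂ)) = algebraMap ℂ _ c := rfl
      rw [e, AlgHom.commutes, ← Algebra.smul_def, ← Algebra.smul_def, map_smul]
    | add p q hp hq => rw [map_add, map_add, add_mul, add_mul, map_add, hp, hq]
    | mul_X p k hp => rw [C_mul, mul_assoc, hp, hC, map_mul φ, mul_assoc]
  | add p q hp hq => rw [map_add, add_mul, add_mul, map_add, hp, hq]
  | mul_X p k hp => rw [mul_assoc, hp, hX, map_mul φ, mul_assoc]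

/-- A polynomial invariant under translations by a spanning set of vectors is constant. -/
theorem eq_C_of_translations {κ : Type*} (v : κ → ι → ℂ)
    (hv : Submodule.span ℂ (Set.range v) = ⊤) (c : MvPolynomial ι ℂ)
    (hc : ∀ a, aeval (fun k => X k - C (v a k)) c = c) : ∃ z : ℂ, c = C z := by
  let S : Submodule ℂ (ι → ℂ) :=
    { carrier := {w | ∀ u : ι → ℂ, eval (u + w) c = eval u c}
      zero_mem' := fun u => by rw [add_zero]
      add_mem' := fun {w w'} hw hw' u => by rw [← add_assoc, hw', hw]
      smul_mem' := fun z w hw u => by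
        -- A period w gives all natural multiples of w as periods; restricted to the line through u
        -- in direction w, the polynomial takes one value infinitely often, so it is constant there
        -- and w may be scaled by any complex number.
        have hn : ∀ m : ℕ, eval (u + (m : ℂ) • w) c = eval u c := by
          intro m
          induction m with
          | zero => simp
          | succ m ih =>
            rw [Nat.cast_succ, add_smul, one_smul, ← add_assoc, hw, ih]
        let q : Polynomial ℂ :=
          aeval (fun k => Polynomial.C (u k) + Polynomial.X * Polynomial.C (w k)) c
            - Polynomial.C (eval u c)
        have hq : ∀ t : ℂ, q.eval t = eval (u + t • w) c - eval u c := by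
          intro t
          have e : (Polynomial.aeval t).comp (aeval (R := ℂ)
              (fun k => Polynomial.C (u k) + Polynomial.X * Polynomial.C (w k)))
              = aeval (u + t • w) := by
            apply algHom_ext
            intro k
            simp
            ring
          have e2 := DFunLike.congr_fun e c
          simp only [q, Polynomial.eval_sub, Polynomial.eval_C]
          congr 1
        have hq0 : q = 0 := by
          apply Polynomial.eq_zero_of_infinite_isRoot
          refine (Set.infinite_range_of_injective (Nat.cast_injective (R := ℂ))).mono ?_
          rintro _ ⟨m, rfl⟩
          change q.eval _ = 0
          rw [hq, hn, sub_self]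
        have e := hq z
        rw [hq0, Polynomial.eval_zero] at e
        exact (sub_eq_zero.mp e.symm) }
  have hS : S = ⊤ := by
    rw [eq_top_iff, ← hv, Submodule.span_le]
    rintro _ ⟨a, rfl⟩
    intro u
    have e : (aeval (R := ℂ) (u + v a)).comp (aeval (fun k => X k - C (v a k))) = aeval u := by
      apply algHom_ext
      intro k
      simp
    have e2 := DFunLike.congr_fun e c
    rw [AlgHom.comp_apply, hc] at e2
    exact e2
  refine ⟨eval 0 c, MvPolynomial.funext fun u => ?_⟩
  have hu : u ∈ S := hS ▸ Submodule.mem_top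
  have e := hu 0
  rw [zero_add] at e
  rw [e, eval_C]

/-- The quadratic equation for b splits over ℂ with roots (1 ± s)/2, s² = 1 - 4z, and the polynomial
ring is a domain. -/
theorem exists_eq_C_of_sub_sq (b : MvPolynomial ι ℂ) (z : ℂ) (h : b - b ^ 2 = C z) :
    ∃ w : ℂ, b = C w := by
  obtain ⟨s, hs⟩ := IsAlgClosed.exists_pow_nat_eq (1 - 4 * z) two_pos
  have e : (b - C ((1 + s) / 2)) * (b - C ((1 - s) / 2)) = 0 := by
    have e1 : (C ((1 + s) / 2) : MvPolynomial ι ℂ) + C ((1 - s) / 2) = 1 := by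
      rw [← C_add, ← C_1]
      congr 1
      ring
    have e2 : (C ((1 + s) / 2) : MvPolynomial ι ℂ) * C ((1 - s) / 2) = C z := by
      rw [← C_mul]
      congr 1
      linear_combination (-1 / 4) * hs
    linear_combination -h - b * e1 + e2
  rcases mul_eq_zero.mp e with e | e
  · exact ⟨_, sub_eq_zero.mp e⟩
  · exact ⟨_, sub_eq_zero.mp e⟩

theorem eq_lamPow {n : ℕ} (ch : (Fin n → ℤ) → ℂˣ) (h : ∀ r s, ch (r + s) = ch r * ch s)
    (r : Fin n → ℤ) : (ch r : ℂ) = lamPow (fun j => ch (Pi.single j 1)) r := by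
  rw [lamPow]
  congr 1
  let φ : Multiplicative (Fin n → ℤ) →* ℂˣ :=
    MonoidHom.mk' (fun r => ch r.toAdd) fun r s => h _ _
  have e : Multiplicative.ofAdd r
      = ∏ j, (Multiplicative.ofAdd (Pi.single j 1 : Fin n → ℤ)) ^ r j := by
    rw [← ofAdd_toAdd (∏ j, _)]
    congr 1
    rw [toAdd_prod]
    funext k
    simp [Finset.sum_apply, Pi.single_apply]
  calc ch r = φ (Multiplicative.ofAdd r) := rfl
    _ = _ := by
      rw [e, map_prod]
      simp only [map_zpow]
      rfl

end Polynomials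

end FullToroidal

/-! ### Polynomial actions: the Witt algebra and the centre. -/

namespace FullToroidal

open MvPolynomial FullToroidalAlgebra

variable {c₁ c₂ : ℂ} {n : ℕ} {𝔤 : Type*} [LieRing 𝔤] [LieAlgebra ℂ 𝔤] {𝔥 : LieSubalgebra ℂ 𝔤}
  {ι : Type*}

/-- The linear polynomial attached to an element of `𝔥`. -/
def linearPoly (hb : Module.Basis ι ℂ 𝔥) : 𝔥 →ₗ[ℂ] MvPolynomial ι ℂ :=
  hb.constr ℂ fun k => (X k : MvPolynomial ι ℂ)

theorem linearPoly_basis (hb : Module.Basis ι ℂ 𝔥) (k : ι) : linearPoly hb (hb k) = X k :=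
  hb.constr_basis ℂ _ k

theorem linearPoly_ne_zero (hb : Module.Basis ι ℂ 𝔥) {h : 𝔥} (h0 : h ≠ 0) :
    linearPoly hb h ≠ 0 := by
  classical
  intro hz
  apply h0
  apply hb.ext_elem
  intro k
  have e : (lcoeff ℂ (Finsupp.single k 1)) ∘ₗ linearPoly hb = hb.coord k := by
    apply hb.ext
    intro l
    simp [linearPoly_basis, coeff_X, Finsupp.single_apply, Finsupp.single_left_inj]
  have e2 := DFunLike.congr_fun e h
  rw [LinearMap.comp_apply, hz, map_zero] at e2
  rw [map_zero]
  exact e2.symm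

/-- An action of `ℒ` on polynomials in a basis of `𝔥̃ₙ` for which this basis acts by
multiplication. -/
structure IsPolynomialAction (hb : Module.Basis ι ℂ 𝔥)
    (ρ : FullToroidalAlgebra c₁ c₂ n 𝔤 →ₗ[ℂ]
      Module.End ℂ (MvPolynomial (Fin n) (MvPolynomial ι ℂ))) : Prop where
  lie : ∀ X Y f, ρ ⁅X, Y⁆ f = ρ X (ρ Y f) - ρ Y (ρ X f)
  euler : ∀ i f, ρ (wittElt c₁ c₂ 𝔤 0 i) f = X i * f
  cartan : ∀ (h : 𝔥) f, ρ (loopElt c₁ c₂ 0 (h : 𝔤)) f = C (linearPoly hb h) * f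

namespace IsPolynomialAction

variable {hb : Module.Basis ι ℂ 𝔥}
  {ρ : FullToroidalAlgebra c₁ c₂ n 𝔤 →ₗ[ℂ]
    Module.End ℂ (MvPolynomial (Fin n) (MvPolynomial ι ℂ))}

/-- The element `t^r dᵢ` commutes with `𝔥` and has weight r for the `dⱼ`; the cocycle vanishes
against the degree derivations. -/
theorem wittElt_mul (H : IsPolynomialAction hb ρ) (r : Fin n → ℤ) (i : Fin n)
    (f g : MvPolynomial (Fin n) (MvPolynomial ι ℂ)) :
    ρ (wittElt c₁ c₂ 𝔤 r i) (f * g) = shiftBy r f * ρ (wittElt c₁ c₂ 𝔤 r i) g := by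
  refine eq_algHom_mul ((shiftBy r).restrictScalars ℂ) _ (fun k f => ?_) (fun j f => ?_) f g
  · have e := H.lie (wittElt c₁ c₂ 𝔤 r i) (loopElt c₁ c₂ 0 (hb k : 𝔤)) f
    rw [wittElt_lie_loopElt, H.cartan, H.cartan,
        linearPoly_basis] at e
    simp only [Pi.zero_apply, Int.cast_zero, zero_smul, map_zero, LinearMap.zero_apply] at e
    rw [AlgHom.restrictScalars_apply, shiftBy_C]
    exact (sub_eq_zero.mp e.symm)
  · have e := H.lie (wittElt c₁ c₂ 𝔤 0 j) (wittElt c₁ c₂ 𝔤 r i) f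
    rw [wittElt_lie_wittElt, phi_mono_smul, H.euler, H.euler] at e
    simp only [Pi.zero_apply, Int.cast_zero, zero_smul, mono_zero, dClass_one, smul_zero, map_zero,
      add_zero, sub_zero, zero_add, map_smul, LinearMap.smul_apply] at e
    rw [AlgHom.restrictScalars_apply, shiftBy_X, Algebra.smul_def, map_intCast] at *
    linear_combination e

theorem loopElt_X_mul (H : IsPolynomialAction hb ρ) (r : Fin n → ℤ) (x : 𝔤) (j : Fin n)
    (f : MvPolynomial (Fin n) (MvPolynomial ι ℂ)) :
    ρ (loopElt c₁ c₂ r x) (X j * f) = (X j - (r j : MvPolynomial (Fin n) (MvPolynomial ι ℂ)))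
      * ρ (loopElt c₁ c₂ r x) f := by
  have e := H.lie (wittElt c₁ c₂ 𝔤 0 j) (loopElt c₁ c₂ r x) f
  rw [wittElt_lie_loopElt, H.euler, H.euler, zero_add, map_smul, LinearMap.smul_apply,
    Algebra.smul_def, map_intCast] at e
  linear_combination e

/-- For arbitrary x only the variables `dⱼ` can be moved across, since x need not commute with `𝔥`;
hence the restriction to polynomials with scalar coefficients. -/
theorem loopElt_map_mul (H : IsPolynomialAction hb ρ) (r : Fin n → ℤ) (x : 𝔤)
    (q : MvPolynomial (Fin n) ℂ) (f : MvPolynomial (Fin n) (MvPolynomial ι ℂ)) :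
    ρ (loopElt c₁ c₂ r x) (map C q * f) = shiftBy r (map C q) * ρ (loopElt c₁ c₂ r x) f := by
  induction q using MvPolynomial.induction_on generalizing f with
  | C c =>
    have e : (C (C c) : MvPolynomial (Fin n) (MvPolynomial ι ℂ)) = algebraMap ℂ _ c := rfl
    rw [map_C, e, shiftBy_algebraMap, ← Algebra.smul_def, ← Algebra.smul_def, map_smul]
  | add p q hp hq => rw [map_add, add_mul, map_add, map_add, add_mul, hp, hq]
  | mul_X p k hp =>
    rw [map_mul (map C), mul_assoc, hp, map_X, H.loopElt_X_mul, map_mul (shiftBy r), shiftBy_X,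
      mul_assoc]

theorem loopElt_cartan_mul [IsLieAbelian 𝔥] (H : IsPolynomialAction hb ρ) (r : Fin n → ℤ) (h : 𝔥)
    (f g : MvPolynomial (Fin n) (MvPolynomial ι ℂ)) :
    ρ (loopElt c₁ c₂ r (h : 𝔤)) (f * g) = shiftBy r f * ρ (loopElt c₁ c₂ r (h : 𝔤)) g := by
  refine eq_algHom_mul ((shiftBy r).restrictScalars ℂ) _ (fun k f => ?_)
    (fun j f => ?_) f g
  · have e := H.lie (loopElt c₁ c₂ r (h : 𝔤)) (loopElt c₁ c₂ 0 (hb k : 𝔤)) f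
    have hz : ⁅(h : 𝔤), (hb k : 𝔤)⁆ = 0 := by
      rw [← LieSubalgebra.coe_bracket, trivial_lie_zero]
      rfl
    rw [loopElt_lie_loopElt, hz, loopElt_zero, mono_zero, dClass_swap, dClass_one, neg_zero,
      smul_zero, map_zero, add_zero, map_zero, LinearMap.zero_apply, H.cartan, H.cartan,
        linearPoly_basis] at e
    rw [AlgHom.restrictScalars_apply, shiftBy_C]
    exact (sub_eq_zero.mp e.symm)
  · rw [H.loopElt_X_mul, AlgHom.restrictScalars_apply, shiftBy_X]

/-- The central class has degree zero, so it commutes with the `dⱼ` as well as with `𝔥`. -/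
theorem cenElt_mul (H : IsPolynomialAction hb ρ) (r : Fin n → ℤ)
    (f g : MvPolynomial (Fin n) (MvPolynomial ι ℂ)) :
    ρ (cenElt c₁ c₂ 𝔤 (dClass (mono r) (mono (-r)))) (f * g)
      = f * ρ (cenElt c₁ c₂ 𝔤 (dClass (mono r) (mono (-r)))) g := by
  refine eq_algHom_mul (AlgHom.id ℂ _) _ (fun k f => ?_) (fun j f => ?_) f g
  · have e := H.lie (loopElt c₁ c₂ 0 (hb k : 𝔤)) (cenElt c₁ c₂ 𝔤 (dClass (mono r) (mono (-r)))) f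
    rw [loopElt_lie_cenElt, map_zero, LinearMap.zero_apply, H.cartan, H.cartan,
        linearPoly_basis] at e
    exact (sub_eq_zero.mp e.symm).symm
  · have e := H.lie (wittElt c₁ c₂ 𝔤 0 j) (cenElt c₁ c₂ 𝔤 (dClass (mono r) (mono (-r)))) f
    have hz : lieKA (mono (0 : Fin n → ℤ) • FullToroidal.euler j) (dClass (mono r) (mono (-r)))
        = 0 := by
      rw [mono_zero, one_smul, lieKA_dClass, euler_mono, euler_mono]
      simp
    rw [wittElt_lie_cenElt, hz, map_zero, map_zero, LinearMap.zero_apply, H.euler, H.euler] at e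
    exact (sub_eq_zero.mp e.symm).symm

/-- The Lie derivative of the class of `t^(-r) d(t^r)` along `t^r dᵢ` is a combination of the
classes of `t^(-r) d(t^(2r))` and `d(t^r)`, and both forms are multiples of the exact form `d(t^r)`.
-/
theorem wittElt_cenElt_comm (H : IsPolynomialAction hb ρ) (r : Fin n → ℤ) (i : Fin n)
    (f : MvPolynomial (Fin n) (MvPolynomial ι ℂ)) :
    ρ (wittElt c₁ c₂ 𝔤 r i) (ρ (cenElt c₁ c₂ 𝔤 (dClass (mono r) (mono (-r)))) f)
      = ρ (cenElt c₁ c₂ 𝔤 (dClass (mono r) (mono (-r)))) (ρ (wittElt c₁ c₂ 𝔤 r i) f) := by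
  have hz : lieKA (mono r • FullToroidal.euler i) (dClass (mono r) (mono (-r))) = 0 := by
    have e1 := dClass_mul (mono r) (mono r) (mono (-r))
    have e2 := dClass_swap (mono r) (1 : Laurent n)
    rw [mono_neg_mul, mono_mul_neg, e2, dClass_one, neg_zero, add_zero] at e1
    rw [lieKA_dClass]
    simp only [Derivation.smul_apply, euler_mono, smul_eq_mul, mul_smul_comm, mono_mul_neg,
      map_smul, LinearMap.smul_apply, e1, e2, dClass_one, neg_zero, smul_zero, add_zero]
  have e := H.lie (wittElt c₁ c₂ 𝔤 r i) (cenElt c₁ c₂ 𝔤 (dClass (mono r) (mono (-r)))) f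
  rw [wittElt_lie_cenElt, hz, map_zero, map_zero, LinearMap.zero_apply] at e
  exact sub_eq_zero.mp e.symm

theorem wittElt_loopElt_relation [IsLieAbelian 𝔥] (H : IsPolynomialAction hb ρ) (h : 𝔥)
    (r s : Fin n → ℤ) (i : Fin n) :
    shiftBy r (ρ (loopElt c₁ c₂ s (h : 𝔤)) 1) * ρ (wittElt c₁ c₂ 𝔤 r i) 1
        - shiftBy s (ρ (wittElt c₁ c₂ 𝔤 r i) 1) * ρ (loopElt c₁ c₂ s (h : 𝔤)) 1
      = (s i : MvPolynomial (Fin n) (MvPolynomial ι ℂ)) * ρ (loopElt c₁ c₂ (r + s) (h : 𝔤)) 1 := by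
  have e := H.lie (wittElt c₁ c₂ 𝔤 r i) (loopElt c₁ c₂ s (h : 𝔤)) 1
  rw [wittElt_lie_loopElt, map_smul, LinearMap.smul_apply, Algebra.smul_def, map_intCast] at e
  rw [e, ← H.wittElt_mul, mul_one, ← H.loopElt_cartan_mul, mul_one]

/-- Before the centre is known to act by zero, the cocycle contributes an unknown κ. It is a
multiple of the value at 1 of a central element commuting with `t^r dᵢ`, which is the invariance
needed for the degree count. -/
theorem wittElt_wittElt_relation (H : IsPolynomialAction hb ρ) (r : Fin n → ℤ) (i : Fin n) :
    ∃ κ : MvPolynomial (Fin n) (MvPolynomial ι ℂ),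
      shiftBy r κ * ρ (wittElt c₁ c₂ 𝔤 r i) 1 = κ * ρ (wittElt c₁ c₂ 𝔤 r i) 1 ∧
      shiftBy r (ρ (wittElt c₁ c₂ 𝔤 (-r) i) 1) * ρ (wittElt c₁ c₂ 𝔤 r i) 1
          - shiftBy (-r) (ρ (wittElt c₁ c₂ 𝔤 r i) 1) * ρ (wittElt c₁ c₂ 𝔤 (-r) i) 1
        = -(2 * (r i : MvPolynomial (Fin n) (MvPolynomial ι ℂ)) * X i) + κ := by
  generalize hD : ρ (cenElt c₁ c₂ 𝔤 (dClass (mono r) (mono (-r)))) 1 = d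
  have hd : shiftBy r d * ρ (wittElt c₁ c₂ 𝔤 r i) 1 = d * ρ (wittElt c₁ c₂ 𝔤 r i) 1 := by
    have e := H.wittElt_cenElt_comm r i 1
    have e1 := H.wittElt_mul r i d 1
    have e2 := H.cenElt_mul r (ρ (wittElt c₁ c₂ 𝔤 r i) 1) 1
    rw [mul_one] at e1 e2
    rw [hD] at e e2
    rw [← e1, e, e2, mul_comm]
  refine ⟨algebraMap ℂ _ (c₂ * (r i * (-r) i) - c₁ * ((-r) i * r i) : ℂ) * d, ?_, ?_⟩
  · rw [map_mul, shiftBy_algebraMap, mul_assoc, mul_assoc, hd]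
  · have e := H.lie (wittElt c₁ c₂ 𝔤 r i) (wittElt c₁ c₂ 𝔤 (-r) i) 1
    rw [wittElt_lie_wittElt, phi_mono_smul, map_add, map_sub, map_smul, map_smul, map_smul,
      map_smul, add_neg_cancel, LinearMap.add_apply, LinearMap.sub_apply, LinearMap.smul_apply,
      LinearMap.smul_apply, LinearMap.smul_apply, H.euler, hD] at e
    have e1 := H.wittElt_mul r i (ρ (wittElt c₁ c₂ 𝔤 (-r) i) 1) 1
    have e2 := H.wittElt_mul (-r) i (ρ (wittElt c₁ c₂ 𝔤 r i) 1) 1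
    rw [mul_one] at e1 e2
    rw [← e1, ← e2, ← e]
    simp only [Algebra.smul_def, map_intCast, Pi.neg_apply, Int.cast_neg, map_neg]
    ring

/-- The normal form of the action of the Witt algebra. -/
theorem exists_witt_form [IsLieAbelian 𝔥] (H : IsPolynomialAction hb ρ) (h : 𝔥) (h0 : h ≠ 0) :
    ∃ (Λ : Fin n → ℂˣ) (β : (Fin n → ℤ) → Fin n → MvPolynomial ι ℂ),
      (∀ r, ρ (loopElt c₁ c₂ r (h : 𝔤)) 1
        = algebraMap ℂ _ (lamPow Λ r) * C (linearPoly hb h)) ∧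
      ∀ r i, ρ (wittElt c₁ c₂ 𝔤 r i) 1 = algebraMap ℂ _ (lamPow Λ r) * (X i - C (β r i)) := by
  obtain ⟨ch, hmul, hp, β, hβ⟩ := exists_normal_form (linearPoly hb h)
    (fun r => ρ (loopElt c₁ c₂ r (h : 𝔤)) 1) (fun r i => ρ (wittElt c₁ c₂ 𝔤 r i) 1)
    (fun u hu => by
      obtain ⟨c, -, hc⟩ := isUnit_iff_eq_C_of_isReduced.mp hu
      exact ⟨c, hc.symm⟩)
    (linearPoly_ne_zero hb h0) (by rw [H.cartan, mul_one]) (H.wittElt_loopElt_relation h)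
    (fun r i _ => H.wittElt_wittElt_relation r i)
  have hl := eq_lamPow ch hmul
  refine ⟨fun j => ch (Pi.single j 1), β, fun r => ?_, fun r i => ?_⟩
  · rw [← hl]
    exact hp r
  · rw [← hl]
    exact hβ r i

theorem lamPow_ne_zero (Λ : Fin n → ℂˣ) (r : Fin n → ℤ) : lamPow Λ r ≠ 0 := Units.ne_zero _

theorem algebraMap_lamPow_ne_zero (Λ : Fin n → ℂˣ) (r : Fin n → ℤ) :
    algebraMap ℂ (MvPolynomial (Fin n) (MvPolynomial ι ℂ)) (lamPow Λ r) ≠ 0 := by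
  rw [Ne, map_eq_zero_iff _ (algebraMap ℂ (MvPolynomial (Fin n) (MvPolynomial ι ℂ))).injective]
  exact lamPow_ne_zero Λ r

/-- `𝒦_A` acts by zero. -/
theorem cenElt_eq_zero [IsLieAbelian 𝔥] (H : IsPolynomialAction hb ρ) (h : 𝔥)
    (hk : killingForm ℂ 𝔤 h h ≠ 0) (Λ : Fin n → ℂˣ)
    (hΛ : ∀ r, ρ (loopElt c₁ c₂ r (h : 𝔤)) 1
        = algebraMap ℂ _ (lamPow Λ r) * C (linearPoly hb h)) (k : KA n)
    (f : MvPolynomial (Fin n) (MvPolynomial ι ℂ)) : ρ (cenElt c₁ c₂ 𝔤 k) f = 0 := by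
  have hl : ∀ r f, ρ (loopElt c₁ c₂ r (h : 𝔤)) f
      = shiftBy r f * (algebraMap ℂ _ (lamPow Λ r) * C (linearPoly hb h)) := fun r f => by
    rw [← hΛ, ← H.loopElt_cartan_mul, mul_one]
  induction k using KA_induction with
  | h0 => simp
  | ha k l hk hl => rw [map_add, map_add, LinearMap.add_apply, hk, hl, add_zero]
  | hc u w =>
    induction u using laurent_induction with
    | ha u u' hu hu' =>
      rw [map_add, LinearMap.add_apply, map_add, map_add, LinearMap.add_apply, hu, hu', add_zero]
    | hs c u hu => 
      rw [map_smul, LinearMap.smul_apply, map_smul, map_smul, LinearMap.smul_apply, hu, smul_zero]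
    | hm r =>
      induction w using laurent_induction with
      | ha u u' hu hu' =>
        rw [map_add, map_add, map_add, LinearMap.add_apply, hu, hu', add_zero]
      | hs c u hu => rw [map_smul, map_smul, map_smul, LinearMap.smul_apply, hu, smul_zero]
      | hm s =>
        -- The bracket of `h(r)` with `h(s)` is (h, h) times the central class, whereas the
        -- operators commute: both are translations followed by multiplication by a scalar multiple
        -- of the translation-invariant h.
        have e := H.lie (loopElt c₁ c₂ r (h : 𝔤)) (loopElt c₁ c₂ s (h : 𝔤)) f
        rw [loopElt_lie_loopElt, lie_self, loopElt_zero, zero_add, map_smul, map_smul,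
          LinearMap.smul_apply] at e
        have e2 : ρ (loopElt c₁ c₂ r (h : 𝔤)) (ρ (loopElt c₁ c₂ s (h : 𝔤)) f)
            - ρ (loopElt c₁ c₂ s (h : 𝔤)) (ρ (loopElt c₁ c₂ r (h : 𝔤)) f) = 0 := by
          simp only [hl, map_mul, shiftBy_algebraMap, shiftBy_C, shiftBy_shiftBy]
          rw [add_comm s r]
          ring
        rw [e2] at e
        exact (smul_eq_zero.mp e).resolve_left hk

/-- The constant terms in the normal form of the Witt algebra are linear. -/
theorem exists_linear_constant (H : IsPolynomialAction hb ρ) (Λ : Fin n → ℂˣ)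
    (β : (Fin n → ℤ) → Fin n → MvPolynomial ι ℂ)
    (hβ : ∀ r i, ρ (wittElt c₁ c₂ 𝔤 r i) 1 = algebraMap ℂ _ (lamPow Λ r) * (X i - C (β r i)))
    (hcen : ∀ k f, ρ (cenElt c₁ c₂ 𝔤 k) f = 0) :
    ∃ b : MvPolynomial ι ℂ, ∀ r i, β r i = r i * b := by
  have hw : ∀ r i f, ρ (wittElt c₁ c₂ 𝔤 r i) f
      = shiftBy r f * (algebraMap ℂ _ (lamPow Λ r) * (X i - C (β r i))) := fun r i f => by
    rw [← hβ, ← H.wittElt_mul, mul_one]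
  apply exists_linear
  · intro i
    have e := hβ 0 i
    rw [H.euler, lamPow_zero, map_one, one_mul, mul_one] at e
    have e2 : (C (β 0 i) : MvPolynomial (Fin n) (MvPolynomial ι ℂ)) = C 0 := by
      rw [C_0]
      linear_combination e
    exact C_injective _ _ e2
  · intro r s i j
    -- With the cocycle term gone, the terms in the variables cancel and the constant terms give the
    -- relation required by `exists_linear`, up to the factor `Λ^(r+s)`.
    have e := H.lie (wittElt c₁ c₂ 𝔤 r i) (wittElt c₁ c₂ 𝔤 s j) 1
    rw [wittElt_lie_wittElt, map_add, LinearMap.add_apply, hcen, add_zero, map_sub,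
      LinearMap.sub_apply, map_smul, map_smul, LinearMap.smul_apply, LinearMap.smul_apply] at e
    simp only [hw, map_mul, map_one, one_mul, shiftBy_algebraMap, map_sub, shiftBy_X, shiftBy_C,
      lamPow_add, Algebra.smul_def, map_intCast] at e
    apply C_injective (Fin n) (MvPolynomial ι ℂ)
    apply mul_left_cancel₀ (mul_ne_zero (algebraMap_lamPow_ne_zero (ι := ι) Λ r)
      (algebraMap_lamPow_ne_zero (ι := ι) Λ s))
    simp only [map_mul, map_sub, map_intCast]
    linear_combination -e

end IsPolynomialAction

end FullToroidal

/-! ### Polynomial actions: the scalar a and the action of the loop algebra. -/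

namespace FullToroidal

open MvPolynomial FullToroidalAlgebra

variable {c₁ c₂ : ℂ} {n : ℕ} {𝔤 : Type*} [LieRing 𝔤] [LieAlgebra ℂ 𝔤] {𝔥 : LieSubalgebra ℂ 𝔤}
  {ι : Type*}

namespace IsPolynomialAction

variable {hb : Module.Basis ι ℂ 𝔥}
  {ρ : FullToroidalAlgebra c₁ c₂ n 𝔤 →ₗ[ℂ]
    Module.End ℂ (MvPolynomial (Fin n) (MvPolynomial ι ℂ))}

theorem loopElt_zero_lie (H : IsPolynomialAction hb ρ) (x y : 𝔤)
    (f : MvPolynomial (Fin n) (MvPolynomial ι ℂ)) :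
    ρ (loopElt c₁ c₂ 0 ⁅x, y⁆) f = ρ (loopElt c₁ c₂ 0 x) (ρ (loopElt c₁ c₂ 0 y) f)
      - ρ (loopElt c₁ c₂ 0 y) (ρ (loopElt c₁ c₂ 0 x) f) := by
  rw [← H.lie, loopElt_lie_loopElt, mono_zero, dClass_one, smul_zero, map_zero, add_zero, add_zero]

theorem wittElt_loopElt_comm (H : IsPolynomialAction hb ρ) (r : Fin n → ℤ) (i : Fin n) (x : 𝔤)
    (f : MvPolynomial (Fin n) (MvPolynomial ι ℂ)) :
    ρ (wittElt c₁ c₂ 𝔤 r i) (ρ (loopElt c₁ c₂ 0 x) f)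
      = ρ (loopElt c₁ c₂ 0 x) (ρ (wittElt c₁ c₂ 𝔤 r i) f) := by
  have e := H.lie (wittElt c₁ c₂ 𝔤 r i) (loopElt c₁ c₂ 0 x) f
  rw [wittElt_lie_loopElt, Pi.zero_apply, Int.cast_zero, zero_smul, map_zero,
    LinearMap.zero_apply] at e
  exact sub_eq_zero.mp e.symm

theorem loopElt_zero_X_mul (H : IsPolynomialAction hb ρ) (x : 𝔤) (j : Fin n)
    (f : MvPolynomial (Fin n) (MvPolynomial ι ℂ)) :
    ρ (loopElt c₁ c₂ 0 x) (X j * f) = X j * ρ (loopElt c₁ c₂ 0 x) f := by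
  rw [H.loopElt_X_mul, Pi.zero_apply, Int.cast_zero, sub_zero]

/-- For r the i-th unit vector, `t^r dᵢ` after `t^(-r) dᵢ` is multiplication by `(dᵢ - 1 + b)(dᵢ -
b) = dᵢ² - dᵢ + b - b²`. So multiplication by `b - b²` is built from operators that commute with
`𝔤`. -/
theorem loopElt_C_mul_of_witt_form (H : IsPolynomialAction hb ρ) (Λ : Fin n → ℂˣ)
    (b : MvPolynomial ι ℂ) (i : Fin n)
    (hw : ∀ r f, ρ (wittElt c₁ c₂ 𝔤 r i) f
      = shiftBy r f * (algebraMap ℂ _ (lamPow Λ r) * (X i - C (r i * b)))) (x : 𝔤)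
    (f : MvPolynomial (Fin n) (MvPolynomial ι ℂ)) :
    ρ (loopElt c₁ c₂ 0 x) (C (b - b ^ 2) * f) = C (b - b ^ 2) * ρ (loopElt c₁ c₂ 0 x) f := by
  set r : Fin n → ℤ := Pi.single i 1 with hr
  have hl : algebraMap ℂ (MvPolynomial (Fin n) (MvPolynomial ι ℂ)) (lamPow Λ r)
      * algebraMap ℂ (MvPolynomial (Fin n) (MvPolynomial ι ℂ)) (lamPow Λ (-r)) = 1 := by
    rw [← map_mul, ← lamPow_add, add_neg_cancel, lamPow_zero, map_one]
  have key : ∀ f, C (b - b ^ 2) * f = ρ (wittElt c₁ c₂ 𝔤 r i) (ρ (wittElt c₁ c₂ 𝔤 (-r) i) f)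
      - X i * (X i * f) + X i * f := by
    intro f
    rw [hw (-r), hw r, map_mul, shiftBy_shiftBy, add_neg_cancel, shiftBy_zero_apply, map_mul,
      shiftBy_algebraMap, map_sub (shiftBy r), shiftBy_X, shiftBy_C]
    simp only [hr, Pi.neg_apply, Pi.single_eq_same, Int.cast_neg, Int.cast_one, one_mul, neg_mul,
      map_neg, map_sub, map_pow]
    rw [← hr]
    linear_combination (-(f * (X i - 1 + C b) * (X i - C b))) * hl
  rw [key, key, map_add, map_sub, H.loopElt_zero_X_mul, H.loopElt_zero_X_mul,
    ← H.wittElt_loopElt_comm, ← H.wittElt_loopElt_comm]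

section Simple

variable [LieAlgebra.IsSimple ℂ 𝔤]

/-- The elements acting by zero form an ideal of the simple algebra `𝔤`, and h, which acts by
multiplication by a nonzero polynomial, is not in it. -/
theorem loopElt_zero_injective (H : IsPolynomialAction hb ρ) {h : 𝔥} (h0 : h ≠ 0) {x : 𝔤}
    (hx : ρ (loopElt c₁ c₂ 0 x) = 0) : x = 0 := by
  let I : LieIdeal ℂ 𝔤 :=
    { carrier := {x | ρ (loopElt c₁ c₂ 0 x) = 0}
      zero_mem' := by
        change ρ (loopElt c₁ c₂ 0 0) = 0
        rw [loopElt_zero, map_zero]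
      add_mem' := fun {x y} hx hy => by
        change ρ (loopElt c₁ c₂ 0 (x + y)) = 0
        change ρ (loopElt c₁ c₂ 0 x) = 0 at hx
        change ρ (loopElt c₁ c₂ 0 y) = 0 at hy
        rw [loopElt_add, map_add, hx, hy, add_zero]
      smul_mem' := fun c x hx => by
        change ρ (loopElt c₁ c₂ 0 (c • x)) = 0
        change ρ (loopElt c₁ c₂ 0 x) = 0 at hx
        rw [loopElt_smul, map_smul, hx, smul_zero]
      lie_mem := fun {x y} hy => by
        change ρ (loopElt c₁ c₂ 0 y) = 0 at hy
        change ρ (loopElt c₁ c₂ 0 ⁅x, y⁆) = 0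
        refine LinearMap.ext fun f => ?_
        rw [H.loopElt_zero_lie, hy]
        simp }
  rcases LieAlgebra.IsSimple.eq_bot_or_eq_top (R := ℂ) I with hI | hI
  · have : x ∈ I := hx
    rw [hI] at this
    simpa using this
  · have : (h : 𝔤) ∈ I := by rw [hI]; trivial
    have e : ρ (loopElt c₁ c₂ 0 (h : 𝔤)) = 0 := this
    have e2 := H.cartan h 1
    rw [e, LinearMap.zero_apply, mul_one] at e2
    have e3 : linearPoly hb h = 0 := C_injective (Fin n) _ (by rw [← e2, C_0])
    exact absurd e3 (linearPoly_ne_zero hb h0)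

variable [FiniteDimensional ℂ 𝔤] [𝔥.IsCartanSubalgebra]

/-- An element of `S(𝔥)` whose multiplication operator commutes with `𝔤` is a constant. -/
theorem exists_eq_C_of_comm (H : IsPolynomialAction hb ρ) {h : 𝔥} (h0 : h ≠ 0)
    (c : MvPolynomial ι ℂ)
    (hc : ∀ x f, ρ (loopElt c₁ c₂ 0 x) (C c * f) = C c * ρ (loopElt c₁ c₂ 0 x) f) :
    ∃ z : ℂ, c = C z := by
  refine eq_C_of_translations
    (fun (α : LieModule.Weight ℂ 𝔥 𝔤) (k : ι) => α (hb k)) ?_ c fun α => ?_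
  -- Coordinates in the basis `hb` carry the spanning of the dual of `𝔥` by the weights to spanning
  -- of the coordinate space.
  · let L : Module.Dual ℂ 𝔥 →ₗ[ℂ] (ι → ℂ) := LinearMap.pi fun k => LinearMap.applyₗ (hb k)
    have hL : Function.Surjective L := fun v =>
      ⟨hb.constr ℂ v, funext fun k => hb.constr_basis ℂ v k⟩
    have hr : Set.range (fun (α : LieModule.Weight ℂ 𝔥 𝔤) (k : ι) => α (hb k))
        = L '' Set.range (LieModule.Weight.toLinear ℂ 𝔥 𝔤) := by
      rw [← Set.range_comp]
      rfl
    rw [hr, Submodule.span_image, LieAlgebra.IsKilling.span_weight_eq_top, Submodule.map_top,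
      LinearMap.range_eq_top.mpr hL]
  · obtain ⟨x, hx, hx0⟩ := α.exists_ne_zero
    let φ : MvPolynomial (Fin n) (MvPolynomial ι ℂ) →ₐ[ℂ] MvPolynomial (Fin n) (MvPolynomial ι ℂ) :=
      mapAlgHom (aeval fun k => X k - C (α (hb k)))
    have hφC : ∀ p, φ (C p) = C (aeval (fun k => X k - C (α (hb k))) p) := fun p => map_C _ p
    -- A vector x of weight α is semilinear for the translation of `S(𝔥)` by α. As x commutes with c
    -- and `x·1 ≠ 0`, the translation by α fixes c.
    have hmul := eq_algHom_mul φ (ρ (loopElt c₁ c₂ 0 x)) (fun k f => by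
        have e := H.loopElt_zero_lie (hb k : 𝔤) x f
        have e1 : ⁅(hb k : 𝔤), x⁆ = α (hb k) • x :=
          LieAlgebra.IsKilling.lie_eq_smul_of_mem_rootSpace hx (hb k)
        rw [e1, loopElt_smul, map_smul, LinearMap.smul_apply, H.cartan, H.cartan,
          linearPoly_basis, Algebra.smul_def] at e
        have e2 : (algebraMap ℂ (MvPolynomial (Fin n) (MvPolynomial ι ℂ))) (α (hb k))
          = C (C (α (hb k))) := rfl
        rw [e2] at e
        rw [hφC, aeval_X, map_sub]
        linear_combination e)
      (fun i f => by
        rw [H.loopElt_zero_X_mul]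
        congr 1
        exact (map_X _ i).symm)
    have hne : ρ (loopElt c₁ c₂ 0 x) 1 ≠ 0 := by
      intro hz
      apply hx0
      apply H.loopElt_zero_injective h0
      refine LinearMap.ext fun f => ?_
      rw [← mul_one f, hmul, hz, mul_zero, LinearMap.zero_apply]
    apply C_injective (Fin n) (MvPolynomial ι ℂ)
    apply mul_right_cancel₀ hne
    rw [← hφC, ← hmul, hc]

end Simple

/-- As w is a scalar, `x(s)` can be moved past the polynomial by which `t^r dᵢ` acts. For s = 0,
commutation with all `t^r dᵢ` makes `x·y` invariant under translations, so that it lies in `S(𝔥)`;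
for s = r, the bracket of `t^(-r) dᵢ` with `x(r)` recovers `x(r)`. -/
theorem loopElt_eq_of_witt_form (H : IsPolynomialAction hb ρ) (Λ : Fin n → ℂˣ) (w : ℂ)
    (hw : ∀ r i f, ρ (wittElt c₁ c₂ 𝔤 r i) f
      = shiftBy r f * (algebraMap ℂ _ (lamPow Λ r) * (X i - C (r i * C w)))) (x : 𝔤)
    (y : MvPolynomial ι ℂ) (r : Fin n → ℤ) :
    ρ (loopElt c₁ c₂ r x) (C y)
      = algebraMap ℂ _ (lamPow Λ r) * C (constantCoeff (ρ (loopElt c₁ c₂ 0 x) (C y))) := by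
  have hmul : ∀ s r i, ρ (loopElt c₁ c₂ s x) (ρ (wittElt c₁ c₂ 𝔤 r i) (C y))
      = algebraMap ℂ _ (lamPow Λ r)
        * ((X i - (s i : MvPolynomial (Fin n) (MvPolynomial ι ℂ)) - C (r i * C w))
          * ρ (loopElt c₁ c₂ s x) (C y)) := by
    intro s r i
    have e : ρ (wittElt c₁ c₂ 𝔤 r i) (C y)
        = lamPow Λ r • (X i * C y - ((r i : ℂ) * w) • C y) := by
      rw [hw, shiftBy_C, Algebra.smul_def, Algebra.smul_def]
      have e2 : (algebraMap ℂ (MvPolynomial (Fin n) (MvPolynomial ι ℂ))) ((r i : ℂ) * w)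
          = C ((r i : MvPolynomial ι ℂ) * C w) := by
        rw [map_mul, map_mul, map_intCast, map_intCast]
        rfl
      rw [e2]
      ring
    rw [e, map_smul, map_sub, map_smul, H.loopElt_X_mul, Algebra.smul_def, Algebra.smul_def]
    have e2 : (algebraMap ℂ (MvPolynomial (Fin n) (MvPolynomial ι ℂ))) ((r i : ℂ) * w)
        = C ((r i : MvPolynomial ι ℂ) * C w) := by
      rw [map_mul, map_mul, map_intCast, map_intCast]
      rfl
    rw [e2]
    ring
  have hconst : ρ (loopElt c₁ c₂ 0 x) (C y)
      = C (constantCoeff (ρ (loopElt c₁ c₂ 0 x) (C y))) := by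
    refine eq_C_of_shiftBy_eq fun r => ?_
    rcases isEmpty_or_nonempty (Fin n) with hn | ⟨⟨i⟩⟩
    · rw [Subsingleton.elim r 0, shiftBy_zero_apply]
    · have e := H.wittElt_loopElt_comm r i x (C y)
      rw [hw, hmul] at e
      have hne : (X i - C (r i * C w) : MvPolynomial (Fin n) (MvPolynomial ι ℂ)) ≠ 0 := by
        intro hz
        have := congrArg (coeff (Finsupp.single i 1)) hz
        rw [coeff_sub, coeff_C, if_neg (Finsupp.single_ne_zero.mpr one_ne_zero).symm, sub_zero,
          coeff_zero] at this
        simp at this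
      apply mul_right_cancel₀ (mul_ne_zero (algebraMap_lamPow_ne_zero (ι := ι) Λ r) hne)
      rw [e, Pi.zero_apply, Int.cast_zero, sub_zero]
      ring
  by_cases hr : r = 0
  · rw [hr, lamPow_zero, map_one, one_mul, ← hconst]
  obtain ⟨i, hi⟩ : ∃ i, r i ≠ 0 := by
    by_contra hcon
    push Not at hcon
    exact hr (funext hcon)
  have hl : algebraMap ℂ (MvPolynomial (Fin n) (MvPolynomial ι ℂ)) (lamPow Λ (-r))
      * algebraMap ℂ (MvPolynomial (Fin n) (MvPolynomial ι ℂ)) (lamPow Λ r) = 1 := by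
    rw [← map_mul, ← lamPow_add, neg_add_cancel, lamPow_zero, map_one]
  have e := H.lie (wittElt c₁ c₂ 𝔤 (-r) i) (loopElt c₁ c₂ r x) (C y)
  rw [wittElt_lie_loopElt, neg_add_cancel, map_smul, LinearMap.smul_apply, Algebra.smul_def,
    map_intCast, hmul, hw, hconst] at e
  -- The factor `Λ^(-r)` normalises the unknown, so that the relation holds with `x(0)·y` on the
  -- right.
  have e2 := eq_C_of_shift_relation (C w) (constantCoeff (ρ (loopElt c₁ c₂ 0 x) (C y))) r i hi
    (algebraMap ℂ _ (lamPow Λ (-r)) * ρ (loopElt c₁ c₂ r x) (C y)) (by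
      rw [e, map_mul, shiftBy_algebraMap]
      simp only [Pi.neg_apply, Int.cast_neg, neg_mul, map_neg, map_mul, map_intCast]
      ring)
  rw [← e2]
  linear_combination (-ρ (loopElt c₁ c₂ r x) (C y)) * hl

end IsPolynomialAction

end FullToroidal

/-! ### The normal form, and free modules of rank one as polynomial rings. -/

namespace FullToroidal

open MvPolynomial FullToroidalAlgebra

variable {c₁ c₂ : ℂ} {n : ℕ} {𝔤 : Type*} [LieRing 𝔤] [LieAlgebra ℂ 𝔤] {𝔥 : LieSubalgebra ℂ 𝔤}
  {ι : Type*}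

/-- If all squares vanished, polarisation and nondegeneracy of the form on `𝔥` would give `𝔥 = 0`;
being self-normalising, `𝔥` would then be all of `𝔤`. -/
theorem exists_killingForm_ne_zero [FiniteDimensional ℂ 𝔤] [LieAlgebra.IsSimple ℂ 𝔤]
    (𝔥 : LieSubalgebra ℂ 𝔤) [𝔥.IsCartanSubalgebra] :
    ∃ h : 𝔥, h ≠ 0 ∧ killingForm ℂ 𝔤 (h : 𝔤) (h : 𝔤) ≠ 0 := by
  by_contra hcon
  push Not at hcon
  have hz : ∀ h : 𝔥, LieModule.traceForm ℂ 𝔥 𝔤 h h = 0 := by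
    intro h
    by_cases h0 : h = 0
    · simp [h0]
    · exact hcon h h0
  have hz2 : ∀ h k : 𝔥, LieModule.traceForm ℂ 𝔥 𝔤 h k = 0 := by
    intro h k
    have e := hz (h + k)
    simp only [map_add, LinearMap.add_apply, hz, LieModule.traceForm_comm ℂ 𝔥 𝔤 k h, zero_add,
      add_zero] at e
    rw [← two_mul] at e
    exact (mul_eq_zero.mp e).resolve_left two_ne_zero
  have hbot : ∀ h : 𝔥, h = 0 := fun h =>
    (LieAlgebra.IsKilling.traceForm_cartan_nondegenerate ℂ 𝔤 𝔥).1 h (hz2 h)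
  have hzero : ∀ x : 𝔤, x = 0 := by
    intro x
    have hx : x ∈ 𝔥 := by
      rw [← LieSubalgebra.IsCartanSubalgebra.self_normalizing (H := 𝔥),
        LieSubalgebra.mem_normalizer_iff]
      intro y hy
      have hy0 : y = 0 := congrArg Subtype.val (hbot ⟨y, hy⟩)
      rw [hy0, lie_zero]
      exact zero_mem 𝔥
    exact congrArg Subtype.val (hbot ⟨x, hx⟩)
  exact LieAlgebra.IsSimple.non_abelian (R := ℂ) (L := 𝔤) ⟨fun x y => hzero _⟩

namespace IsPolynomialAction

variable {hb : Module.Basis ι ℂ 𝔥}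
  {ρ : FullToroidalAlgebra c₁ c₂ n 𝔤 →ₗ[ℂ]
    Module.End ℂ (MvPolynomial (Fin n) (MvPolynomial ι ℂ))}

/-- The normal form of a polynomial action of `ℒ`. -/
theorem exists_normal_form [FiniteDimensional ℂ 𝔤] [LieAlgebra.IsSimple ℂ 𝔤]
    [𝔥.IsCartanSubalgebra] (H : IsPolynomialAction hb ρ) :
    ∃ (Λ : Fin n → ℂˣ) (a : ℂ), (∀ k f, ρ (cenElt c₁ c₂ 𝔤 k) f = 0) ∧
      (∀ r i f, ρ (wittElt c₁ c₂ 𝔤 r i) f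
        = shiftBy r f * (algebraMap ℂ _ (lamPow Λ r) * (X i - C (r i * C (a + 1))))) ∧
      ∀ r x y q, ρ (loopElt c₁ c₂ r x) (C y * map C q)
        = algebraMap ℂ _ (lamPow Λ r)
          * (C (constantCoeff (ρ (loopElt c₁ c₂ 0 x) (C y))) * shiftBy r (map C q)) := by
  obtain ⟨h, h0, hk⟩ := exists_killingForm_ne_zero 𝔥
  obtain ⟨Λ, β, hp, hβ⟩ := H.exists_witt_form h h0
  have hcen := H.cenElt_eq_zero h hk Λ hp
  obtain ⟨b, hb'⟩ := H.exists_linear_constant Λ β hβ hcen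
  have hw : ∀ r i f, ρ (wittElt c₁ c₂ 𝔤 r i) f
      = shiftBy r f * (algebraMap ℂ _ (lamPow Λ r) * (X i - C (r i * b))) := fun r i f => by
    rw [← hb', ← hβ, ← H.wittElt_mul, mul_one]
  obtain ⟨w, hw'⟩ : ∃ w : ℂ, ∀ r i f, ρ (wittElt c₁ c₂ 𝔤 r i) f
      = shiftBy r f * (algebraMap ℂ _ (lamPow Λ r) * (X i - C (r i * C w))) := by
    -- For n = 0 there are no Witt elements and any scalar will do.
    rcases isEmpty_or_nonempty (Fin n) with hn | ⟨⟨i⟩⟩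
    · exact ⟨0, fun _ i => hn.elim i⟩
    · obtain ⟨z, hz⟩ := H.exists_eq_C_of_comm h0 (b - b ^ 2)
        (H.loopElt_C_mul_of_witt_form Λ b i fun r f => hw r i f)
      obtain ⟨w, rfl⟩ := exists_eq_C_of_sub_sq b z hz
      exact ⟨w, hw⟩
  refine ⟨Λ, w - 1, hcen, by rwa [sub_add_cancel], fun r x y q => ?_⟩
  rw [mul_comm (C y), H.loopElt_map_mul, H.loopElt_eq_of_witt_form Λ w hw']
  ring

end IsPolynomialAction

/-- The `𝔤`-module structure given by an action by endomorphisms. -/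
abbrev lieRingModuleOfEnd {V : Type*} [AddCommGroup V] [Module ℂ V] (T : 𝔤 →ₗ[ℂ] Module.End ℂ V)
    (hT : ∀ x y v, T ⁅x, y⁆ v = T x (T y v) - T y (T x v)) : LieRingModule 𝔤 V where
  bracket x v := T x v
  add_lie x y v := by
    rw [map_add]
    rfl
  lie_add x v w := map_add (T x) v w
  leibniz_lie x y v := sub_eq_iff_eq_add.mp (hT x y v).symm

theorem lieModuleOfEnd {V : Type*} [AddCommGroup V] [Module ℂ V] (T : 𝔤 →ₗ[ℂ] Module.End ℂ V)
    (hT : ∀ x y v, T ⁅x, y⁆ v = T x (T y v) - T y (T x v)) :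
    @LieModule ℂ 𝔤 V _ _ _ _ _ (lieRingModuleOfEnd T hT) :=
  let _ := lieRingModuleOfEnd T hT
  { smul_lie := fun c x v => by
      change T (c • x) v = c • T x v
      rw [map_smul]
      rfl
    lie_smul := fun c x v => map_smul (T x) c v }

section

attribute [local instance 100] LieRing.ofAssociativeRing

/-- A module on `S(𝔥)` on which `𝔥` acts by multiplication is free of rank one. -/
theorem isFreeOfRankOne_mvPolynomial [IsLieAbelian 𝔥] (hb : Module.Basis ι ℂ 𝔥)
    [LieRingModule 𝔤 (MvPolynomial ι ℂ)] [LieModule ℂ 𝔤 (MvPolynomial ι ℂ)]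
    (h : ∀ (x : 𝔥) (f : MvPolynomial ι ℂ), ⁅(x : 𝔤), f⁆ = linearPoly hb x * f) :
    IsFreeOfRankOne 𝔥 (MvPolynomial ι ℂ) := by
  obtain ⟨e, he⟩ := UniversalEnvelopingAlgebra.exists_equiv_mvPolynomial hb
  refine ⟨e.toLinearEquiv, fun u v => ?_⟩
  have key : UniversalEnvelopingAlgebra.lift ℂ (LieModule.toEnd ℂ 𝔥 (MvPolynomial ι ℂ))
      = (Algebra.lmul ℂ (MvPolynomial ι ℂ)).comp e.toAlgHom := by
    apply UniversalEnvelopingAlgebra.hom_ext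
    refine LieHom.ext fun x => LinearMap.ext fun f => ?_
    change UniversalEnvelopingAlgebra.lift ℂ (LieModule.toEnd ℂ 𝔥 (MvPolynomial ι ℂ))
      (UniversalEnvelopingAlgebra.ι ℂ x) f = e (UniversalEnvelopingAlgebra.ι ℂ x) * f
    rw [UniversalEnvelopingAlgebra.lift_ι_apply, he]
    exact h x f
  rw [key]
  exact map_mul e u v

/-- A free module of rank one over `U(𝔟)`, `𝔟` abelian, is a polynomial ring on which a basis
of `𝔟` acts by multiplication. -/
theorem IsFreeOfRankOne.exists_equiv {𝔞 : Type*} [LieRing 𝔞] [LieAlgebra ℂ 𝔞]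
    {𝔟 : LieSubalgebra ℂ 𝔞} [IsLieAbelian 𝔟] (b : Module.Basis ι ℂ 𝔟) {M : Type*}
    [AddCommGroup M] [Module ℂ M] [LieRingModule 𝔞 M] [LieModule ℂ 𝔞 M]
    (hM : IsFreeOfRankOne 𝔟 M) :
    ∃ E : MvPolynomial ι ℂ ≃ₗ[ℂ] M, ∀ (x : 𝔟) (f : MvPolynomial ι ℂ),
      E (linearPoly b x * f) = ⁅(x : 𝔞), E f⁆ := by
  obtain ⟨e, he⟩ := UniversalEnvelopingAlgebra.exists_equiv_mvPolynomial b
  obtain ⟨E, hE⟩ := hM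
  refine ⟨e.symm.toLinearEquiv.trans E, fun x f => ?_⟩
  have e1 : e.symm (linearPoly b x) = UniversalEnvelopingAlgebra.ι ℂ x := by
    rw [AlgEquiv.symm_apply_eq, he]
    rfl
  change E (e.symm (linearPoly b x * f)) = ⁅(x : 𝔞), E (e.symm f)⁆
  rw [map_mul, e1, hE, UniversalEnvelopingAlgebra.lift_ι_apply]
  rfl

end

end FullToroidal

/-! ### A basis of `𝔥̃ₙ`. -/

namespace FullToroidalAlgebra

open FullToroidal

variable {n : ℕ} {𝔤 : Type*} [LieRing 𝔤] [LieAlgebra ℂ 𝔤] (c₁ c₂ : ℂ)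
  (𝔥 : LieSubalgebra ℂ 𝔤)

theorem cartanMap_loop (h : 𝔥) : cartanMap c₁ c₂ n 𝔥 (h, 0) = loopElt c₁ c₂ 0 (h : 𝔤) := by
  ext1
  · rfl
  · rfl
  · simp [cartanMap, loopElt]

theorem cartanMap_witt (i : Fin n) :
    cartanMap c₁ c₂ n 𝔥 (0, Pi.single i 1) = wittElt c₁ c₂ 𝔤 0 i := by
  ext1
  · simp [cartanMap, wittElt]
  · rfl
  · simp [cartanMap, wittElt, mono_zero, Pi.single_apply]

theorem one_tmul_injective {x : 𝔤} (h : (1 : Laurent n) ⊗ₜ[ℂ] x = 0) : x = 0 := by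
  have e := congrArg ((TensorProduct.lid ℂ 𝔤) ∘ (LinearMap.rTensor 𝔤 ((monoBasis n).coord 0))) h
  have e1 : (monoBasis n).coord 0 (1 : Laurent n) = 1 := by
    rw [← mono_zero, ← monoBasis_apply]
    simp
  simpa [e1] using e

theorem cartanMap_injective : Function.Injective (cartanMap c₁ c₂ n 𝔥) := by
  rw [← LinearMap.ker_eq_bot, LinearMap.ker_eq_bot']
  rintro ⟨x, w⟩ h
  have h1 : (1 : Laurent n) ⊗ₜ[ℂ] (x : 𝔤) = 0 := congrArg loop h
  have h2 : (∑ i, w i • euler i : Witt n) = 0 := congrArg der h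
  have hone : (1 : Laurent n) ≠ 0 := by
    rw [← mono_zero, ← monoBasis_apply]
    exact (monoBasis n).ne_zero 0
  refine Prod.ext (Subtype.ext (one_tmul_injective h1)) (funext fun j => ?_)
  have h3 := coef_sum_euler w j
  rw [h2, map_zero] at h3
  exact (smul_eq_zero.mp h3.symm).resolve_right hone

/-- The linear map from `𝔥 ⊕ ℂⁿ` to `𝔥̃ₙ`. -/
def cartanLin : (𝔥 × (Fin n → ℂ)) →ₗ[ℂ] cartan c₁ c₂ n 𝔥 where
  toFun p := ⟨cartanMap c₁ c₂ n 𝔥 p, ⟨p, rfl⟩⟩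
  map_add' p q := Subtype.ext (map_add (cartanMap c₁ c₂ n 𝔥) p q)
  map_smul' c p := Subtype.ext (map_smul (cartanMap c₁ c₂ n 𝔥) c p)

/-- The linear equivalence of `𝔥 ⊕ ℂⁿ` with `𝔥̃ₙ`. -/
def cartanEquiv : (𝔥 × (Fin n → ℂ)) ≃ₗ[ℂ] cartan c₁ c₂ n 𝔥 :=
  LinearEquiv.ofBijective (cartanLin c₁ c₂ 𝔥)
    ⟨fun _ _ h => cartanMap_injective c₁ c₂ 𝔥 (congrArg Subtype.val h),
      fun ⟨_, p, hp⟩ => ⟨p, Subtype.ext hp⟩⟩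

theorem cartanEquiv_coe (p : 𝔥 × (Fin n → ℂ)) :
    (cartanEquiv c₁ c₂ 𝔥 p : FullToroidalAlgebra c₁ c₂ n 𝔤) = cartanMap c₁ c₂ n 𝔥 p := rfl

instance isLieAbelian_cartan [IsLieAbelian 𝔥] : IsLieAbelian (cartan c₁ c₂ n 𝔥) := by
  refine ⟨?_⟩
  rintro ⟨_, ⟨x, w⟩, rfl⟩ ⟨_, ⟨y, w'⟩, rfl⟩
  apply Subtype.ext
  change ⁅cartanMap c₁ c₂ n 𝔥 (x, w), cartanMap c₁ c₂ n 𝔥 (y, w')⁆ = 0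
  have hxy : ⁅(x : 𝔤), (y : 𝔤)⁆ = 0 := by
    rw [← LieSubalgebra.coe_bracket, trivial_lie_zero]
    rfl
  ext1
  · simp [cartanMap, loop_lie, derLoop_tmul, hxy]
  · simp [cartanMap, cen_lie, loopCocycle_tmul, phi, phi₁_eq, phi₂_eq, jac_sum_euler, trPair,
      dClass_one]
  · simp [cartanMap, der_lie, sum_euler_comm]

variable {𝔥} in
/-- The basis of `𝔥̃ₙ` given by a basis of `𝔥` and the `dᵢ`. -/
def cartanBasis {ι : Type*} (hb : Module.Basis ι ℂ 𝔥) :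
    Module.Basis (Fin n ⊕ ι) ℂ (cartan c₁ c₂ n 𝔥) :=
  ((hb.prod (Pi.basisFun ℂ (Fin n))).map (cartanEquiv c₁ c₂ 𝔥)).reindex (Equiv.sumComm _ _)

variable {𝔥} in
theorem cartanBasis_inl {ι : Type*} (hb : Module.Basis ι ℂ 𝔥) (i : Fin n) :
    cartanBasis c₁ c₂ hb (Sum.inl i) = cartanEquiv c₁ c₂ 𝔥 (0, Pi.single i 1) := by
  simp [cartanBasis]

variable {𝔥} in
theorem cartanBasis_inr {ι : Type*} (hb : Module.Basis ι ℂ 𝔥) (k : ι) :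
    cartanBasis c₁ c₂ (n := n) hb (Sum.inr k) = cartanEquiv c₁ c₂ 𝔥 (hb k, 0) := by
  simp [cartanBasis]

end FullToroidalAlgebra

/-! ### Transport to polynomials and comparison with `M̂(Λ, a, V)`. -/

namespace FullToroidal

open MvPolynomial FullToroidalAlgebra

variable {c₁ c₂ : ℂ} {n : ℕ} {𝔤 : Type*} [LieRing 𝔤] [LieAlgebra ℂ 𝔤] {𝔥 : LieSubalgebra ℂ 𝔤}
  {ι : Type*}

/-- The action on polynomials obtained by transport of structure. -/
def transportAction {P M : Type*} [AddCommGroup P] [Module ℂ P] [AddCommGroup M] [Module ℂ M]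
    [LieRingModule 𝔤 M] [LieModule ℂ 𝔤 M] (F : P ≃ₗ[ℂ] M) : 𝔤 →ₗ[ℂ] Module.End ℂ P where
  toFun X := F.symm.toLinearMap ∘ₗ (LieModule.toEnd ℂ 𝔤 M X) ∘ₗ F.toLinearMap
  map_add' X Y := by ext; simp
  map_smul' c X := by ext; simp

theorem transportAction_apply {P M : Type*} [AddCommGroup P] [Module ℂ P] [AddCommGroup M]
    [Module ℂ M] [LieRingModule 𝔤 M] [LieModule ℂ 𝔤 M] (F : P ≃ₗ[ℂ] M) (X : 𝔤) (f : P) :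
    transportAction F X f = F.symm ⁅X, F f⁆ := rfl

/-- The polynomial ring in a basis of `𝔥̃ₙ` is regrouped as polynomials in the `dᵢ` over `S(𝔥)`, so
that degrees in the `dᵢ` can be counted with coefficients in a domain. -/
theorem exists_polynomialAction [IsLieAbelian 𝔥] (hb : Module.Basis ι ℂ 𝔥) {M : Type*}
    [AddCommGroup M] [Module ℂ M] [LieRingModule (FullToroidalAlgebra c₁ c₂ n 𝔤) M]
    [LieModule ℂ (FullToroidalAlgebra c₁ c₂ n 𝔤) M]
    (hM : IsFreeOfRankOne (FullToroidalAlgebra.cartan c₁ c₂ n 𝔥) M) :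
    ∃ F : MvPolynomial (Fin n) (MvPolynomial ι ℂ) ≃ₗ[ℂ] M,
      IsPolynomialAction hb (transportAction (𝔤 := FullToroidalAlgebra c₁ c₂ n 𝔤) F) := by
  obtain ⟨E, hE⟩ := IsFreeOfRankOne.exists_equiv (cartanBasis c₁ c₂ (n := n) hb) hM
  let s := sumAlgEquiv ℂ (Fin n) ι
  refine ⟨s.symm.toLinearEquiv.trans E, ⟨fun X Y f => ?_, fun i f => ?_, fun h f => ?_⟩⟩
  · simp only [transportAction_apply, LinearEquiv.apply_symm_apply, lie_lie, map_sub]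
  · rw [transportAction_apply, LinearEquiv.symm_apply_eq]
    change _ = E (s.symm (X i * f))
    have e := hE (cartanBasis c₁ c₂ hb (Sum.inl i)) (s.symm f)
    rw [linearPoly_basis, cartanBasis_inl, cartanEquiv_coe, cartanMap_witt] at e
    refine e.symm.trans ?_
    have e1 : s (X (Sum.inl i)) = X i := sumAlgEquiv_X_inl _ _ _ i
    rw [map_mul s.symm, ← e1, AlgEquiv.symm_apply_apply]
  · rw [transportAction_apply, LinearEquiv.symm_apply_eq]
    change _ = E (s.symm (C (linearPoly hb h) * f))
    have e := hE (cartanEquiv c₁ c₂ 𝔥 (h, 0)) (s.symm f)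
    rw [cartanEquiv_coe, cartanMap_loop] at e
    have e2 : s.toLinearMap ∘ₗ linearPoly (cartanBasis c₁ c₂ (n := n) hb)
        ∘ₗ (cartanEquiv c₁ c₂ 𝔥).toLinearMap ∘ₗ LinearMap.inl ℂ 𝔥 (Fin n → ℂ)
        = (IsScalarTower.toAlgHom ℂ (MvPolynomial ι ℂ)
            (MvPolynomial (Fin n) (MvPolynomial ι ℂ))).toLinearMap ∘ₗ linearPoly hb := by
      apply hb.ext
      intro k
      simp only [LinearMap.comp_apply, LinearMap.inl_apply, LinearEquiv.coe_coe, linearPoly_basis,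
        ← cartanBasis_inr]
      exact sumAlgEquiv_X_inr _ _ _ k
    have e3 : s (linearPoly (cartanBasis c₁ c₂ (n := n) hb) (cartanEquiv c₁ c₂ 𝔥 (h, 0)))
        = C (linearPoly hb h) := DFunLike.congr_fun e2 h
    refine e.symm.trans ?_
    rw [map_mul s.symm, ← e3, AlgEquiv.symm_apply_apply]

theorem shiftBy_map_C (r : Fin n → ℤ) (q : MvPolynomial (Fin n) ℂ) :
    shiftBy r (map C q : MvPolynomial (Fin n) (MvPolynomial ι ℂ)) = map C (tau r q) := by
  induction q using MvPolynomial.induction_on with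
  | C c => rw [map_C, shiftBy_C, tau, aeval_C, MvPolynomial.algebraMap_eq, map_C]
  | add p q hp hq => rw [map_add, map_add, hp, hq, map_add, map_add]
  | mul_X p j hp =>
    rw [map_mul, map_mul, hp, map_mul, map_mul, map_X, shiftBy_X, tau, aeval_X, map_sub, map_X,
      map_C, map_intCast, map_intCast]

theorem witt_eq_sum (D : Witt n) : D = ∑ i, coef i D • euler i := by
  ext1 f
  rw [witt_apply, witt_apply (∑ i, coef i D • euler i)]
  refine Finset.sum_congr rfl fun i _ => ?_
  simp [map_sum, coef_smul_euler]

theorem eq_loop_add_cen_add_der (X : FullToroidalAlgebra c₁ c₂ n 𝔤) :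
    X = ⟨X.loop, 0, 0⟩ + cenElt c₁ c₂ 𝔤 X.cen + ⟨0, 0, X.der⟩ := by
  ext1 <;> simp [cenElt]

/-- Two linear maps on `ℒ` agree if they agree on the elements `x(r)`, `𝒦_A` and `t^r dᵢ`. -/
theorem linearMap_ext {W : Type*} [AddCommGroup W] [Module ℂ W]
    {φ ψ : FullToroidalAlgebra c₁ c₂ n 𝔤 →ₗ[ℂ] W}
    (hl : ∀ r x, φ (loopElt c₁ c₂ r x) = ψ (loopElt c₁ c₂ r x))
    (hc : ∀ k, φ (cenElt c₁ c₂ 𝔤 k) = ψ (cenElt c₁ c₂ 𝔤 k))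
    (hw : ∀ r i, φ (wittElt c₁ c₂ 𝔤 r i) = ψ (wittElt c₁ c₂ 𝔤 r i)) : φ = ψ := by
  let jl : Laurent n ⊗[ℂ] 𝔤 →ₗ[ℂ] FullToroidalAlgebra c₁ c₂ n 𝔤 :=
    { toFun := fun L => ⟨L, 0, 0⟩
      map_add' := fun _ _ => by ext1 <;> simp
      map_smul' := fun _ _ => by ext1 <;> simp }
  let jd : Witt n →ₗ[ℂ] FullToroidalAlgebra c₁ c₂ n 𝔤 :=
    { toFun := fun D => ⟨0, 0, D⟩
      map_add' := fun _ _ => by ext1 <;> simp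
      map_smul' := fun _ _ => by ext1 <;> simp }
  have h1 : ∀ L, φ (jl L) = ψ (jl L) := by
    intro L
    induction L with
    | zero => simp
    | add L L' h h' => simp only [map_add, h, h']
    | tmul f x =>
      induction f using laurent_induction with
      | hm r => exact hl r x
      | ha f g hf hg => simp only [TensorProduct.add_tmul, map_add, hf, hg]
      | hs c f hf => simp only [← TensorProduct.smul_tmul', map_smul, hf]
  have h2 : ∀ D, φ (jd D) = ψ (jd D) := by
    intro D
    rw [witt_eq_sum D]
    simp only [map_sum]
    refine Finset.sum_congr rfl fun i _ => ?_
    induction coef i D using laurent_induction with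
    | hm r => exact hw r i
    | ha f g hf hg => simp only [add_smul, map_add, hf, hg]
    | hs c f hf => simp only [smul_assoc, map_smul, hf]
  refine LinearMap.ext fun X => ?_
  rw [eq_loop_add_cen_add_der X, map_add, map_add, map_add, map_add, hc]
  congr 1
  · congr 1
    exact h1 X.loop
  · exact h2 X.der

theorem exists_hatModule_linearEquiv {M : Type*} [AddCommGroup M] [Module ℂ M]
    (F : MvPolynomial (Fin n) (MvPolynomial ι ℂ) ≃ₗ[ℂ] M) (Λ : Fin n → ℂˣ) (a : ℂ) :
    ∃ G : HatModule Λ a (MvPolynomial ι ℂ) ≃ₗ[ℂ] M,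
      ∀ v p, G (HatModule.tmul Λ a v p) = F (C v * map C p) := by
  refine ⟨((algebraTensorAlgEquiv ℂ (MvPolynomial ι ℂ)
    (σ := Fin n)).toLinearEquiv.restrictScalars ℂ).trans F, fun v p => ?_⟩
  change F (algebraTensorAlgEquiv ℂ (MvPolynomial ι ℂ) (v ⊗ₜ[ℂ] p)) = _
  rw [algebraTensorAlgEquiv_tmul, MvPolynomial.smul_eq_C_mul]
  rfl

theorem hatModule_induction {V : Type*} [AddCommGroup V] [Module ℂ V] {Λ : Fin n → ℂˣ} {a : ℂ}
    {P : HatModule Λ a V → Prop} (m : HatModule Λ a V) (h0 : P 0)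
    (ht : ∀ v p, P (HatModule.tmul Λ a v p)) (ha : ∀ m m', P m → P m' → P (m + m')) : P m :=
  TensorProduct.induction_on (motive := P) m h0 ht ha

/-- A linear equivalence of an `ℒ`-module with `M̂(Λ, a, V)` is a module isomorphism if it
commutes with the elements `x(r)`, `𝒦_A` and `t^r dᵢ`. -/
theorem nonempty_lieModuleEquiv {V M : Type*} [AddCommGroup V] [Module ℂ V] [LieRingModule 𝔤 V]
    [LieModule ℂ 𝔤 V] [AddCommGroup M] [Module ℂ M]
    [LieRingModule (FullToroidalAlgebra c₁ c₂ n 𝔤) M]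
    [LieModule ℂ (FullToroidalAlgebra c₁ c₂ n 𝔤) M] {Λ : Fin n → ℂˣ} {a : ℂ}
    (G : HatModule Λ a V ≃ₗ[ℂ] M)
    (hl : ∀ (r : Fin n → ℤ) (x : 𝔤) (v : V) p, ⁅loopElt c₁ c₂ r x, G (HatModule.tmul Λ a v p)⁆
      = lamPow Λ r • G (HatModule.tmul Λ a ⁅x, v⁆ (tau r p)))
    (hc : ∀ (k : KA n) m, ⁅cenElt c₁ c₂ 𝔤 k, G m⁆ = 0)
    (hw : ∀ (r : Fin n → ℤ) i (v : V) p, ⁅wittElt c₁ c₂ 𝔤 r i, G (HatModule.tmul Λ a v p)⁆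
      = lamPow Λ r • G (HatModule.tmul Λ a v
          (tau r p * (X i - C ((r i : ℂ) * (a + 1)))))) :
    Nonempty (M ≃ₗ⁅ℂ, FullToroidalAlgebra c₁ c₂ n 𝔤⁆ HatModule Λ a V) := by
  have hlie : ∀ (Y : FullToroidalAlgebra c₁ c₂ n 𝔤) m, G ⁅Y, m⁆ = ⁅Y, G m⁆ := by
    intro Y m
    induction m using hatModule_induction with
    | h0 => rw [lie_zero, map_zero, lie_zero]
    | ha m m' h h' => rw [lie_add, map_add, map_add, lie_add, h, h']
    | ht v p =>
      let φ : FullToroidalAlgebra c₁ c₂ n 𝔤 →ₗ[ℂ] M :=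
        { toFun := fun Y => G ⁅Y, HatModule.tmul Λ a v p⁆
          map_add' := fun _ _ => by rw [add_lie, map_add]
          map_smul' := fun _ _ => by rw [smul_lie, map_smul, RingHom.id_apply] }
      let ψ : FullToroidalAlgebra c₁ c₂ n 𝔤 →ₗ[ℂ] M :=
        { toFun := fun Y => ⁅Y, G (HatModule.tmul Λ a v p)⁆
          map_add' := fun _ _ => add_lie _ _ _
          map_smul' := fun _ _ => smul_lie _ _ _ }
      have e : φ = ψ := by
        apply linearMap_ext
        · intro r x
          refine Eq.trans ?_ (hl r x v p).symm
          exact (congrArg G (HatModule.lie_loop Λ a V r x v p)).trans (map_smul G _ _)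
        · intro k
          refine Eq.trans ?_ (hc k _).symm
          exact (congrArg G (HatModule.lie_cen Λ a V k _)).trans (map_zero G)
        · intro r i
          refine Eq.trans ?_ (hw r i v p).symm
          exact (congrArg G (HatModule.lie_witt Λ a V r i v p)).trans (map_smul G _ _)
      exact DFunLike.congr_fun e Y
  exact ⟨LieModuleEquiv.symm { G with map_lie' := fun {Y m} => hlie Y m }⟩

theorem nonempty_equiv_hatModule {M : Type*}
    [AddCommGroup M] [Module ℂ M] [LieRingModule (FullToroidalAlgebra c₁ c₂ n 𝔤) M]
    [LieModule ℂ (FullToroidalAlgebra c₁ c₂ n 𝔤) M]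
    [LieRingModule 𝔤 (MvPolynomial ι ℂ)] [LieModule ℂ 𝔤 (MvPolynomial ι ℂ)]
    (F : MvPolynomial (Fin n) (MvPolynomial ι ℂ) ≃ₗ[ℂ] M) (Λ : Fin n → ℂˣ) (a : ℂ)
    (hc : ∀ (k : KA n) f, ⁅cenElt c₁ c₂ 𝔤 k, F f⁆ = 0)
    (hw : ∀ (r : Fin n → ℤ) i f, ⁅wittElt c₁ c₂ 𝔤 r i, F f⁆
      = F (shiftBy r f * (algebraMap ℂ _ (lamPow Λ r)
          * (X i - C ((r i : MvPolynomial ι ℂ) * C (a + 1))))))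
    (hl : ∀ (r : Fin n → ℤ) (x : 𝔤) (y : MvPolynomial ι ℂ) q,
      ⁅loopElt c₁ c₂ r x, F (C y * map C q)⁆
        = F (algebraMap ℂ _ (lamPow Λ r) * (C ⁅x, y⁆ * shiftBy r (map C q)))) :
    Nonempty (M ≃ₗ⁅ℂ, FullToroidalAlgebra c₁ c₂ n 𝔤⁆ HatModule Λ a (MvPolynomial ι ℂ)) := by
  obtain ⟨G, hG⟩ := exists_hatModule_linearEquiv F Λ a
  refine nonempty_lieModuleEquiv G (fun r x v p => ?_) (fun k m => ?_) (fun r i v p => ?_)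
  · rw [hG, hG, hl, ← map_smul F, Algebra.smul_def, shiftBy_map_C]
  · rw [← F.apply_symm_apply (G m), hc]
  · have e : (map C (tau r p * (X i - C ((r i : ℂ) * (a + 1)))) :
        MvPolynomial (Fin n) (MvPolynomial ι ℂ))
        = map C (tau r p) * (X i - C ((r i : MvPolynomial ι ℂ) * C (a + 1))) := by
      rw [map_mul, map_sub, map_X, map_C, C_mul (σ := ι), map_intCast]
    rw [hG, hG, hw, ← map_smul F, Algebra.smul_def, map_mul (shiftBy r), shiftBy_C, shiftBy_map_C,
      e]
    exact congrArg F (by rw [← mul_assoc (C v), mul_left_comm])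

end FullToroidal

end

theorem mainTheorem2 {𝔤 : Type u} [LieRing 𝔤] [LieAlgebra ℂ 𝔤] [FiniteDimensional ℂ 𝔤]
    [LieAlgebra.IsSimple ℂ 𝔤] (𝔥 : LieSubalgebra ℂ 𝔤) [𝔥.IsCartanSubalgebra]
    (n : ℕ) (c₁ c₂ : ℂ)
    (M : Type v) [AddCommGroup M] [Module ℂ M] [LieRingModule (FullToroidalAlgebra c₁ c₂ n 𝔤) M]
    [LieModule ℂ (FullToroidalAlgebra c₁ c₂ n 𝔤) M]
    (hM : IsFreeOfRankOne (FullToroidalAlgebra.cartan c₁ c₂ n 𝔥) M) :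
    ∃ (Λ : Fin n → ℂˣ) (a : ℂ) (V : Type u) (_ : AddCommGroup V) (_ : Module ℂ V)
      (_ : LieRingModule 𝔤 V) (_ : LieModule ℂ 𝔤 V),
      IsFreeOfRankOne 𝔥 V ∧
        Nonempty (M ≃ₗ⁅ℂ, FullToroidalAlgebra c₁ c₂ n 𝔤⁆ HatModule Λ a V) := by
  let hb := Module.Free.chooseBasis ℂ 𝔥
  obtain ⟨F, H⟩ := FullToroidal.exists_polynomialAction hb hM
  obtain ⟨Λ, a, hc, hw, hl⟩ := H.exists_normal_form
  set ρ := FullToroidal.transportAction (𝔤 := FullToroidalAlgebra c₁ c₂ n 𝔤) F with hρ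
  have hF : ∀ X f, ⁅X, F f⁆ = F (ρ X f) := fun X f => by
    rw [hρ, FullToroidal.transportAction_apply, LinearEquiv.apply_symm_apply]
  -- The module `M_𝔤` is `S(𝔥)` inside the polynomial ring. Taking the constant term in the `dᵢ`
  -- loses nothing, because `x(0)` preserves `S(𝔥)`.
  let T : 𝔤 →ₗ[ℂ] Module.End ℂ (MvPolynomial (Module.Free.ChooseBasisIndex ℂ 𝔥) ℂ) :=
    LinearMap.mk₂ ℂ
      (fun x y => MvPolynomial.constantCoeff
        (ρ (FullToroidalAlgebra.loopElt c₁ c₂ 0 x) (MvPolynomial.C y)))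
      (fun x x' y => by rw [FullToroidalAlgebra.loopElt_add, map_add, LinearMap.add_apply, map_add])
      (fun c x y => by
        rw [FullToroidalAlgebra.loopElt_smul, map_smul, LinearMap.smul_apply,
          MvPolynomial.constantCoeff_smul])
      (fun x y y' => by rw [map_add, map_add, map_add])
      (fun c x y => by
        rw [← MvPolynomial.constantCoeff_smul, ← map_smul]
        congr 2
        rw [MvPolynomial.smul_eq_C_mul, map_mul, Algebra.smul_def]
        rfl)
  have hT : ∀ x y, ρ (FullToroidalAlgebra.loopElt c₁ c₂ 0 x) (MvPolynomial.C y)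
      = MvPolynomial.C (T x y) := by
    intro x y
    -- The normal form at r = 0 and q = 1 is exactly this stability.
    have e := hl 0 x y 1
    rw [map_one, mul_one, map_one, mul_one, FullToroidal.lamPow_zero, map_one, one_mul] at e
    exact e
  have hTlie : ∀ x y v, T ⁅x, y⁆ v = T x (T y v) - T y (T x v) := by
    intro x y v
    apply MvPolynomial.C_injective (Fin n)
    rw [map_sub, ← hT, ← hT, ← hT, ← hT, ← hT, H.loopElt_zero_lie]
  let _ : LieRingModule 𝔤 (MvPolynomial (Module.Free.ChooseBasisIndex ℂ 𝔥) ℂ) :=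
    FullToroidal.lieRingModuleOfEnd T hTlie
  have _ : LieModule ℂ 𝔤 (MvPolynomial (Module.Free.ChooseBasisIndex ℂ 𝔥) ℂ) :=
    FullToroidal.lieModuleOfEnd T hTlie
  refine ⟨Λ, a, MvPolynomial (Module.Free.ChooseBasisIndex ℂ 𝔥) ℂ, inferInstance, inferInstance,
    inferInstance, inferInstance, ?_, ?_⟩
  · apply FullToroidal.isFreeOfRankOne_mvPolynomial hb
    intro h f
    apply MvPolynomial.C_injective (Fin n)
    rw [map_mul, ← H.cartan]
    exact (hT h f).symm
  · apply FullToroidal.nonempty_equiv_hatModule F Λ a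
    · intro k f
      rw [hF, hc, map_zero]
    · intro r i f
      rw [hF, hw]
    · intro r x y q
      rw [hF, hl]
      rfl
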